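/- Let $N\ge 1$, $p=p_F:=1+\frac2N$, $A\ge \frac{2}{p-1}=N$ and $\phi(x)=(1+|x|)^{-A}$ on $\mathbf R^N$. For $0<\alpha<1$ consider the time-fractional Cauchy problem $$\partial_t^\alpha u-\Delta u=u^p\ \text{ in }(0,T)\times\mathbf R^N,\qquad u(0)=\mu ,$$ where $\partial_t^\alpha$ is the Caputo derivative and $\mu$ is a nonnegative Radon measure. A solution in $[0,T]\times\mathbf R^N$ is a nonnegative measurable $u$ with $$\infty>u(t,x)=[P_\alpha(t)\mu](x)+\alpha\int_0^t(t-s)^{\alpha-1}[S_\alpha(t-s)u(s)^p](x)\,ds\quad\text{for a.a. }t\in(0,T],\ x\in\mathbf R^N,$$ where $P_\alpha(t)=\int_0^\infty h_\alpha(\theta)e^{t^\alpha\theta\Delta}\,d\theta$, $S_\alpha(t)=\int_0^\infty\theta h_\alpha(\theta)e^{t^\alpha\theta\Delta}\,d\theta$, $e^{t\Delta}$ is the heat semigroup on $\mathbf R^N$, and $h_\alpha(\theta)=\sum_{n\ge0}\frac{(-\theta)^n}{n!\,\Gamma(1-\alpha-\alpha n)}$ is the probability density on $(0,\infty)$ with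 $\int_0^\infty h_\alpha(\theta)e^{z\theta}d\theta=\sum_{k\ge0}\frac{z^k}{\Gamma(\alpha k+1)}$. The minimal solution is the solution that is a.e. bounded above by every other solution in $[0,T]\times\mathbf R^N$, and the life span $T_\alpha[\mu]\in[0,\infty]$ is the supremum of all $T>0$ such that the minimal solution exists in $[0,T]\times\mathbf R^N$. (i) Let $A>N$. Then for each $\alpha\in(0,1)$ there is $K(\alpha)>0$ such that $T_\alpha[\kappa\phi]=\infty$ whenever $0<\kappa<K(\alpha)$, while $0<T_\alpha[\kappa\phi]<\infty$ and $$T_\alpha[\kappa\phi]^{\frac{\alpha-1}{2}}\log T_\alpha[\kappa\phi]\le C\kappa^{-(p-1)}$$ whenever $\kappa>K(\alpha)$. Here $C>0$ is independent of $\kappa$ and is uniform in $\alpha$ away from $0$: for every $\alpha_0\in(0,1)$ one $C=C(N,A,\alpha_0)$ serves for all $\alpha\in[\alpha_0,1)$. (ii) Let $A=N$. Then for every $\alpha_0\in(0,1)$ there are $C>0$ and $\kappa_0>0$, depending only on $N$ and $\alpha_0$, such that for all $\alpha\in[\alpha_0,1)$ and all $0<\kappa<\kappa_0$ one has $0<T_\alpha[\kappa\phi]<\infty$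 and $$T_\alpha[\kappa\phi]^{\frac{\alpha-1}{2p}}\log T_\alpha[\kappa\phi]\le C\kappa^{-\frac{p-1}{p}} .$$ -/

import Mathlib

open MeasureTheory
open scoped ENNReal

noncomputable section

namespace TimeFractionalFujita

/-- The Fujita exponent `1 + 2 / N`. -/
def fujitaExponent (N : ℕ) : ℝ := 1 + 2 / (N : ℝ)

/-- The heat kernel `G(t, x) = (4πt)^{-N/2} exp(-|x|² / (4t))` on `ℝ^N`, for `t > 0`. -/
def heatKernel {N : ℕ} (t : ℝ) (x : EuclideanSpace ℝ (Fin N)) : ℝ :=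
  (4 * Real.pi * t) ^ (-((N : ℝ) / 2)) * Real.exp (-‖x‖ ^ 2 / (4 * t))

/-- The heat semigroup `e^{tΔ}μ(x) = ∫ G(t, x - y) dμ(y)` applied to a nonnegative measure `μ`;
the value is in `[0, ∞]`. A nonnegative function `f` is identified with the measure `f dx`,
that is, with `volume.withDensity f`. -/
def heatSemigroup {N : ℕ} (t : ℝ) (μ : Measure (EuclideanSpace ℝ (Fin N)))
    (x : EuclideanSpace ℝ (Fin N)) : ℝ≥0∞ :=
  ∫⁻ y, ENNReal.ofReal (heatKernel t (x - y)) ∂μ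

/-- The M-Wright (Mainardi) function
`h_α(θ) = ∑_{n ≥ 0} (-θ)^n / (n! Γ(1 - α - αn))`, for `0 < α < 1`. It is the positive probability
density on `(0, ∞)` with `∫ h_α(θ) e^{zθ} dθ = E_{α,1}(z)` (Mittag-Leffler function). The
convention `1 / Γ(-k) = 0` for `k = 0, 1, 2, …` used in the series is the one that `Real.Gamma`
obeys. -/
def wrightDensity (α θ : ℝ) : ℝ :=
  ∑' n : ℕ, (-θ) ^ n / ((n.factorial : ℝ) * Real.Gamma (1 - α - α * (n : ℝ)))

/-- `[P_α(t)μ](x) = ∫_0^∞ h_α(θ) [e^{t^α θ Δ}μ](x) dθ`. -/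
def operatorP {N : ℕ} (α t : ℝ) (μ : Measure (EuclideanSpace ℝ (Fin N)))
    (x : EuclideanSpace ℝ (Fin N)) : ℝ≥0∞ :=
  ∫⁻ θ in Set.Ioi (0 : ℝ),
    ENNReal.ofReal (wrightDensity α θ) * heatSemigroup (t ^ α * θ) μ x

/-- `[S_α(t)μ](x) = ∫_0^∞ θ h_α(θ) [e^{t^α θ Δ}μ](x) dθ`. -/
def operatorS {N : ℕ} (α t : ℝ) (μ : Measure (EuclideanSpace ℝ (Fin N)))
    (x : EuclideanSpace ℝ (Fin N)) : ℝ≥0∞ :=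
  ∫⁻ θ in Set.Ioi (0 : ℝ),
    ENNReal.ofReal (θ * wrightDensity α θ) * heatSemigroup (t ^ α * θ) μ x

/-- The right-hand side of the integral equation:
`[P_α(t)μ](x) + α ∫_0^t (t - s)^{α-1} [S_α(t - s) u(s)^p](x) ds`. -/
def mildRHS {N : ℕ} (p α : ℝ) (μ : Measure (EuclideanSpace ℝ (Fin N)))
    (u : ℝ → EuclideanSpace ℝ (Fin N) → ℝ≥0∞) (t : ℝ) (x : EuclideanSpace ℝ (Fin N)) : ℝ≥0∞ :=
  operatorP α t μ x
    + ENNReal.ofReal α * ∫⁻ s in Set.Ioo (0 : ℝ) t,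
        ENNReal.ofReal ((t - s) ^ (α - 1))
          * operatorS α (t - s) (volume.withDensity fun y => u s y ^ p) x

/-- `u` is a (nonnegative, mild) solution of `∂_t^α u - Δu = u^p`, `u(0) = μ`, in
`[0, T] × ℝ^N`: it is measurable, and for almost all `t ∈ (0, T]` and `x` it satisfies
`∞ > u(t, x) = (right-hand side of the integral equation)`. Only the values of `u` on
`(0, T] × ℝ^N` matter. -/
structure IsSolution {N : ℕ} (p α T : ℝ) (μ : Measure (EuclideanSpace ℝ (Fin N)))
    (u : ℝ → EuclideanSpace ℝ (Fin N) → ℝ≥0∞) : Prop where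
  measurable : Measurable fun z : ℝ × EuclideanSpace ℝ (Fin N) => u z.1 z.2
  eq_mildRHS : ∀ᵐ t ∂(volume.restrict (Set.Ioc (0 : ℝ) T)),
    ∀ᵐ x ∂(volume : Measure (EuclideanSpace ℝ (Fin N))),
      u t x < ∞ ∧ u t x = mildRHS p α μ u t x

/-- `u` is the minimal solution in `[0, T] × ℝ^N`: a solution which lies almost everywhere below
every other solution in `[0, T] × ℝ^N`. -/
structure IsMinimalSolution {N : ℕ} (p α T : ℝ) (μ : Measure (EuclideanSpace ℝ (Fin N)))
    (u : ℝ → EuclideanSpace ℝ (Fin N) → ℝ≥0∞) : Prop where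
  isSolution : IsSolution p α T μ u
  le_solution : ∀ v : ℝ → EuclideanSpace ℝ (Fin N) → ℝ≥0∞, IsSolution p α T μ v →
    ∀ᵐ t ∂(volume.restrict (Set.Ioc (0 : ℝ) T)),
      ∀ᵐ x ∂(volume : Measure (EuclideanSpace ℝ (Fin N))), u t x ≤ v t x

/-- The life span `T_α[μ] ∈ [0, ∞]`: the supremum of all `T > 0` such that the minimal solution
exists in `[0, T] × ℝ^N`. -/
def lifeSpan {N : ℕ} (p α : ℝ) (μ : Measure (EuclideanSpace ℝ (Fin N))) : ℝ≥0∞ :=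
  sSup {τ : ℝ≥0∞ | ∃ T : ℝ, 0 < T ∧ τ = ENNReal.ofReal T ∧
    ∃ u : ℝ → EuclideanSpace ℝ (Fin N) → ℝ≥0∞, IsMinimalSolution p α T μ u}

/-- The initial datum `κφ`, `φ(x) = (1 + |x|)^{-A}`, as the measure `κφ dx` on `ℝ^N`. -/
def decayingDatum (N : ℕ) (A κ : ℝ) : Measure (EuclideanSpace ℝ (Fin N)) :=
  volume.withDensity fun x => ENNReal.ofReal (κ * (1 + ‖x‖) ^ (-A))

end TimeFractionalFujita

end

noncomputable section

namespace TimeFractionalFujita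
-- The Gamma integral for complex rates
section

/-! Everything about the life span is read off from the increasing limit of the Picard iterates
started at 0. By monotone convergence it satisfies the integral equation at every point, with values
in [0, ∞], and it lies below every supersolution. So a minimal solution exists on [0, T] exactly
when this limit is a.e. finite there (`exists_isMinimalSolution_iff`). The life span is therefore
antitone in the datum, and it is positive for bounded data, which have a constant supersolution for
a short time. For A > N the threshold K(α) is the supremum of the sizes κ with infinite life span;
it must be shown positive and finite.

Global existence (`exists_finiteUpTo_of_small_mass`). At the Fujita exponent (N/2)(p - 1) = 1, so
the heat semigroup maps a measure μ into L^p with norm at most τ^(-1/p) μ(ℝ^N). A bound on t^(α/p)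
‖u(t)‖_p then reproduces itself under the integral equation when the mass is small: the Duhamel term
produces ∫ (t-s)^(α-1-α/p) s^(-α) ds = c t^(-α/p). This converges because α < 1; at α = 1 it
diverges at s = 0, which is the classical Fujita obstruction. For A > N, small κ means small mass.

Upper bounds (`exists_log_mul_rpow_le`). Let z(t) be a lower bound for the integral of u(t) over the
ball of radius t^(α/2), made of the initial mass and the accumulated integral of u^p. Hölder on this
ball and the bound (t-s)^(α-1) ≥ T^(α-1) give z' ≥ k z^p / t on [T₁, T], as long as (1-α) log(T/T₁)
≤ 1. Such a z blows up in finite logarithmic time, so log(T/T₁) m^(p-1) ≤ C, where m is the mass in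
the ball at time T₁. With log(T/T₁) = min(log T / 2, 1/(1-α)) this becomes the stated inequality.
For A > N the mass is at least cκ. For A = N it grows like κ log T, which gives the exponent 1/p and
rules out global existence for every κ > 0.

Uniformity in α. The constants must survive α → 1, where h_α concentrates at θ = 1. What is needed
is a lower bound for the averages of the positive part of h_α against θ^j min(1, 1/θ)^(N/2) with j =
0, 1. The Mellin transform of h_α is explicit and continuous up to α = 1. Averaging it with a
Gaussian along Re s = 1/2 gives the integral of h_α against a log-Gaussian, hence a uniform lower
bound (`exists_le_integral_wrightDensity`). Positivity of h_α itself is not needed: `ENNReal.ofReal`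
keeps the positive part, which only enlarges the averages. -/

lemma norm_cpow_mul_exp_neg_mul (a z : ℂ) {t : ℝ} (ht : 0 < t) :
    ‖(t : ℂ) ^ a * Complex.exp (-(z * t))‖ = t ^ a.re * Real.exp (-(z.re * t)) := by
  rw [norm_mul, Complex.norm_cpow_eq_rpow_re_of_pos ht, Complex.norm_exp]
  simp

lemma continuousOn_cpow_mul_exp (a z : ℂ) :
    ContinuousOn (fun t : ℝ => (t : ℂ) ^ a * Complex.exp (-(z * t))) (Set.Ioi 0) := by
  intro t ht
  have : (t : ℂ) ∈ Complex.slitPlane := Or.inl (by simpa using ht)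
  refine ContinuousAt.continuousWithinAt (ContinuousAt.mul ?_ (by fun_prop))
  exact (continuousAt_cpow_const this).comp Complex.continuous_ofReal.continuousAt

lemma integrableOn_rpow_mul_exp_neg {s b : ℝ} (hs : -1 < s) (hb : 0 < b) :
    IntegrableOn (fun t : ℝ => t ^ s * Real.exp (-(b * t))) (Set.Ioi 0) := by
  have := integrableOn_rpow_mul_exp_neg_mul_rpow hs one_pos hb
  simpa using this

lemma integrableOn_cpow_mul_exp {a z : ℂ} (ha : 0 < a.re) (hz : 0 < z.re) :
    IntegrableOn (fun t : ℝ => (t : ℂ) ^ (a - 1) * Complex.exp (-(z * t))) (Set.Ioi 0) := by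
  have h := integrableOn_rpow_mul_exp_neg (s := (a - 1).re) (by simpa using ha) hz
  refine h.mono' ((continuousOn_cpow_mul_exp _ _).aestronglyMeasurable measurableSet_Ioi) ?_
  filter_upwards [self_mem_ae_restrict measurableSet_Ioi] with t ht
  rw [norm_cpow_mul_exp_neg_mul _ _ ht]

/-- The Gamma integral `∫ t^(a-1) e^(-zt) dt = z^(-a) Γ(a)` for complex `a` and `z` in the right
half plane. -/
theorem integral_cpow_mul_cexp {a z : ℂ} (ha : 0 < a.re) (hz : 0 < z.re) :
    ∫ t : ℝ in Set.Ioi 0, (t : ℂ) ^ (a - 1) * Complex.exp (-(z * t)) =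
      (1 / z) ^ a * Complex.Gamma a := by
  -- Both sides are analytic in z on the right half plane and agree for real z > 0, so the identity
  -- theorem applies.
  set U : Set ℂ := {w | 0 < w.re} with hU
  have hUo : IsOpen U := isOpen_lt continuous_const Complex.continuous_re
  have hUc : IsPreconnected U := (convex_halfSpace_re_gt 0).isPreconnected
  set F : ℂ → ℂ := fun w => ∫ t : ℝ in Set.Ioi 0, (t : ℂ) ^ (a - 1) * Complex.exp (-(w * t))
  set G : ℂ → ℂ := fun w => (1 / w) ^ a * Complex.Gamma a
  have hF : AnalyticOnNhd ℂ F U := by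
    refine DifferentiableOn.analyticOnNhd (fun w hw => ?_) hUo
    have hw' : 0 < w.re := hw
    refine DifferentiableAt.differentiableWithinAt ?_
    refine (hasDerivAt_integral_of_dominated_loc_of_deriv_le
      (μ := volume.restrict (Set.Ioi 0))
      (F := fun w (t : ℝ) => (t : ℂ) ^ (a - 1) * Complex.exp (-(w * t)))
      (F' := fun w (t : ℝ) => (t : ℂ) ^ (a - 1) * (Complex.exp (-(w * t)) * (-t)))
      (bound := fun t => t ^ a.re * Real.exp (-(w.re / 2 * t)))
      (Metric.ball_mem_nhds w (half_pos hw')) ?_ (integrableOn_cpow_mul_exp ha hw') ?_ ?_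
      (integrableOn_rpow_mul_exp_neg (by linarith) (half_pos hw')) ?_).2.differentiableAt
    · exact Filter.Eventually.of_forall fun x =>
        (continuousOn_cpow_mul_exp _ _).aestronglyMeasurable measurableSet_Ioi
    · have := (continuousOn_cpow_mul_exp (a - 1) w).mul
        (g := fun t : ℝ => (-t : ℂ)) (by fun_prop)
      refine ContinuousOn.aestronglyMeasurable ?_ measurableSet_Ioi
      exact this.congr fun t _ => (mul_assoc _ _ _).symm
    · filter_upwards [self_mem_ae_restrict measurableSet_Ioi] with t ht x hx
      have ht' : 0 < t := ht
      have hx' : w.re / 2 ≤ x.re := by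
        have h1 := (Complex.abs_re_le_norm (x - w)).trans (mem_ball_iff_norm.1 hx).le
        have h2 := (abs_le.1 h1).1
        simp only [Complex.sub_re] at h2
        linarith
      rw [← mul_assoc, norm_mul, norm_cpow_mul_exp_neg_mul _ _ ht, norm_neg,
        Complex.norm_real, Real.norm_of_nonneg ht'.le, Complex.sub_re, Complex.one_re,
        Real.rpow_sub_one ht'.ne']
      have : Real.exp (-(x.re * t)) ≤ Real.exp (-(w.re / 2 * t)) := by
        apply Real.exp_le_exp.2; nlinarith
      calc t ^ a.re / t * Real.exp (-(x.re * t)) * t = t ^ a.re * Real.exp (-(x.re * t)) := by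
            field_simp
        _ ≤ _ := by gcongr
    · filter_upwards with t x hx
      have h1 : HasDerivAt (fun w : ℂ => -(w * t)) (-(t : ℂ)) x := by
        have := ((hasDerivAt_id x).mul_const (t : ℂ)).neg
        rw [one_mul] at this
        exact this
      exact (h1.cexp).const_mul _
  have hG : AnalyticOnNhd ℂ G U := by
    refine DifferentiableOn.analyticOnNhd (fun w hw => ?_) hUo
    have hw' : 0 < w.re := hw
    have hw0 : w ≠ 0 := by rintro rfl; simp at hw'
    have hs : 1 / w ∈ Complex.slitPlane := by
      refine Or.inl ?_
      rw [one_div, Complex.inv_re]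
      exact div_pos hw' (Complex.normSq_pos.2 hw0)
    refine DifferentiableAt.differentiableWithinAt ?_
    have h1 : DifferentiableAt ℂ (fun w : ℂ => 1 / w) w := by fun_prop (disch := assumption)
    exact (h1.cpow_const hs).mul_const _
  have hEq : Set.EqOn F G U := by
    refine hF.eqOn_of_preconnected_of_frequently_eq hG hUc (z₀ := 1) (by simp [hU]) ?_
    -- Real points accumulating at 1, and different from 1, where the real formula holds.
    have hseq : Filter.Tendsto (fun n : ℕ => ((1 + 1 / ((n : ℝ) + 1) : ℝ) : ℂ)) Filter.atTop
        (nhdsWithin 1 {1}ᶜ) := by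
      refine tendsto_nhdsWithin_iff.2 ⟨?_, ?_⟩
      · have h := (tendsto_one_div_add_atTop_nhds_zero_nat (𝕜 := ℝ)).const_add 1
        rw [add_zero] at h
        exact (Complex.continuous_ofReal.tendsto' 1 1 (by simp)).comp h
      · refine Filter.Eventually.of_forall fun n => ?_
        have : (0 : ℝ) < 1 / ((n : ℝ) + 1) := by positivity
        simp only [Set.mem_compl_iff, Set.mem_singleton_iff]
        intro h
        have := congrArg Complex.re h
        simp only [Complex.ofReal_re, Complex.one_re] at this
        linarith
    refine hseq.frequently (Filter.Eventually.frequently (Filter.Eventually.of_forall fun n => ?_))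
    have hn : (0 : ℝ) < 1 + 1 / ((n : ℝ) + 1) := by positivity
    exact Complex.integral_cpow_mul_exp_neg_mul_Ioi ha hn
  exact hEq hz

/-! ### An integral representation of the M-Wright function -/

/-- The angle `πα / (1 + α)` of the ray of integration. -/
def rayAngle (α : ℝ) : ℝ := Real.pi * α / (1 + α)

/-- The unit vector `e^{iβ}` with `β = πα / (1 + α)`. -/
def ray (α : ℝ) : ℂ := Complex.exp (rayAngle α * Complex.I)

lemma rayAngle_pos {α : ℝ} (h0 : 0 < α) : 0 < rayAngle α := by
  unfold rayAngle; positivity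

/-- Since α < 1, the angle stays below π/2. Hence both e and 1/e = e^(-iβ) have positive real part
cos β, and both exponentials in the ray integral decay when θ ≥ 0. -/
lemma rayAngle_lt {α : ℝ} (h0 : 0 < α) (h1 : α < 1) : rayAngle α < Real.pi / 2 := by
  unfold rayAngle
  rw [div_lt_div_iff₀ (by positivity) (by positivity)]
  nlinarith [Real.pi_pos]

lemma ray_re (α : ℝ) : (ray α).re = Real.cos (rayAngle α) := by
  rw [ray, Complex.exp_ofReal_mul_I_re]

lemma ray_re_pos {α : ℝ} (h0 : 0 < α) (h1 : α < 1) : 0 < (ray α).re := by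
  rw [ray_re]
  exact Real.cos_pos_of_mem_Ioo ⟨by linarith [rayAngle_pos h0, Real.pi_pos], rayAngle_lt h0 h1⟩

lemma norm_ray (α : ℝ) : ‖ray α‖ = 1 := Complex.norm_exp_ofReal_mul_I _

lemma ray_ne_zero (α : ℝ) : ray α ≠ 0 := Complex.exp_ne_zero _

lemma inv_ray_re (α : ℝ) : ((ray α)⁻¹).re = (ray α).re := by
  rw [Complex.inv_re, Complex.normSq_eq_norm_sq, norm_ray]; simp

lemma norm_inv_ray (α : ℝ) : ‖(ray α)⁻¹‖ = 1 := by rw [norm_inv, norm_ray, inv_one]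

lemma ray_cpow {α : ℝ} (h0 : 0 < α) (h1 : α < 1) (z : ℂ) :
    ray α ^ z = Complex.exp (rayAngle α * Complex.I * z) := by
  have h := rayAngle_pos h0
  have h' := rayAngle_lt h0 h1
  rw [Complex.cpow_def_of_ne_zero (ray_ne_zero α), ray, Complex.log_exp]
  · simp; linarith [Real.pi_pos]
  · simp; linarith [Real.pi_pos]

/-- The integral `∫ r^{α-1} e exp(-r/e - θ r^α e) dr` along the ray through `e = e^{iβ}`, whose
imaginary part is `π h_α(θ)`. -/
def rayIntegral (α θ : ℝ) : ℂ :=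
  ∫ r : ℝ in Set.Ioi 0, ((r ^ (α - 1) : ℝ) : ℂ) * ray α *
    Complex.exp (-((ray α)⁻¹ * r)) * Complex.exp (-(θ * ((r ^ α : ℝ) : ℂ) * ray α))

/-- Young's inequality with exponents 1/α and 1/(1-α). It lets e^(-cr) absorb exp(b r^α), so that
absolute values may be put inside the exponential series. -/
lemma exists_mul_rpow_le {α : ℝ} (h0 : 0 < α) (h1 : α < 1) {c : ℝ} (hc : 0 < c) {b : ℝ}
    (hb : 0 ≤ b) : ∃ K : ℝ, ∀ r : ℝ, 0 < r → b * r ^ α ≤ K + c * r := by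
  refine ⟨(1 - α) * (b * c ^ (-α)) ^ (1 / (1 - α)), fun r hr => ?_⟩
  have hb' : 0 ≤ b * c ^ (-α) := by positivity
  have key := Real.geom_mean_le_arith_mean2_weighted (w₁ := α) (w₂ := 1 - α)
    (p₁ := c * r) (p₂ := (b * c ^ (-α)) ^ (1 / (1 - α))) h0.le (by linarith)
    (by positivity) (by positivity) (by ring)
  rw [← Real.rpow_mul hb', one_div_mul_cancel (by linarith), Real.rpow_one,
    Real.mul_rpow hc.le hr.le, Real.rpow_neg hc.le] at key
  have h2 : c ^ α * r ^ α * (b * (c ^ α)⁻¹) = b * r ^ α := by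
    have : c ^ α ≠ 0 := (Real.rpow_pos_of_pos hc α).ne'
    field_simp
  rw [h2, ← Real.rpow_neg hc.le] at key
  have h3 : α * (c * r) ≤ c * r := by nlinarith [mul_pos hc hr]
  linarith

lemma integrableOn_rpow_mul_exp_mul_rpow {α : ℝ} (h0 : 0 < α) (h1 : α < 1) {c b s : ℝ}
    (hc : 0 < c) (hb : 0 ≤ b) (hs : -1 < s) :
    IntegrableOn (fun r : ℝ => r ^ s * Real.exp (-(c * r)) * Real.exp (b * r ^ α))
      (Set.Ioi 0) := by
  obtain ⟨K, hK⟩ := exists_mul_rpow_le h0 h1 (half_pos hc) hb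
  refine ((integrableOn_rpow_mul_exp_neg hs (half_pos hc)).const_mul
    (Real.exp K)).mono' ?_ ?_
  · refine Measurable.aestronglyMeasurable ?_
    fun_prop
  · filter_upwards [self_mem_ae_restrict measurableSet_Ioi] with r hr
    have hr' : 0 < r := hr
    rw [Real.norm_of_nonneg (by positivity), mul_assoc, ← Real.exp_add, mul_left_comm,
      ← Real.exp_add]
    refine mul_le_mul_of_nonneg_left (Real.exp_le_exp.2 ?_) (by positivity)
    linarith [hK r hr]

lemma rpow_mul_succ_sub_one {α r : ℝ} (hr : 0 < r) (n : ℕ) :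
    r ^ (α * (n + 1) - 1) = r ^ (α - 1) * (r ^ α) ^ n := by
  rw [← Real.rpow_mul_natCast hr.le, ← Real.rpow_add hr]; ring_nf

/-- Termwise integration of `rayIntegral`. -/
theorem hasSum_rayIntegral {α : ℝ} (h0 : 0 < α) (h1 : α < 1) (θ : ℝ) :
    HasSum (fun n : ℕ => (-(θ : ℂ)) ^ n / (n.factorial : ℂ) *
      (Complex.exp (Real.pi * α * (n + 1) * Complex.I) * (Real.Gamma (α * (n + 1)) : ℂ)))
      (rayIntegral α θ) := by
  have hc := ray_re_pos h0 h1
  set F : ℕ → ℝ → ℂ := fun n r => (-(θ : ℂ)) ^ n / (n.factorial : ℂ) * ray α ^ (n + 1) *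
    (((r ^ (α * (n + 1) - 1) : ℝ) : ℂ) * Complex.exp (-((ray α)⁻¹ * r)))
  -- The dominating series is the exponential series in |θ| r^α; its sum is integrable because r^α
  -- is sublinear.
  have hsum : ∀ r : ℝ, 0 < r → HasSum (fun n : ℕ => |θ| ^ n / (n.factorial : ℝ) *
      (r ^ (α * (n + 1) - 1) * Real.exp (-((ray α).re * r))))
      (r ^ (α - 1) * Real.exp (-((ray α).re * r)) * Real.exp (|θ| * r ^ α)) := by
    intro r hr
    have := (NormedSpace.expSeries_div_hasSum_exp (𝔸 := ℝ) (|θ| * r ^ α)).mul_left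
      (r ^ (α - 1) * Real.exp (-((ray α).re * r)))
    rw [← Real.exp_eq_exp_ℝ] at this
    convert! this using 2 with n
    rw [rpow_mul_succ_sub_one hr, mul_pow]; ring
  have key := hasSum_integral_of_dominated_convergence (μ := volume.restrict (Set.Ioi (0 : ℝ)))
    (F := F) (f := fun r => ((r ^ (α - 1) : ℝ) : ℂ) * ray α *
    Complex.exp (-((ray α)⁻¹ * r)) * Complex.exp (-(θ * ((r ^ α : ℝ) : ℂ) * ray α)))
    (fun n r => |θ| ^ n / (n.factorial : ℝ) *
      (r ^ (α * (n + 1) - 1) * Real.exp (-((ray α).re * r)))) ?_ ?_ ?_ ?_ ?_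
  · convert! key using 2 with n
    · simp only [F]
      rw [integral_const_mul]
      have hpos : 0 < α * (n + 1) := by positivity
      have : ∫ r : ℝ in Set.Ioi 0, ((r ^ (α * (n + 1) - 1) : ℝ) : ℂ) *
          Complex.exp (-((ray α)⁻¹ * r)) =
          ∫ r : ℝ in Set.Ioi 0, (r : ℂ) ^ (((α * (n + 1) : ℝ) : ℂ) - 1) *
          Complex.exp (-((ray α)⁻¹ * r)) := by
        refine setIntegral_congr_fun measurableSet_Ioi fun r hr => ?_
        have hr' : 0 < r := hr
        rw [Complex.ofReal_cpow hr'.le]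
        push_cast
        rfl
      rw [this, integral_cpow_mul_cexp (by simpa using hpos) (by rwa [inv_ray_re]), one_div,
        inv_inv, ray_cpow h0 h1, Complex.Gamma_ofReal, ray, ← Complex.exp_nat_mul]
      -- The n-th term carries the phase β(n+1) from the powers of e and αβ(n+1) from the Gamma
      -- integral. Their sum is πα(n+1): this fixes β = πα/(1+α).
      have hexp : Complex.exp (Real.pi * α * (n + 1) * Complex.I) =
          Complex.exp ((n + 1 : ℕ) * (rayAngle α * Complex.I)) *
          Complex.exp (rayAngle α * Complex.I * (α * (n + 1) : ℝ)) := by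
        rw [← Complex.exp_add]
        congr 1
        unfold rayAngle
        have : (1 + α : ℂ) ≠ 0 := by
          have : (1 + α) ≠ 0 := by positivity
          exact_mod_cast this
        push_cast
        field_simp
      rw [hexp]
      ring
  · intro n
    refine Measurable.aestronglyMeasurable ?_
    fun_prop
  · intro n
    filter_upwards [self_mem_ae_restrict measurableSet_Ioi] with r hr
    have hr' : 0 < r := hr
    simp only [F]
    rw [norm_mul, norm_mul, norm_mul, norm_pow, norm_ray, one_pow, mul_one, norm_div, norm_pow,
      norm_neg, Complex.norm_real, Real.norm_eq_abs, Complex.norm_natCast, Complex.norm_real,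
      Real.norm_of_nonneg (by positivity), Complex.norm_exp]
    have : (-((ray α)⁻¹ * (r : ℂ))).re = -((ray α).re * r) := by
      rw [Complex.neg_re, Complex.re_mul_ofReal, inv_ray_re]
    rw [this]
  · filter_upwards [self_mem_ae_restrict measurableSet_Ioi] with r hr
    exact (hsum r hr).summable
  · refine (integrableOn_rpow_mul_exp_mul_rpow h0 h1 hc (abs_nonneg θ) (s := α - 1)
      (by linarith)).congr_fun ?_ measurableSet_Ioi
    intro r hr
    exact (hsum r hr).tsum_eq.symm
  · filter_upwards [self_mem_ae_restrict measurableSet_Ioi] with r hr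
    have hr' : 0 < r := hr
    have := (NormedSpace.expSeries_div_hasSum_exp (𝔸 := ℂ)
      (-(θ * ((r ^ α : ℝ) : ℂ) * ray α))).mul_left (((r ^ (α - 1) : ℝ) : ℂ) * ray α *
        Complex.exp (-((ray α)⁻¹ * r)))
    rw [← Complex.exp_eq_exp_ℂ] at this
    convert! this using 2 with n
    simp only [F]
    have e : (-(θ * ((r ^ α : ℝ) : ℂ) * ray α)) ^ n =
        (-(θ : ℂ)) ^ n * ((r ^ α : ℝ) : ℂ) ^ n * ray α ^ n := by
      rw [← mul_pow, ← mul_pow]; ring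
    rw [rpow_mul_succ_sub_one hr', e]
    push_cast
    ring

/-- `π h_α(θ)` is the imaginary part of `rayIntegral`; this includes convergence of the series. -/
theorem hasSum_wrightDensity {α : ℝ} (h0 : 0 < α) (h1 : α < 1) (θ : ℝ) :
    HasSum (fun n : ℕ => (-θ) ^ n / ((n.factorial : ℝ) * Real.Gamma (1 - α - α * (n : ℝ))))
      ((rayIntegral α θ).im / Real.pi) := by
  have h := (Complex.imCLM.hasSum (hasSum_rayIntegral h0 h1 θ)).div_const Real.pi
  convert! h using 2 with n
  have hz : 0 < α * (n + 1) := by positivity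
  have e1 : (1 : ℝ) - α - α * n = 1 - α * (n + 1) := by ring
  have hG := Real.Gamma_pos_of_pos hz
  have e2 := Real.Gamma_mul_Gamma_one_sub (α * (n + 1))
  -- Euler's reflection formula. It also holds at the poles, where the sine vanishes and both Γ and
  -- its reciprocal take the default value 0.
  have e3 : 1 / Real.Gamma (1 - α * (n + 1)) =
      Real.Gamma (α * (n + 1)) * Real.sin (Real.pi * (α * (n + 1))) / Real.pi := by
    by_cases hs : Real.sin (Real.pi * (α * (n + 1))) = 0
    · rw [hs, div_zero] at e2
      have := (mul_eq_zero.1 e2).resolve_left hG.ne'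
      rw [this, hs]; simp
    · have h3 : Real.Gamma (1 - α * (n + 1)) =
          Real.pi / (Real.Gamma (α * (n + 1)) * Real.sin (Real.pi * (α * (n + 1)))) := by
        field_simp
        field_simp at e2
        linarith
      rw [h3]; field_simp
  have e4 : (-(θ : ℂ)) ^ n / (n.factorial : ℂ) = (((-θ) ^ n / (n.factorial : ℝ) : ℝ) : ℂ) := by
    push_cast; rfl
  have e5 : (Real.pi * α * (n + 1) * Complex.I : ℂ) =
      ((Real.pi * (α * (n + 1)) : ℝ) : ℂ) * Complex.I := by push_cast; ring
  simp only [Complex.imCLM_apply]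
  rw [e4, e5, Complex.im_ofReal_mul, Complex.im_mul_ofReal, Complex.exp_ofReal_mul_I_im, e1,
    ← div_div, div_eq_mul_one_div _ (Real.Gamma _), e3]
  ring

lemma wrightDensity_eq {α : ℝ} (h0 : 0 < α) (h1 : α < 1) (θ : ℝ) :
    wrightDensity α θ = (rayIntegral α θ).im / Real.pi :=
  (hasSum_wrightDensity h0 h1 θ).tsum_eq

lemma measurable_wrightDensity {α : ℝ} (h0 : 0 < α) (h1 : α < 1) :
    Measurable (wrightDensity α) := by
  refine measurable_of_tendsto_metrizable (f := fun (n : ℕ) θ => ∑ i ∈ Finset.range n,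
    (-θ) ^ i / ((i.factorial : ℝ) * Real.Gamma (1 - α - α * (i : ℝ)))) (fun n => ?_) ?_
  · fun_prop
  · refine tendsto_pi_nhds.2 fun θ => ?_
    rw [wrightDensity_eq h0 h1]
    exact (hasSum_wrightDensity h0 h1 θ).tendsto_sum_nat

end

/-! ### Size and decay of the M-Wright function -/

section

lemma norm_cexp_sub_one_le_of_re_nonpos {z : ℂ} (hz : z.re ≤ 0) :
    ‖Complex.exp z - 1‖ ≤ ‖z‖ := by
  have := Convex.norm_image_sub_le_of_norm_deriv_le (𝕜 := ℂ) (f := Complex.exp)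
    (s := {w | w.re ≤ 0}) (x := 0) (y := z) (C := 1)
    (fun w _ => Complex.differentiable_exp.differentiableAt) (fun w hw => ?_)
    (convex_halfSpace_re_le 0) (by simp) hz
  · simpa using this
  · rw [Complex.deriv_exp, Complex.norm_exp]
    exact Real.exp_le_one_iff.2 hw

lemma norm_rayIntegrand {α : ℝ} (θ : ℝ) {r : ℝ} (hr : 0 < r) :
    ‖((r ^ (α - 1) : ℝ) : ℂ) * ray α * Complex.exp (-((ray α)⁻¹ * r)) *
      Complex.exp (-(θ * ((r ^ α : ℝ) : ℂ) * ray α))‖ =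
      r ^ (α - 1) * Real.exp (-((ray α).re * r)) * Real.exp (-((ray α).re * (θ * r ^ α))) := by
  rw [norm_mul, norm_mul, norm_mul, norm_ray, Complex.norm_real, Complex.norm_exp,
    Complex.norm_exp, Real.norm_of_nonneg (by positivity), mul_one, Complex.neg_re,
    Complex.neg_re, Complex.re_mul_ofReal, inv_ray_re, ← Complex.ofReal_mul,
    Complex.re_ofReal_mul, mul_comm (θ * r ^ α)]

lemma measurable_rayIntegrand (α : ℝ) :
    Measurable fun z : ℝ × ℝ => ((z.2 ^ (α - 1) : ℝ) : ℂ) * ray α *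
      Complex.exp (-((ray α)⁻¹ * z.2)) *
      Complex.exp (-(z.1 * ((z.2 ^ α : ℝ) : ℂ) * ray α)) := by
  fun_prop

lemma integrableOn_rayIntegrand {α : ℝ} (h0 : 0 < α) (h1 : α < 1) {θ : ℝ} (hθ : 0 ≤ θ) :
    IntegrableOn (fun r : ℝ => ((r ^ (α - 1) : ℝ) : ℂ) * ray α *
      Complex.exp (-((ray α)⁻¹ * r)) * Complex.exp (-(θ * ((r ^ α : ℝ) : ℂ) * ray α)))
      (Set.Ioi 0) := by
  have hc := ray_re_pos h0 h1
  refine (integrableOn_rpow_mul_exp_neg (s := α - 1) (by linarith) hc).mono'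
    (Measurable.aestronglyMeasurable (by fun_prop)) ?_
  filter_upwards [self_mem_ae_restrict measurableSet_Ioi] with r hr
  have hr' : 0 < r := hr
  rw [norm_rayIntegrand θ hr']
  refine mul_le_of_le_one_right (by positivity) (Real.exp_le_one_iff.2 ?_)
  have : 0 ≤ (ray α).re * (θ * r ^ α) := by positivity
  linarith

/-- For θ ≥ 0 the factor exp(-θ r^α e) has modulus at most 1, and what remains is a convergent Gamma
integral. The constant depends on α, which is harmless: it serves only statements for a fixed α. -/
lemma exists_abs_wrightDensity_le {α : ℝ} (h0 : 0 < α) (h1 : α < 1) :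
    ∃ C : ℝ, 0 < C ∧ ∀ θ : ℝ, 0 ≤ θ → |wrightDensity α θ| ≤ C := by
  have hc := ray_re_pos h0 h1
  refine ⟨(∫ r in Set.Ioi (0 : ℝ), r ^ (α - 1) * Real.exp (-((ray α).re * r))) + 1, ?_,
    fun θ hθ => ?_⟩
  · have : 0 ≤ ∫ r in Set.Ioi (0 : ℝ), r ^ (α - 1) * Real.exp (-((ray α).re * r)) :=
      setIntegral_nonneg measurableSet_Ioi fun r hr => by
        have hr' : 0 < r := hr
        positivity
    linarith
  rw [wrightDensity_eq h0 h1, abs_div, abs_of_pos Real.pi_pos]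
  have h2 : |(rayIntegral α θ).im| ≤ _ := (Complex.abs_im_le_norm _).trans
    (norm_integral_le_of_norm_le
      (integrableOn_rpow_mul_exp_neg (s := α - 1) (by linarith) hc) (by
        filter_upwards [self_mem_ae_restrict measurableSet_Ioi] with r hr
        have hr' : 0 < r := hr
        rw [norm_rayIntegrand θ hr']
        refine mul_le_of_le_one_right (by positivity) (Real.exp_le_one_iff.2 ?_)
        have : 0 ≤ (ray α).re * (θ * r ^ α) := by positivity
        linarith))
  have h3 : |(rayIntegral α θ).im| / Real.pi ≤ |(rayIntegral α θ).im| :=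
    div_le_self (abs_nonneg _) (by linarith [Real.pi_gt_three])
  linarith

lemma integral_rpow_mul_cexp_rpow {α : ℝ} (h0 : 0 < α) {z : ℂ} (hz : 0 < z.re) :
    ∫ r : ℝ in Set.Ioi 0, ((r ^ (α - 1) : ℝ) : ℂ) * Complex.exp (-(z * ((r ^ α : ℝ) : ℂ))) =
      1 / (α * z) := by
  have h := integral_comp_rpow_Ioi (fun t : ℝ => Complex.exp (-(z * t))) h0.ne'
  have h2 := integral_cpow_mul_cexp (a := 1) (by simp) hz
  simp only [sub_self, Complex.cpow_zero, one_mul, Complex.cpow_one, Complex.Gamma_one,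
    mul_one] at h2
  rw [h2] at h
  have hα : (α : ℂ) ≠ 0 := by exact_mod_cast h0.ne'
  rw [one_div, mul_inv, ← one_div z, ← h, ← integral_const_mul]
  refine setIntegral_congr_fun measurableSet_Ioi fun r _ => ?_
  simp only [abs_of_pos h0, Complex.real_smul]
  push_cast
  field_simp

/-- Replacing e^(-r/e) by 1 in the ray integral gives exactly 1/(αθ), a real number, which does not
contribute to the imaginary part. The error is at most r in modulus, and the extra factor r improves
the decay from θ^(-1) to θ^(-1-1/α). -/
lemma exists_abs_wrightDensity_le_rpow {α : ℝ} (h0 : 0 < α) (h1 : α < 1) :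
    ∃ C : ℝ, 0 < C ∧ ∀ θ : ℝ, 0 < θ → |wrightDensity α θ| ≤ C * θ ^ (-(1 + 1 / α)) := by
  have hc := ray_re_pos h0 h1
  refine ⟨(ray α).re ^ (-(1 + 1 / α)) * (1 / α) * Real.Gamma ((α + 1) / α), by
    have := Real.Gamma_pos_of_pos (s := (α + 1) / α) (by positivity)
    positivity, fun θ hθ => ?_⟩
  set G : ℝ → ℂ := fun r => ((r ^ (α - 1) : ℝ) : ℂ) *
    Complex.exp (-(θ * ray α * ((r ^ α : ℝ) : ℂ))) * ray α with hG
  have hzre : 0 < ((θ : ℂ) * ray α).re := by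
    rw [Complex.re_ofReal_mul]; positivity
  have hGint : IntegrableOn G (Set.Ioi 0) := by
    refine (integrableOn_rpow_mul_exp_neg_mul_rpow (p := α) (s := α - 1) (by linarith) h0
      hzre).mono' (Measurable.aestronglyMeasurable (by fun_prop)) ?_
    filter_upwards [self_mem_ae_restrict measurableSet_Ioi] with r hr
    have hr' : 0 < r := hr
    rw [norm_mul, norm_mul, norm_ray, Complex.norm_real, Complex.norm_exp, mul_one,
      Complex.neg_re, Complex.re_mul_ofReal, Real.norm_of_nonneg (by positivity), neg_mul]
  have hGval : ∫ r in Set.Ioi (0 : ℝ), G r = ((1 / (α * θ) : ℝ) : ℂ) := by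
    rw [hG, integral_mul_const, integral_rpow_mul_cexp_rpow h0 hzre]
    have := ray_ne_zero α
    have hα : (α : ℂ) ≠ 0 := by exact_mod_cast h0.ne'
    have hθ' : (θ : ℂ) ≠ 0 := by exact_mod_cast hθ.ne'
    push_cast
    field_simp
  have hF := integrableOn_rayIntegrand h0 h1 hθ.le
  have him : (rayIntegral α θ).im = (∫ r in Set.Ioi (0 : ℝ),
      (((r ^ (α - 1) : ℝ) : ℂ) * ray α * Complex.exp (-((ray α)⁻¹ * r)) *
      Complex.exp (-(θ * ((r ^ α : ℝ) : ℂ) * ray α)) - G r)).im := by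
    rw [integral_sub hF hGint, hGval, Complex.sub_im, Complex.ofReal_im, sub_zero]; rfl
  have hbd := integrableOn_rpow_mul_exp_neg_mul_rpow (p := α) (s := α) (by linarith) h0 hzre
  have hval := integral_rpow_mul_exp_neg_mul_rpow (p := α) (q := α) h0 (by linarith) hzre
  have hnorm := norm_integral_le_of_norm_le hbd (f := fun r : ℝ =>
      (((r ^ (α - 1) : ℝ) : ℂ) * ray α * Complex.exp (-((ray α)⁻¹ * r)) *
      Complex.exp (-(θ * ((r ^ α : ℝ) : ℂ) * ray α)) - G r)) (by
    filter_upwards [self_mem_ae_restrict measurableSet_Ioi] with r hr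
    have hr' : 0 < r := hr
    have e1 : (((r ^ (α - 1) : ℝ) : ℂ) * ray α * Complex.exp (-((ray α)⁻¹ * r)) *
      Complex.exp (-(θ * ((r ^ α : ℝ) : ℂ) * ray α)) - G r) =
      (Complex.exp (-((ray α)⁻¹ * r)) - 1) * G r := by
      simp only [hG]
      rw [mul_right_comm (θ : ℂ)]
      ring
    have e2 : ‖G r‖ = r ^ (α - 1) * Real.exp (-(((θ : ℂ) * ray α).re) * r ^ α) := by
      rw [hG, norm_mul, norm_mul, norm_ray, Complex.norm_real, Complex.norm_exp, mul_one,
        Complex.neg_re, Complex.re_mul_ofReal, Real.norm_of_nonneg (by positivity), neg_mul]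
    have e3 : ‖Complex.exp (-((ray α)⁻¹ * r)) - 1‖ ≤ r := by
      refine (norm_cexp_sub_one_le_of_re_nonpos ?_).trans ?_
      · rw [Complex.neg_re, Complex.re_mul_ofReal, inv_ray_re]
        have := mul_pos hc hr'
        linarith
      · rw [norm_neg, norm_mul, norm_inv_ray, one_mul, Complex.norm_real,
          Real.norm_of_nonneg hr'.le]
    rw [e1, norm_mul, e2]
    calc _ ≤ r * (r ^ (α - 1) * Real.exp (-(((θ : ℂ) * ray α).re) * r ^ α)) := by gcongr
      _ = _ := by
        rw [← mul_assoc, Real.rpow_sub_one hr'.ne', mul_div_cancel₀ _ hr'.ne'])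
  rw [hval] at hnorm
  rw [wrightDensity_eq h0 h1, abs_div, abs_of_pos Real.pi_pos, him]
  have h3 : ∀ x : ℝ, |x| / Real.pi ≤ |x| := fun x =>
    div_le_self (abs_nonneg _) (by linarith [Real.pi_gt_three])
  refine (h3 _).trans ((Complex.abs_im_le_norm _).trans (hnorm.trans_eq ?_))
  have e4 : -(α + 1) / α = -(1 + 1 / α) := by field_simp
  rw [Complex.re_ofReal_mul, Real.mul_rpow hθ.le hc.le, e4]
  ring

/-! ### The Mellin transform of `rayIntegral` -/

/-- Tonelli: the θ-integral of the modulus converges at 0 because Re s > 0 and yields a multiple of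
r^(-α Re s). What is left behaves like r^(α(1 - Re s) - 1) at 0, integrable because Re s < 1. -/
lemma integrable_mellin_rayIntegrand {α : ℝ} (h0 : 0 < α) (h1 : α < 1) {s : ℂ}
    (hs0 : 0 < s.re) (hs1 : s.re < 1) :
    Integrable (fun z : ℝ × ℝ => (z.1 : ℂ) ^ (s - 1) * (((z.2 ^ (α - 1) : ℝ) : ℂ) * ray α *
      Complex.exp (-((ray α)⁻¹ * z.2)) *
      Complex.exp (-(z.1 * ((z.2 ^ α : ℝ) : ℂ) * ray α))))
      ((volume.restrict (Set.Ioi (0 : ℝ))).prod (volume.restrict (Set.Ioi (0 : ℝ)))) := by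
  have hc := ray_re_pos h0 h1
  have hmeas : Measurable (fun z : ℝ × ℝ => (z.1 : ℂ) ^ (s - 1) *
      (((z.2 ^ (α - 1) : ℝ) : ℂ) * ray α * Complex.exp (-((ray α)⁻¹ * z.2)) *
      Complex.exp (-(z.1 * ((z.2 ^ α : ℝ) : ℂ) * ray α)))) :=
    Measurable.mul (by fun_prop) (measurable_rayIntegrand α)
  have hnorm : ∀ θ r : ℝ, 0 < θ → 0 < r → ‖(θ : ℂ) ^ (s - 1) * (((r ^ (α - 1) : ℝ) : ℂ) * ray α *
      Complex.exp (-((ray α)⁻¹ * r)) * Complex.exp (-(θ * ((r ^ α : ℝ) : ℂ) * ray α)))‖ =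
      (r ^ (α - 1) * Real.exp (-((ray α).re * r))) *
        (θ ^ (s.re - 1) * Real.exp (-((ray α).re * r ^ α * θ))) := by
    intro θ r hθ hr
    rw [norm_mul, norm_rayIntegrand θ hr, Complex.norm_cpow_eq_rpow_re_of_pos hθ]
    simp only [Complex.sub_re, Complex.one_re]
    rw [mul_comm θ (r ^ α), ← mul_assoc ((ray α).re)]
    ring
  rw [integrable_prod_iff' hmeas.aestronglyMeasurable]
  constructor
  · filter_upwards [self_mem_ae_restrict measurableSet_Ioi] with r hr
    have hr' : 0 < r := hr
    refine ((integrableOn_rpow_mul_exp_neg (s := s.re - 1) (by linarith)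
      (b := (ray α).re * r ^ α) (by positivity)).const_mul
      (r ^ (α - 1) * Real.exp (-((ray α).re * r)))).mono'
      ((hmeas.comp (measurable_id.prodMk measurable_const)).aestronglyMeasurable) ?_
    filter_upwards [self_mem_ae_restrict measurableSet_Ioi] with θ hθ
    exact (hnorm θ r hθ hr').le
  · have hint := ((integrableOn_rpow_mul_exp_neg (s := α * (1 - s.re) - 1)
      (by nlinarith) hc).const_mul ((ray α).re ^ (-s.re) * Real.Gamma s.re))
    refine IntegrableOn.congr_fun hint (fun r hr => ?_) measurableSet_Ioi
    have hr' : 0 < r := hr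
    have : ∫ θ in Set.Ioi (0 : ℝ), ‖(θ : ℂ) ^ (s - 1) * (((r ^ (α - 1) : ℝ) : ℂ) * ray α *
      Complex.exp (-((ray α)⁻¹ * r)) * Complex.exp (-(θ * ((r ^ α : ℝ) : ℂ) * ray α)))‖ =
      ∫ θ in Set.Ioi (0 : ℝ), (r ^ (α - 1) * Real.exp (-((ray α).re * r))) *
        (θ ^ (s.re - 1) * Real.exp (-((ray α).re * r ^ α * θ))) :=
      setIntegral_congr_fun measurableSet_Ioi fun θ hθ => hnorm θ r hθ hr'
    simp only
    rw [this, integral_const_mul, Real.integral_rpow_mul_exp_neg_mul_Ioi hs0 (by positivity),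
      one_div, Real.inv_rpow (by positivity), ← Real.rpow_neg (by positivity),
      Real.mul_rpow hc.le (by positivity), ← Real.rpow_mul hr'.le]
    have : r ^ (α * (1 - s.re) - 1) = r ^ (α - 1) * r ^ (α * -s.re) := by
      rw [← Real.rpow_add hr']; ring_nf
    rw [this]; ring

lemma integrableOn_mellin_rayIntegral {α : ℝ} (h0 : 0 < α) (h1 : α < 1) {s : ℂ}
    (hs0 : 0 < s.re) (hs1 : s.re < 1) :
    IntegrableOn (fun θ : ℝ => (θ : ℂ) ^ (s - 1) * rayIntegral α θ) (Set.Ioi 0) := by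
  have := (integrable_mellin_rayIntegrand h0 h1 hs0 hs1).integral_prod_left
  refine this.congr (Filter.Eventually.of_forall fun θ => ?_)
  simp only [rayIntegral]
  rw [← integral_const_mul]

/-- The Mellin transform of `rayIntegral`. -/
theorem mellin_rayIntegral {α : ℝ} (h0 : 0 < α) (h1 : α < 1) {s : ℂ}
    (hs0 : 0 < s.re) (hs1 : s.re < 1) :
    ∫ θ : ℝ in Set.Ioi 0, (θ : ℂ) ^ (s - 1) * rayIntegral α θ =
      Complex.Gamma s * Complex.Gamma (α * (1 - s)) *
        Complex.exp (Real.pi * Complex.I * (α * (1 - s))) := by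
  have hc := ray_re_pos h0 h1
  have h2 : ∫ θ : ℝ in Set.Ioi 0, (θ : ℂ) ^ (s - 1) * rayIntegral α θ =
      ∫ θ : ℝ in Set.Ioi 0, ∫ r : ℝ in Set.Ioi 0, (θ : ℂ) ^ (s - 1) *
        (((r ^ (α - 1) : ℝ) : ℂ) * ray α * Complex.exp (-((ray α)⁻¹ * r)) *
        Complex.exp (-(θ * ((r ^ α : ℝ) : ℂ) * ray α))) := by
    refine setIntegral_congr_fun measurableSet_Ioi fun θ _ => ?_
    simp only [rayIntegral]
    rw [← integral_const_mul]
  have hα : (0 : ℝ) < ((α : ℂ) * (1 - s)).re := by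
    rw [Complex.re_ofReal_mul, Complex.sub_re, Complex.one_re]
    nlinarith
  rw [h2, integral_integral_swap (integrable_mellin_rayIntegrand h0 h1 hs0 hs1)]
  have h3 : ∀ r ∈ Set.Ioi (0 : ℝ), ∫ θ : ℝ in Set.Ioi 0, (θ : ℂ) ^ (s - 1) *
        (((r ^ (α - 1) : ℝ) : ℂ) * ray α * Complex.exp (-((ray α)⁻¹ * r)) *
        Complex.exp (-(θ * ((r ^ α : ℝ) : ℂ) * ray α))) =
      (Complex.Gamma s * Complex.exp (rayAngle α * Complex.I * (1 - s))) *
      ((r : ℂ) ^ (α * (1 - s) - 1) * Complex.exp (-((ray α)⁻¹ * r))) := by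
    intro r hr
    have hr' : 0 < r := hr
    have hx : 0 < r ^ α := by positivity
    have e1 : ∀ θ : ℝ, (θ : ℂ) ^ (s - 1) *
        (((r ^ (α - 1) : ℝ) : ℂ) * ray α * Complex.exp (-((ray α)⁻¹ * r)) *
        Complex.exp (-(θ * ((r ^ α : ℝ) : ℂ) * ray α))) =
        (((r ^ (α - 1) : ℝ) : ℂ) * ray α * Complex.exp (-((ray α)⁻¹ * r))) *
        ((θ : ℂ) ^ (s - 1) * Complex.exp (-(((r ^ α : ℝ) : ℂ) * ray α * θ))) := by
      intro θ
      rw [mul_comm (θ : ℂ) _, mul_right_comm _ (θ : ℂ)]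
      ring
    simp only [e1]
    rw [integral_const_mul, integral_cpow_mul_cexp hs0
      (by rw [Complex.re_ofReal_mul]; positivity)]
    have hz0 : ((r ^ α : ℝ) : ℂ) * ray α ≠ 0 :=
      mul_ne_zero (by exact_mod_cast hx.ne') (ray_ne_zero α)
    have e2 : (1 / (((r ^ α : ℝ) : ℂ) * ray α)) ^ s =
        (r : ℂ) ^ (-(α * s)) * Complex.exp (-(rayAngle α * Complex.I * s)) := by
      have harg : (((r ^ α : ℝ) : ℂ) * ray α).arg ≠ Real.pi := by
        rw [Complex.arg_real_mul _ hx]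
        intro h
        have := Complex.arg_eq_pi_iff.1 h
        linarith [this.1]
      have hlog : Complex.log (ray α) = rayAngle α * Complex.I := by
        have h := rayAngle_pos h0
        have h' := rayAngle_lt h0 h1
        rw [ray, Complex.log_exp]
        · simp; linarith [Real.pi_pos]
        · simp; linarith [Real.pi_pos]
      rw [one_div, Complex.inv_cpow _ _ harg, Complex.cpow_def_of_ne_zero hz0,
        Complex.log_ofReal_mul hx (ray_ne_zero α), Real.log_rpow hr', hlog,
        Complex.cpow_def_of_ne_zero (by exact_mod_cast hr'.ne'), ← Complex.exp_neg,
        ← Complex.exp_add, ← Complex.ofReal_log hr'.le]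
      congr 1
      push_cast
      ring
    have e3 : ((r ^ (α - 1) : ℝ) : ℂ) * (r : ℂ) ^ (-(α * s)) = (r : ℂ) ^ (α * (1 - s) - 1) := by
      rw [Complex.ofReal_cpow hr'.le, ← Complex.cpow_add _ _ (by exact_mod_cast hr'.ne')]
      congr 1
      push_cast
      ring
    have e4 : ray α * Complex.exp (-(rayAngle α * Complex.I * s)) =
        Complex.exp (rayAngle α * Complex.I * (1 - s)) := by
      rw [ray, ← Complex.exp_add]; congr 1; ring
    rw [e2, ← e3, ← e4]
    ring
  rw [setIntegral_congr_fun measurableSet_Ioi h3, integral_const_mul,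
    integral_cpow_mul_cexp hα (by rwa [inv_ray_re]), one_div, inv_inv, ray_cpow h0 h1]
  -- The phases β(1-s) and αβ(1-s) again add up to πα(1-s) by the choice of β.
  have e5 : Complex.exp (Real.pi * Complex.I * (α * (1 - s))) =
      Complex.exp (rayAngle α * Complex.I * (1 - s)) *
        Complex.exp (rayAngle α * Complex.I * (α * (1 - s))) := by
    rw [← Complex.exp_add]
    congr 1
    unfold rayAngle
    have : (1 + α : ℂ) ≠ 0 := by
      have : (1 + α) ≠ 0 := by positivity
      exact_mod_cast this
    push_cast
    field_simp
  rw [e5]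
  ring

end

/-! ### Averages of the M-Wright function, uniformly up to α = 1 -/

section

/-- The Mellin transform of `rayIntegral α` on the line `Re s = 1/2`. -/
def mellinSymbol (α y : ℝ) : ℂ :=
  Complex.Gamma (1 / 2 + y * Complex.I) * Complex.Gamma (α * (1 / 2 - y * Complex.I)) *
    Complex.exp (Real.pi * Complex.I * (α * (1 / 2 - y * Complex.I)))

/-- The weight `θ^{-1/2} exp(-(ε log θ)² / 4)`. -/
def logGaussian (ε θ : ℝ) : ℝ := θ ^ (-(1 / 2) : ℝ) * Real.exp (-(ε * Real.log θ) ^ 2 / 4)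

lemma measurable_rayIntegral (α : ℝ) : Measurable (rayIntegral α) := by
  have := (measurable_rayIntegrand α).stronglyMeasurable.integral_prod_right'
    (ν := volume.restrict (Set.Ioi (0 : ℝ)))
  exact this.measurable

lemma measurable_logGaussian (ε : ℝ) : Measurable (logGaussian ε) := by
  unfold logGaussian; fun_prop

/-- As θ^(iεx) = exp(iεx log θ), this is the Fourier transform of the Gaussian at ε log θ. It
accounts for the form of `logGaussian`. -/
lemma integral_gaussian_mul_cpow (ε : ℝ) {θ : ℝ} (hθ : 0 < θ) :
    ∫ x : ℝ, (Real.exp (-x ^ 2) : ℂ) * (θ : ℂ) ^ ((1 / 2 + (ε * x : ℝ) * Complex.I) - 1) =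
      ((√Real.pi * logGaussian ε θ : ℝ) : ℂ) := by
  have h := fourierIntegral_gaussian (b := 1) (by simp) ((ε * Real.log θ : ℝ) : ℂ)
  have e : ∀ x : ℝ, (Real.exp (-x ^ 2) : ℂ) *
      (θ : ℂ) ^ ((1 / 2 + (ε * x : ℝ) * Complex.I : ℂ) - 1) =
      ((θ ^ (-(1 / 2) : ℝ) : ℝ) : ℂ) * (Complex.exp (Complex.I * ((ε * Real.log θ : ℝ) : ℂ) * x) *
        Complex.exp (-1 * (x : ℂ) ^ 2)) := by
    intro x
    have hθ' : (θ : ℂ) ≠ 0 := by exact_mod_cast hθ.ne'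
    rw [Complex.ofReal_cpow hθ.le, Complex.cpow_def_of_ne_zero hθ',
      Complex.cpow_def_of_ne_zero hθ', Complex.ofReal_exp, ← Complex.exp_add, ← Complex.exp_add,
      ← Complex.exp_add, ← Complex.ofReal_log hθ.le]
    congr 1
    push_cast
    ring
  simp only [e]
  rw [integral_const_mul, h, logGaussian]
  have : ((Real.pi : ℂ) / 1) ^ (1 / 2 : ℂ) = ((√Real.pi : ℝ) : ℂ) := by
    rw [Real.sqrt_eq_rpow, Complex.ofReal_cpow Real.pi_pos.le]
    push_cast
    simp
  rw [this]
  push_cast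
  ring_nf

lemma norm_cpow_half {θ y : ℝ} (hθ : 0 < θ) :
    ‖(θ : ℂ) ^ ((1 / 2 + (y : ℝ) * Complex.I : ℂ) - 1)‖ = θ ^ (-(1 / 2) : ℝ) := by
  rw [Complex.norm_cpow_eq_rpow_re_of_pos hθ]
  congr 1
  simp
  norm_num

lemma integrableOn_rpow_mul_norm_rayIntegral {α : ℝ} (h0 : 0 < α) (h1 : α < 1) :
    IntegrableOn (fun θ : ℝ => θ ^ (-(1 / 2) : ℝ) * ‖rayIntegral α θ‖) (Set.Ioi 0) := by
  have h := (integrableOn_mellin_rayIntegral h0 h1 (s := 1 / 2 + (0 : ℝ) * Complex.I)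
    (by simp) (by norm_num)).norm
  refine IntegrableOn.congr_fun h (fun θ hθ => ?_) measurableSet_Ioi
  rw [norm_mul, norm_cpow_half hθ]

lemma integrable_gaussian_mul_mellin {α : ℝ} (h0 : 0 < α) (h1 : α < 1) (ε : ℝ) :
    Integrable (fun z : ℝ × ℝ => (Real.exp (-z.2 ^ 2) : ℂ) *
      (z.1 : ℂ) ^ ((1 / 2 + (ε * z.2 : ℝ) * Complex.I : ℂ) - 1) * rayIntegral α z.1)
      ((volume.restrict (Set.Ioi (0 : ℝ))).prod volume) := by
  have hg : Integrable (fun x : ℝ => Real.exp (-x ^ 2)) := by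
    simpa using integrable_exp_neg_mul_sq one_pos
  refine ((integrableOn_rpow_mul_norm_rayIntegral h0 h1).mul_prod hg).mono' ?_ ?_
  · refine Measurable.aestronglyMeasurable (Measurable.mul ?_
      ((measurable_rayIntegral α).comp measurable_fst))
    fun_prop
  · have hpos : ∀ᵐ z : ℝ × ℝ ∂((volume.restrict (Set.Ioi (0 : ℝ))).prod volume), 0 < z.1 :=
      Measure.quasiMeasurePreserving_fst.ae (self_mem_ae_restrict measurableSet_Ioi)
    filter_upwards [hpos] with z hz
    rw [norm_mul, norm_mul, norm_cpow_half hz, Complex.norm_real,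
      Real.norm_of_nonneg (Real.exp_pos _).le]
    exact le_of_eq (by ring)

lemma logGaussian_nonneg {ε θ : ℝ} (hθ : 0 ≤ θ) : 0 ≤ logGaussian ε θ := by
  unfold logGaussian; positivity

lemma integrableOn_wrightDensity_mul_logGaussian {α : ℝ} (h0 : 0 < α) (h1 : α < 1) (ε : ℝ) :
    IntegrableOn (fun θ => wrightDensity α θ * logGaussian ε θ) (Set.Ioi 0) := by
  refine (integrableOn_rpow_mul_norm_rayIntegral h0 h1).mono'
    ((measurable_wrightDensity h0 h1).mul (measurable_logGaussian ε)).aestronglyMeasurable ?_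
  filter_upwards [self_mem_ae_restrict measurableSet_Ioi] with θ hθ
  have hθ' : 0 < θ := hθ
  rw [norm_mul, Real.norm_of_nonneg (logGaussian_nonneg hθ'.le), mul_comm]
  refine mul_le_mul ?_ ?_ (norm_nonneg _) (by positivity)
  · refine mul_le_of_le_one_right (by positivity) (Real.exp_le_one_iff.2 ?_)
    have := sq_nonneg (ε * Real.log θ)
    linarith
  · rw [wrightDensity_eq h0 h1, norm_div, Real.norm_of_nonneg Real.pi_pos.le]
    refine (div_le_self (norm_nonneg _) (by linarith [Real.pi_gt_three])).trans ?_
    exact Complex.abs_im_le_norm _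

/-- Fubini, after averaging the Mellin transform over s = 1/2 + iεx with weight e^(-x²). The gain is
on the right: that expression makes sense and is continuous up to α = 1 and ε = 0, where the left
side gives no control. -/
theorem integral_wrightDensity_mul_logGaussian {α : ℝ} (h0 : 0 < α) (h1 : α < 1) (ε : ℝ) :
    Real.pi * √Real.pi * ∫ θ in Set.Ioi (0 : ℝ), wrightDensity α θ * logGaussian ε θ =
      (∫ x : ℝ, (Real.exp (-x ^ 2) : ℂ) * mellinSymbol α (ε * x)).im := by
  have hI := integrable_gaussian_mul_mellin h0 h1 ε
  have hswap := integral_integral_swap (f := fun θ x : ℝ => (Real.exp (-x ^ 2) : ℂ) *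
      (θ : ℂ) ^ ((1 / 2 + (ε * x : ℝ) * Complex.I : ℂ) - 1) * rayIntegral α θ) hI
  have e1 : ∀ θ ∈ Set.Ioi (0 : ℝ), (∫ x : ℝ, (Real.exp (-x ^ 2) : ℂ) *
      (θ : ℂ) ^ ((1 / 2 + (ε * x : ℝ) * Complex.I : ℂ) - 1) * rayIntegral α θ) =
      ((√Real.pi * logGaussian ε θ : ℝ) : ℂ) * rayIntegral α θ := fun θ hθ => by
    rw [integral_mul_const, integral_gaussian_mul_cpow ε hθ]
  have e2 : ∀ x : ℝ, (∫ θ : ℝ in Set.Ioi 0, (Real.exp (-x ^ 2) : ℂ) *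
      (θ : ℂ) ^ ((1 / 2 + (ε * x : ℝ) * Complex.I : ℂ) - 1) * rayIntegral α θ) =
      (Real.exp (-x ^ 2) : ℂ) * mellinSymbol α (ε * x) := fun x => by
    simp only [mul_assoc]
    rw [integral_const_mul, mellin_rayIntegral h0 h1 (by simp) (by norm_num), mellinSymbol]
    have : (1 : ℂ) - (1 / 2 + (ε * x : ℝ) * Complex.I) = 1 / 2 - (ε * x : ℝ) * Complex.I := by
      ring
    rw [this]
  rw [setIntegral_congr_fun measurableSet_Ioi e1] at hswap
  simp only [e2] at hswap
  have hint : IntegrableOn (fun θ => ((√Real.pi * logGaussian ε θ : ℝ) : ℂ) * rayIntegral α θ)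
      (Set.Ioi 0) :=
    IntegrableOn.congr_fun hI.integral_prod_left e1 measurableSet_Ioi
  rw [← hswap, ← Complex.imCLM_apply, ← Complex.imCLM.integral_comp_comm hint,
    ← integral_const_mul]
  refine setIntegral_congr_fun measurableSet_Ioi fun θ _ => ?_
  simp only [Complex.imCLM_apply]
  rw [Complex.im_ofReal_mul, wrightDensity_eq h0 h1]
  have := Real.pi_pos
  field_simp

lemma norm_Gamma_le {z : ℂ} (hz : 0 < z.re) : ‖Complex.Gamma z‖ ≤ Real.Gamma z.re := by
  rw [Complex.Gamma_eq_integral hz, Real.Gamma_eq_integral hz, Complex.GammaIntegral]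
  refine norm_integral_le_of_norm_le (Real.GammaIntegral_convergent hz) ?_
  filter_upwards [self_mem_ae_restrict measurableSet_Ioi] with t ht
  rw [norm_mul, Complex.norm_cpow_eq_rpow_re_of_pos ht, Complex.norm_real,
    Real.norm_of_nonneg (Real.exp_pos _).le]
  simp

/-- Crude, since |Γ(z)| ≤ Γ(Re z) discards the decay in y. The growth e^(παy) that remains is
absorbed by the Gaussian weight. -/
lemma norm_mellinSymbol_le {α : ℝ} (h0 : 0 < α) (y : ℝ) :
    ‖mellinSymbol α y‖ ≤ √Real.pi * Real.Gamma (α / 2) * Real.exp (Real.pi * α * y) := by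
  rw [mellinSymbol, norm_mul, norm_mul]
  have hr2 : ((α : ℂ) * (1 / 2 - y * Complex.I)).re = α / 2 := by
    rw [Complex.re_ofReal_mul]; simp; ring
  have h1 := norm_Gamma_le (z := 1 / 2 + y * Complex.I) (by simp)
  have h2 := norm_Gamma_le (z := α * (1 / 2 - y * Complex.I)) (by rw [hr2]; positivity)
  rw [hr2] at h2
  have hr1 : ((1 : ℂ) / 2 + y * Complex.I).re = 1 / 2 := by simp
  rw [hr1, Real.Gamma_one_half_eq] at h1
  have h3 : ‖Complex.exp (Real.pi * Complex.I * (α * (1 / 2 - y * Complex.I)))‖ =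
      Real.exp (Real.pi * α * y) := by
    rw [Complex.norm_exp]
    congr 1
    simp
    ring
  rw [h3]
  gcongr

lemma continuousAt_mellinSymbol {α : ℝ} (h0 : 0 < α) (y : ℝ) :
    ContinuousAt (fun z : ℝ × ℝ => mellinSymbol z.1 z.2) (α, y) := by
  have aux : ∀ w : ℂ, 0 < w.re → ContinuousAt Complex.Gamma w := fun w hw =>
    Complex.continuousAt_Gamma w fun m h => by
      rw [h] at hw
      simp at hw
      exact absurd hw (not_lt.2 (Nat.cast_nonneg m))
  have hr2 : ((α : ℂ) * (1 / 2 - y * Complex.I)).re = α / 2 := by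
    rw [Complex.re_ofReal_mul]; simp; ring
  unfold mellinSymbol
  refine ContinuousAt.mul (ContinuousAt.mul ?_ ?_) (by fun_prop)
  · exact ContinuousAt.comp (f := fun z : ℝ × ℝ => (1 / 2 + z.2 * Complex.I : ℂ))
      (aux _ (by simp)) (by fun_prop)
  · exact ContinuousAt.comp (f := fun z : ℝ × ℝ => (z.1 * (1 / 2 - z.2 * Complex.I) : ℂ))
      (aux _ (by rw [hr2]; positivity)) (by fun_prop)

lemma integrable_gaussian_mul_exp_abs :
    Integrable (fun x : ℝ => Real.exp (-x ^ 2) * Real.exp (Real.pi * |x|)) := by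
  have hq : ∀ c : ℝ, Integrable (fun x : ℝ => Real.exp (-x ^ 2) * Real.exp (c * x)) := by
    intro c
    have h := (integrable_cexp_quadratic (b := 1) (by simp) (c : ℂ) 0).norm
    refine h.congr (Filter.Eventually.of_forall fun x => ?_)
    simp only
    rw [Complex.norm_exp, ← Real.exp_add]
    congr 1
    have : (-1 * (x : ℂ) ^ 2 + c * x + 0) = ((-x ^ 2 + c * x : ℝ) : ℂ) := by push_cast; ring
    rw [this, Complex.ofReal_re]
  refine ((hq Real.pi).add (hq (-Real.pi))).mono' (by fun_prop) ?_
  refine Filter.Eventually.of_forall fun x => ?_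
  rw [Real.norm_of_nonneg (by positivity)]
  simp only [Pi.add_apply]
  rw [← mul_add]
  refine mul_le_mul_of_nonneg_left ?_ (Real.exp_pos _).le
  rcases abs_cases x with ⟨h, -⟩ | ⟨h, -⟩ <;> rw [h]
  · linarith [Real.exp_pos (-Real.pi * x)]
  · rw [mul_neg, ← neg_mul]; linarith [Real.exp_pos (Real.pi * x)]

/-- Dominated convergence: Γ(α/2) is bounded on [α₀, 1], and α, ε ≤ 1 bound the exponential growth
by e^(π|x|). -/
lemma continuousOn_integral_mellinSymbol {α₀ : ℝ} (h0 : 0 < α₀) :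
    ContinuousOn (fun z : ℝ × ℝ =>
      (∫ x : ℝ, (Real.exp (-x ^ 2) : ℂ) * mellinSymbol z.1 (z.2 * x)).im)
      (Set.Icc α₀ 1 ×ˢ Set.Icc 0 1) := by
  have hGc : ContinuousOn (fun a : ℝ => Real.Gamma (a / 2)) (Set.Icc α₀ 1) := by
    intro a ha
    have ha' : 0 < a := h0.trans_le ha.1
    have : ContinuousAt Real.Gamma (a / 2) :=
      (Real.differentiableAt_Gamma fun m h => by
        have : (0 : ℝ) ≤ m := Nat.cast_nonneg m
        linarith).continuousAt
    exact (ContinuousAt.comp (f := fun a : ℝ => a / 2) this (by fun_prop)).continuousWithinAt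
  obtain ⟨B, hB⟩ := isCompact_Icc.bddAbove_image hGc
  have hB' : ∀ a ∈ Set.Icc α₀ 1, Real.Gamma (a / 2) ≤ B := fun a ha => hB ⟨a, ha, rfl⟩
  refine Complex.continuous_im.comp_continuousOn ?_
  refine continuousOn_of_dominated
    (bound := fun x => √Real.pi * B * (Real.exp (-x ^ 2) * Real.exp (Real.pi * |x|))) ?_ ?_
    (integrable_gaussian_mul_exp_abs.const_mul _) ?_
  · rintro ⟨a, e⟩ ⟨ha, -⟩
    have ha' : 0 < a := h0.trans_le ha.1
    refine Continuous.aestronglyMeasurable (Continuous.mul (by fun_prop) ?_)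
    refine continuous_iff_continuousAt.2 fun x => ?_
    exact ContinuousAt.comp (f := fun x : ℝ => ((a, e * x) : ℝ × ℝ))
      (continuousAt_mellinSymbol ha' (e * x)) (by fun_prop)
  · rintro ⟨a, e⟩ ⟨ha, he⟩
    have ha' : 0 < a := h0.trans_le ha.1
    refine Filter.Eventually.of_forall fun x => ?_
    have hG := Real.Gamma_pos_of_pos (s := a / 2) (by positivity)
    have hex : Real.pi * a * (e * x) ≤ Real.pi * |x| := by
      rw [mul_assoc]
      refine mul_le_mul_of_nonneg_left ?_ Real.pi_pos.le
      calc a * (e * x) ≤ |a * (e * x)| := le_abs_self _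
        _ = a * e * |x| := by
          rw [abs_mul, abs_mul, abs_of_pos ha', abs_of_nonneg he.1, mul_assoc]
        _ ≤ 1 * |x| := by
          refine mul_le_mul_of_nonneg_right ?_ (abs_nonneg x)
          exact mul_le_one₀ ha.2 he.1 he.2
        _ = |x| := one_mul _
    rw [norm_mul, Complex.norm_real, Real.norm_of_nonneg (Real.exp_pos _).le]
    calc _ ≤ Real.exp (-x ^ 2) * (√Real.pi * Real.Gamma (a / 2) *
          Real.exp (Real.pi * a * (e * x))) := by
          gcongr
          exact norm_mellinSymbol_le ha' _
      _ ≤ Real.exp (-x ^ 2) * (√Real.pi * B * Real.exp (Real.pi * |x|)) := by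
          have := hB' a ha
          have hB0 := hG.le.trans this
          gcongr
      _ = _ := by ring
  · refine Filter.Eventually.of_forall fun x => ?_
    rintro ⟨a, e⟩ ⟨ha, he⟩
    have ha' : 0 < a := h0.trans_le ha.1
    refine ContinuousAt.continuousWithinAt (ContinuousAt.mul (by fun_prop) ?_)
    exact ContinuousAt.comp (x := (a, e)) (f := fun z : ℝ × ℝ => ((z.1, z.2 * x) : ℝ × ℝ))
      (g := fun z : ℝ × ℝ => mellinSymbol z.1 z.2)
      (continuousAt_mellinSymbol ha' (e * x)) (by fun_prop)

/-- At ε = 0 the symbol is the constant Γ(1/2) Γ(α/2) e^(iπα/2), and sin(πα/2) > 0 on (0, 1],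
including the endpoint α = 1. -/
lemma integral_mellinSymbol_zero_pos {α : ℝ} (h0 : 0 < α) (h1 : α ≤ 1) :
    0 < (∫ x : ℝ, (Real.exp (-x ^ 2) : ℂ) * mellinSymbol α (0 * x)).im := by
  simp only [zero_mul]
  rw [integral_mul_const, integral_complex_ofReal, Complex.im_ofReal_mul]
  have e : mellinSymbol α 0 = ((Real.Gamma (1 / 2) * Real.Gamma (α / 2) : ℝ) : ℂ) *
      Complex.exp (((Real.pi * (α / 2) : ℝ) : ℂ) * Complex.I) := by
    rw [mellinSymbol, Complex.ofReal_mul, ← Complex.Gamma_ofReal, ← Complex.Gamma_ofReal]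
    push_cast
    simp only [zero_mul, add_zero, sub_zero]
    ring_nf
  have h2 : 0 < ∫ x : ℝ, Real.exp (-x ^ 2) := by
    have := integral_gaussian 1
    simp only [neg_mul, one_mul, div_one] at this
    rw [this]
    exact Real.sqrt_pos.2 Real.pi_pos
  rw [e, Complex.im_ofReal_mul, Complex.exp_ofReal_mul_I_im]
  have h3 := Real.Gamma_pos_of_pos (s := 1 / 2) (by norm_num)
  have h4 := Real.Gamma_pos_of_pos (s := α / 2) (by positivity)
  have h5 : 0 < Real.sin (Real.pi * (α / 2)) := by
    refine Real.sin_pos_of_pos_of_lt_pi (by positivity) ?_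
    nlinarith [Real.pi_pos]
  positivity

/-- A log-Gaussian average of the M-Wright function is bounded below uniformly for `α` away
from `0`. -/
theorem exists_le_integral_wrightDensity {α₀ : ℝ} (h0 : 0 < α₀) (h1 : α₀ < 1) :
    ∃ ε c : ℝ, 0 < ε ∧ 0 < c ∧ ∀ α : ℝ, α₀ ≤ α → α < 1 →
      c ≤ ∫ θ in Set.Ioi (0 : ℝ), wrightDensity α θ * logGaussian ε θ := by
  set Λ : ℝ × ℝ → ℝ := fun z =>
    (∫ x : ℝ, (Real.exp (-x ^ 2) : ℂ) * mellinSymbol z.1 (z.2 * x)).im with hΛ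
  have hcont := continuousOn_integral_mellinSymbol h0
  have hK : IsCompact (Set.Icc α₀ (1 : ℝ) ×ˢ Set.Icc (0 : ℝ) 1) := isCompact_Icc.prod isCompact_Icc
  -- At ε = 0 there is a positive minimum over the compact interval [α₀, 1]. Uniform continuity
  -- keeps half of it for one small ε valid for all α.
  obtain ⟨a₁, ha₁, hmin⟩ := (isCompact_Icc (a := α₀) (b := (1 : ℝ))).exists_isMinOn
    ⟨α₀, le_rfl, h1.le⟩ (f := fun a => Λ (a, 0))
    (hcont.comp (by fun_prop) fun a ha => ⟨ha, le_rfl, zero_le_one⟩)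
  have hd : 0 < Λ (a₁, 0) := integral_mellinSymbol_zero_pos (h0.trans_le ha₁.1) ha₁.2
  obtain ⟨δ, hδ, hu⟩ := Metric.uniformContinuousOn_iff.1
    (hK.uniformContinuousOn_of_continuous hcont) (Λ (a₁, 0) / 2) (half_pos hd)
  have hε : 0 < min (δ / 2) 1 := lt_min (half_pos hδ) one_pos
  have hπ : 0 < Real.pi * √Real.pi := mul_pos Real.pi_pos (Real.sqrt_pos.2 Real.pi_pos)
  refine ⟨min (δ / 2) 1, Λ (a₁, 0) / 2 / (Real.pi * √Real.pi), hε, by positivity,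
    fun α hα hα1 => ?_⟩
  rw [div_le_iff₀' hπ, integral_wrightDensity_mul_logGaussian (h0.trans_le hα) hα1]
  have h2 := hu (α, min (δ / 2) 1) ⟨⟨hα, hα1.le⟩, hε.le, min_le_right _ _⟩ (α, 0)
    ⟨⟨hα, hα1.le⟩, le_rfl, zero_le_one⟩ (by
      rw [Prod.dist_eq, dist_self, Real.dist_eq, sub_zero, abs_of_pos hε]
      exact max_lt hδ ((min_le_left _ _).trans_lt (half_lt_self hδ)))
  have h3 : Λ (a₁, 0) ≤ Λ (α, 0) := hmin ⟨hα, hα1.le⟩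
  rw [Real.dist_eq] at h2
  have h4 := (abs_lt.1 h2).1
  simp only [hΛ] at h3 ⊢
  linarith

/-- The quadratic has its maximum k²/ε² at x = 2k/ε². With x = log θ this says that a log-Gaussian
beats every power of θ, at 0 and at ∞. -/
lemma exp_sub_sq_le {ε : ℝ} (hε : 0 < ε) (k x : ℝ) :
    Real.exp (k * x + -(ε * x) ^ 2 / 4) ≤ Real.exp (k ^ 2 / ε ^ 2) := by
  refine Real.exp_le_exp.2 ?_
  rw [le_div_iff₀ (by positivity)]
  nlinarith [sq_nonneg (ε ^ 2 * x / 2 - k)]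

lemma rpow_mul_logGaussian_le {ε : ℝ} (hε : 0 < ε) (k : ℝ) {θ : ℝ} (hθ : 0 < θ) :
    θ ^ k * logGaussian ε θ ≤ Real.exp ((k - 1 / 2) ^ 2 / ε ^ 2) := by
  refine le_trans (le_of_eq ?_) (exp_sub_sq_le hε (k - 1 / 2) (Real.log θ))
  rw [logGaussian, ← mul_assoc, ← Real.rpow_add hθ, Real.rpow_def_of_pos hθ, ← Real.exp_add]
  ring_nf

/-- Uniform lower bound for the averages `∫ θ^j h_α(θ)⁺ min(1, 1/θ)^m dθ`, `j ∈ {0, 1}`. -/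
theorem exists_le_lintegral_wrightDensity {α₀ : ℝ} (h0 : 0 < α₀) (h1 : α₀ < 1) (m : ℝ) :
    ∃ c : ℝ, 0 < c ∧ ∀ α : ℝ, α₀ ≤ α → α < 1 →
      ENNReal.ofReal c ≤ (∫⁻ θ in Set.Ioi (0 : ℝ), ENNReal.ofReal (wrightDensity α θ) *
        ENNReal.ofReal (min 1 (1 / θ) ^ m)) ∧
      ENNReal.ofReal c ≤ (∫⁻ θ in Set.Ioi (0 : ℝ), ENNReal.ofReal (θ * wrightDensity α θ) *
        ENNReal.ofReal (min 1 (1 / θ) ^ m)) := by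
  obtain ⟨ε, c, hε, hc, hlow⟩ := exists_le_integral_wrightDensity h0 h1
  -- The log-Gaussian is dominated by the weight of interest; the two terms of the maximum handle θ
  -- ≤ 1 and θ ≥ 1.
  have key : ∀ j : ℝ, ∃ B : ℝ, 0 < B ∧ ∀ θ : ℝ, 0 < θ →
      logGaussian ε θ ≤ B * (θ ^ j * min 1 (1 / θ) ^ m) := by
    intro j
    refine ⟨max (Real.exp ((-j - 1 / 2) ^ 2 / ε ^ 2)) (Real.exp ((m - j - 1 / 2) ^ 2 / ε ^ 2)),
      lt_max_of_lt_left (Real.exp_pos _), fun θ hθ => ?_⟩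
    have hj : 0 < θ ^ j := Real.rpow_pos_of_pos hθ j
    rcases le_total 1 (1 / θ) with h | h
    · rw [min_eq_left h, Real.one_rpow, mul_one]
      have := rpow_mul_logGaussian_le hε (-j) hθ
      rw [Real.rpow_neg hθ.le, inv_mul_le_iff₀ hj, mul_comm] at this
      exact this.trans (mul_le_mul_of_nonneg_right (le_max_left _ _) hj.le)
    · rw [min_eq_right h, one_div θ, Real.inv_rpow hθ.le]
      have := rpow_mul_logGaussian_le hε (m - j) hθ
      have hm : 0 < θ ^ m := Real.rpow_pos_of_pos hθ m
      rw [Real.rpow_sub hθ, div_mul_eq_mul_div, div_le_iff₀ hj] at this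
      rw [← mul_assoc, ← div_eq_mul_inv, le_div_iff₀ hm, mul_comm _ (θ ^ m)]
      exact this.trans (mul_le_mul_of_nonneg_right (le_max_right _ _) hj.le)
  have main : ∀ j : ℝ, ∃ d : ℝ, 0 < d ∧ ∀ α : ℝ, α₀ ≤ α → α < 1 →
      ENNReal.ofReal d ≤ ∫⁻ θ in Set.Ioi (0 : ℝ), ENNReal.ofReal (θ ^ j * wrightDensity α θ) *
        ENNReal.ofReal (min 1 (1 / θ) ^ m) := by
    intro j
    obtain ⟨B, hB, hle⟩ := key j
    refine ⟨c / B, div_pos hc hB, fun α hα hα1 => ?_⟩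
    have hpos := h0.trans_le hα
    rw [ENNReal.ofReal_div_of_pos hB]
    refine ENNReal.div_le_of_le_mul' ?_
    rw [← lintegral_const_mul' _ _ ENNReal.ofReal_ne_top]
    -- Passing from the signed integral to that of the positive part can only increase it, so no
    -- sign of h_α is needed.
    calc ENNReal.ofReal c ≤ ENNReal.ofReal
          (∫ θ in Set.Ioi (0 : ℝ), wrightDensity α θ * logGaussian ε θ) :=
          ENNReal.ofReal_le_ofReal (hlow α hα hα1)
      _ ≤ ∫⁻ θ in Set.Ioi (0 : ℝ), ENNReal.ofReal (wrightDensity α θ * logGaussian ε θ) := by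
          rw [integral_eq_lintegral_pos_part_sub_lintegral_neg_part
            (integrableOn_wrightDensity_mul_logGaussian hpos hα1 ε)]
          refine (ENNReal.ofReal_le_ofReal (sub_le_self _ ENNReal.toReal_nonneg)).trans ?_
          exact ENNReal.ofReal_toReal_le
      _ ≤ _ := by
          refine setLIntegral_mono' measurableSet_Ioi fun θ hθ => ?_
          have hθ' : 0 < θ := hθ
          have hm : 0 ≤ min 1 (1 / θ) ^ m := by positivity
          rcases le_or_gt (wrightDensity α θ) 0 with hw | hw
          · rw [ENNReal.ofReal_of_nonpos
              (mul_nonpos_of_nonpos_of_nonneg hw (logGaussian_nonneg hθ'.le))]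
            exact zero_le
          · rw [← ENNReal.ofReal_mul (by positivity), ← ENNReal.ofReal_mul hB.le]
            refine ENNReal.ofReal_le_ofReal ?_
            calc wrightDensity α θ * logGaussian ε θ ≤
                wrightDensity α θ * (B * (θ ^ j * min 1 (1 / θ) ^ m)) :=
                mul_le_mul_of_nonneg_left (hle θ hθ') hw.le
              _ = _ := by ring
  obtain ⟨d₀, hd₀, H₀⟩ := main 0
  obtain ⟨d₁, hd₁, H₁⟩ := main 1
  refine ⟨min d₀ d₁, lt_min hd₀ hd₁, fun α hα hα1 => ⟨?_, ?_⟩⟩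
  · refine (ENNReal.ofReal_le_ofReal (min_le_left _ _)).trans ((H₀ α hα hα1).trans_eq ?_)
    simp
  · refine (ENNReal.ofReal_le_ofReal (min_le_right _ _)).trans ((H₁ α hα hα1).trans_eq ?_)
    simp

end

section

/-! ### Moments of the M-Wright function -/

/-- Boundedness near 0 allows every k > -1. At infinity the decay θ^(-1-1/α) with 1/α > 1 allows k
up to 1, that is, the first moment required by S_α. -/
lemma lintegral_wrightDensity_mul_rpow_lt_top {α : ℝ} (h0 : 0 < α) (h1 : α < 1) {k : ℝ}
    (hk : -1 < k) (hk1 : k ≤ 1) :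
    ∫⁻ θ in Set.Ioi (0 : ℝ), ENNReal.ofReal (wrightDensity α θ) * ENNReal.ofReal (θ ^ k) < ∞ := by
  obtain ⟨C, hC, hCb⟩ := exists_abs_wrightDensity_le h0 h1
  obtain ⟨D, hD, hDb⟩ := exists_abs_wrightDensity_le_rpow h0 h1
  rw [← Set.Ioc_union_Ioi_eq_Ioi zero_le_one]
  refine (lintegral_union_le _ _ _).trans_lt (ENNReal.add_lt_top.2 ⟨?_, ?_⟩)
  · have hint : IntegrableOn (fun θ : ℝ => C * θ ^ k) (Set.Ioc 0 1) :=
      ((intervalIntegrable_iff_integrableOn_Ioc_of_le zero_le_one).1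
        (intervalIntegral.intervalIntegrable_rpow' hk)).const_mul C
    refine lt_of_le_of_lt (setLIntegral_mono' measurableSet_Ioc fun θ hθ => ?_)
      hint.lintegral_lt_top
    rw [ENNReal.ofReal_mul hC.le]
    gcongr
    exact (le_abs_self _).trans (hCb θ hθ.1.le)
  · have hα : 1 < 1 / α := by rw [lt_div_iff₀ h0]; linarith
    have hint : IntegrableOn (fun θ : ℝ => D * θ ^ (-(1 + 1 / α) + k)) (Set.Ioi 1) :=
      (integrableOn_Ioi_rpow_of_lt (by linarith) one_pos).const_mul D
    refine lt_of_le_of_lt (setLIntegral_mono' measurableSet_Ioi fun θ hθ => ?_)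
      hint.lintegral_lt_top
    have hθ' : 0 < θ := zero_lt_one.trans hθ
    rw [Real.rpow_add hθ', ← mul_assoc, ENNReal.ofReal_mul (by positivity)]
    gcongr
    exact (le_abs_self _).trans (hDb θ hθ')

lemma lintegral_mul_wrightDensity_mul_rpow_lt_top {α : ℝ} (h0 : 0 < α) (h1 : α < 1) {k : ℝ}
    (hk : -2 < k) (hk1 : k ≤ 0) :
    ∫⁻ θ in Set.Ioi (0 : ℝ), ENNReal.ofReal (θ * wrightDensity α θ) * ENNReal.ofReal (θ ^ k)
      < ∞ := by
  refine lt_of_eq_of_lt (setLIntegral_congr_fun measurableSet_Ioi fun θ hθ => ?_)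
    (lintegral_wrightDensity_mul_rpow_lt_top h0 h1 (k := 1 + k) (by linarith) (by linarith))
  have hθ' : 0 < θ := hθ
  rw [Real.rpow_add hθ', Real.rpow_one, ENNReal.ofReal_mul hθ'.le, ENNReal.ofReal_mul hθ'.le]
  ring

/-! ### The heat kernel -/

variable {N : ℕ}

lemma one_lt_fujitaExponent (hN : 1 ≤ N) : 1 < fujitaExponent N := by
  have hN' : (0 : ℝ) < N := by exact_mod_cast hN
  rw [fujitaExponent, lt_add_iff_pos_right]
  positivity

lemma heatKernel_nonneg {t : ℝ} (ht : 0 ≤ t) (x : EuclideanSpace ℝ (Fin N)) :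
    0 ≤ heatKernel t x := by
  unfold heatKernel; positivity

lemma measurable_heatKernel :
    Measurable fun z : ℝ × EuclideanSpace ℝ (Fin N) => heatKernel z.1 z.2 := by
  unfold heatKernel
  fun_prop

lemma lintegral_heatKernel_rpow {τ q : ℝ} (hτ : 0 < τ) (hq : 0 < q)
    (y : EuclideanSpace ℝ (Fin N)) :
    ∫⁻ x, ENNReal.ofReal (heatKernel τ (x - y)) ^ q =
      ENNReal.ofReal ((4 * Real.pi * τ) ^ (-((N : ℝ) / 2) * (q - 1)) * q ^ (-((N : ℝ) / 2))) := by
  have hπ := Real.pi_pos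
  have hb : 0 < q / (4 * τ) := by positivity
  have h4 : 0 < 4 * Real.pi * τ := by positivity
  rw [lintegral_sub_right_eq_self (fun x => ENNReal.ofReal (heatKernel τ x) ^ q) y]
  have e : ∀ x : EuclideanSpace ℝ (Fin N), ENNReal.ofReal (heatKernel τ x) ^ q =
      ENNReal.ofReal ((4 * Real.pi * τ) ^ (-((N : ℝ) / 2) * q) *
        Real.exp (-(q / (4 * τ)) * ‖x‖ ^ 2)) := by
    intro x
    rw [ENNReal.ofReal_rpow_of_nonneg (heatKernel_nonneg hτ.le x) hq.le, heatKernel,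
      Real.mul_rpow (by positivity) (Real.exp_pos _).le, ← Real.rpow_mul h4.le, ← Real.exp_mul]
    congr 3
    ring
  have hint : Integrable
      (fun x : EuclideanSpace ℝ (Fin N) => Real.exp (-(q / (4 * τ)) * ‖x‖ ^ 2)) := by
    refine Integrable.of_integral_ne_zero ?_
    rw [GaussianFourier.integral_rexp_neg_mul_sq_norm hb]
    positivity
  simp only [e]
  rw [← ofReal_integral_eq_lintegral_ofReal (hint.const_mul _)
    (Filter.Eventually.of_forall fun x => by positivity), integral_const_mul,
    GaussianFourier.integral_rexp_neg_mul_sq_norm hb]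
  congr 1
  have e2 : Real.pi / (q / (4 * τ)) = (4 * Real.pi * τ) * q⁻¹ := by field_simp
  rw [finrank_euclideanSpace_fin, e2, Real.mul_rpow h4.le (by positivity), ← mul_assoc,
    ← Real.rpow_add h4, Real.inv_rpow hq.le, ← Real.rpow_neg hq.le]
  ring_nf

lemma lintegral_heatKernel {τ : ℝ} (hτ : 0 < τ) (y : EuclideanSpace ℝ (Fin N)) :
    ∫⁻ x, ENNReal.ofReal (heatKernel τ (x - y)) = 1 := by
  have := lintegral_heatKernel_rpow hτ one_pos y
  simpa using this

lemma lintegral_heatKernel_left {τ : ℝ} (hτ : 0 < τ) (x : EuclideanSpace ℝ (Fin N)) :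
    ∫⁻ y, ENNReal.ofReal (heatKernel τ (x - y)) = 1 := by
  rw [← lintegral_heatKernel hτ x]
  refine lintegral_congr fun y => ?_
  rw [heatKernel, heatKernel, norm_sub_rev]

/-- The scaling exponent (N/2)(p - 1) equals 1: this is where the Fujita exponent enters the global
existence proof. -/
lemma lintegral_heatKernel_fujita (hN : 1 ≤ N) {τ : ℝ} (hτ : 0 < τ)
    (y : EuclideanSpace ℝ (Fin N)) :
    ∫⁻ x, ENNReal.ofReal (heatKernel τ (x - y)) ^ fujitaExponent N ≤ ENNReal.ofReal (τ⁻¹) := by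
  have hN' : (0 : ℝ) < N := by exact_mod_cast hN
  have hq : 1 < fujitaExponent N := by
    unfold fujitaExponent
    have : 0 < 2 / (N : ℝ) := by positivity
    linarith
  rw [lintegral_heatKernel_rpow hτ (by linarith) y]
  refine ENNReal.ofReal_le_ofReal ?_
  have e : -((N : ℝ) / 2) * (fujitaExponent N - 1) = -1 := by
    unfold fujitaExponent; field_simp; ring
  rw [e, Real.rpow_neg_one]
  have h1 : fujitaExponent N ^ (-((N : ℝ) / 2)) ≤ 1 :=
    Real.rpow_le_one_of_one_le_of_nonpos hq.le (by linarith [half_pos hN'])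
  have h2 : τ ≤ 4 * Real.pi * τ := by nlinarith [Real.pi_gt_three]
  calc _ ≤ (4 * Real.pi * τ)⁻¹ * 1 := by gcongr
    _ ≤ τ⁻¹ := by rw [mul_one]; exact inv_anti₀ hτ h2

/-- A fixed portion of the heat emitted from a point of a ball of radius `ρ` is still in the
ball as long as `τ ≲ ρ²`. -/
lemma exists_le_setLIntegral_heatKernel :
    ∃ c : ℝ, 0 < c ∧ ∀ ρ τ : ℝ, 0 < ρ → 0 < τ → ∀ y : EuclideanSpace ℝ (Fin N), ‖y‖ ≤ ρ →
      ENNReal.ofReal (c * min 1 (ρ ^ 2 / τ) ^ ((N : ℝ) / 2)) ≤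
        ∫⁻ x in Metric.closedBall 0 ρ, ENNReal.ofReal (heatKernel τ (x - y)) := by
  set E := EuclideanSpace ℝ (Fin N)
  have hπ := Real.pi_pos
  have hω0 : 0 < volume (Metric.ball (0 : E) 1) := Metric.measure_ball_pos _ _ one_pos
  have hωt : volume (Metric.ball (0 : E) 1) ≠ ∞ := measure_ball_lt_top.ne
  set ω := (volume (Metric.ball (0 : E) 1)).toReal with hω
  have hωp : 0 < ω := ENNReal.toReal_pos hω0.ne' hωt
  refine ⟨(4 * Real.pi) ^ (-((N : ℝ) / 2)) * Real.exp (-(1 / 4)) * ((1 / 4) ^ ((N : ℝ) / 2) * ω),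
    by positivity, fun ρ τ hρ hτ y hy => ?_⟩
  -- At distance at most r ≤ √τ the kernel is comparable with τ^(-N/2), so a ball of radius r/2
  -- receives a fixed multiple of (r²/τ)^(N/2).
  set r := min (√τ) ρ with hr
  have hr0 : 0 < r := lt_min (Real.sqrt_pos.2 hτ) hρ
  have hrρ : r ≤ ρ := min_le_right _ _
  have hr2 : r ^ 2 = min τ (ρ ^ 2) := by
    rw [hr]
    rcases le_total (√τ) ρ with h | h
    · rw [min_eq_left h, Real.sq_sqrt hτ.le, min_eq_left]
      calc τ = √τ ^ 2 := (Real.sq_sqrt hτ.le).symm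
        _ ≤ ρ ^ 2 := by gcongr
    · rw [min_eq_right h, min_eq_right]
      calc ρ ^ 2 ≤ √τ ^ 2 := by gcongr
        _ = τ := Real.sq_sqrt hτ.le
  have hr2τ : r ^ 2 ≤ τ := hr2 ▸ min_le_left _ _
  -- The point y is pulled towards the origin by at most r/2, so that the ball of radius r/2 about z
  -- stays inside the large ball and within r of y.
  set z : E := (1 - r / (2 * ρ)) • y with hz
  have hfrac : 0 ≤ r / (2 * ρ) ∧ r / (2 * ρ) ≤ 1 / 2 :=
    ⟨by positivity, by rw [div_le_div_iff₀ (by positivity) (by norm_num)]; linarith⟩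
  have hsub : Metric.closedBall z (r / 2) ⊆ Metric.closedBall (0 : E) ρ := by
    intro x hx
    rw [mem_closedBall_iff_norm] at hx
    rw [mem_closedBall_zero_iff]
    have h1 : ‖z‖ ≤ ρ - r / 2 := by
      rw [hz, norm_smul, Real.norm_of_nonneg (by linarith)]
      calc (1 - r / (2 * ρ)) * ‖y‖ ≤ (1 - r / (2 * ρ)) * ρ :=
            mul_le_mul_of_nonneg_left hy (by linarith)
        _ = ρ - r / 2 := by field_simp
    calc ‖x‖ = ‖(x - z) + z‖ := by rw [sub_add_cancel]
      _ ≤ ‖x - z‖ + ‖z‖ := norm_add_le _ _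
      _ ≤ ρ := by linarith
  have hdist : ∀ x ∈ Metric.closedBall z (r / 2), ‖x - y‖ ≤ r := by
    intro x hx
    rw [mem_closedBall_iff_norm] at hx
    have h1 : ‖z - y‖ ≤ r / 2 := by
      have : z - y = (-(r / (2 * ρ))) • y := by rw [hz]; module
      rw [this, norm_smul, norm_neg, Real.norm_of_nonneg hfrac.1]
      calc r / (2 * ρ) * ‖y‖ ≤ r / (2 * ρ) * ρ := mul_le_mul_of_nonneg_left hy hfrac.1
        _ = r / 2 := by field_simp
    calc ‖x - y‖ = ‖(x - z) + (z - y)‖ := by rw [sub_add_sub_cancel]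
      _ ≤ ‖x - z‖ + ‖z - y‖ := norm_add_le _ _
      _ ≤ r := by linarith
  have hlow : ∀ x ∈ Metric.closedBall z (r / 2),
      ENNReal.ofReal ((4 * Real.pi * τ) ^ (-((N : ℝ) / 2)) * Real.exp (-(1 / 4))) ≤
        ENNReal.ofReal (heatKernel τ (x - y)) := by
    intro x hx
    refine ENNReal.ofReal_le_ofReal ?_
    unfold heatKernel
    refine mul_le_mul_of_nonneg_left (Real.exp_le_exp.2 ?_) (by positivity)
    have h1 : ‖x - y‖ ^ 2 ≤ τ := (pow_le_pow_left₀ (norm_nonneg _) (hdist x hx) 2).trans hr2τ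
    rw [neg_div, neg_le_neg_iff, div_le_div_iff₀ (by positivity) (by norm_num)]
    linarith
  calc ENNReal.ofReal ((4 * Real.pi) ^ (-((N : ℝ) / 2)) * Real.exp (-(1 / 4)) *
        ((1 / 4) ^ ((N : ℝ) / 2) * ω) * min 1 (ρ ^ 2 / τ) ^ ((N : ℝ) / 2))
      = ENNReal.ofReal ((4 * Real.pi * τ) ^ (-((N : ℝ) / 2)) * Real.exp (-(1 / 4))) *
        volume (Metric.closedBall z (r / 2)) := by
        rw [Measure.addHaar_closedBall _ _ (by positivity), finrank_euclideanSpace_fin,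
          ← ENNReal.ofReal_toReal hωt, ← hω, ← ENNReal.ofReal_mul (by positivity),
          ← ENNReal.ofReal_mul (by positivity)]
        congr 1
        have e1 : min 1 (ρ ^ 2 / τ) = r ^ 2 * τ⁻¹ := by
          rw [hr2, min_mul_of_nonneg _ _ (by positivity), mul_inv_cancel₀ hτ.ne', div_eq_mul_inv]
        have e2 : (r / 2) ^ N = (r ^ 2) ^ ((N : ℝ) / 2) * (1 / 4) ^ ((N : ℝ) / 2) := by
          rw [← Real.mul_rpow (by positivity) (by norm_num)]
          have : r ^ 2 * (1 / 4) = (r / 2) ^ (2 : ℝ) := by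
            rw [Real.rpow_two]; ring
          rw [this, ← Real.rpow_mul (by positivity), mul_div_cancel₀ _ (by norm_num),
            Real.rpow_natCast]
        have e3 : (r ^ 2 * τ⁻¹) ^ ((N : ℝ) / 2) = (r ^ 2) ^ ((N : ℝ) / 2) * τ ^ (-((N : ℝ) / 2)) := by
          rw [Real.mul_rpow (by positivity) (by positivity), Real.inv_rpow hτ.le,
            ← Real.rpow_neg hτ.le]
        have e4 : (4 * Real.pi * τ) ^ (-((N : ℝ) / 2)) =
            (4 * Real.pi) ^ (-((N : ℝ) / 2)) * τ ^ (-((N : ℝ) / 2)) :=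
          Real.mul_rpow (by positivity) hτ.le
        rw [e1, e2, e3, e4]
        ring
    _ = ∫⁻ _ in Metric.closedBall z (r / 2),
        ENNReal.ofReal ((4 * Real.pi * τ) ^ (-((N : ℝ) / 2)) * Real.exp (-(1 / 4))) := by
        rw [setLIntegral_const]
    _ ≤ ∫⁻ x in Metric.closedBall z (r / 2), ENNReal.ofReal (heatKernel τ (x - y)) :=
        setLIntegral_mono' measurableSet_closedBall hlow
    _ ≤ _ := lintegral_mono_set hsub

/-! ### The linear operators -/

lemma measurable_heatSemigroup (μ : Measure (EuclideanSpace ℝ (Fin N))) [SFinite μ] :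
    Measurable fun z : ℝ × EuclideanSpace ℝ (Fin N) => heatSemigroup z.1 μ z.2 := by
  unfold heatSemigroup
  refine Measurable.lintegral_prod_right' (f := fun w : (ℝ × EuclideanSpace ℝ (Fin N)) ×
    EuclideanSpace ℝ (Fin N) => ENNReal.ofReal (heatKernel w.1.1 (w.1.2 - w.2))) ?_
  exact (measurable_heatKernel.comp (by fun_prop : Measurable fun w : (ℝ ×
    EuclideanSpace ℝ (Fin N)) × EuclideanSpace ℝ (Fin N) => (w.1.1, w.1.2 - w.2))).ennreal_ofReal

lemma measurable_operatorP {α : ℝ} (h0 : 0 < α) (h1 : α < 1)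
    (μ : Measure (EuclideanSpace ℝ (Fin N))) [SFinite μ] :
    Measurable fun z : ℝ × EuclideanSpace ℝ (Fin N) => operatorP α z.1 μ z.2 := by
  unfold operatorP
  refine Measurable.lintegral_prod_right' (f := fun w : (ℝ × EuclideanSpace ℝ (Fin N)) × ℝ =>
    ENNReal.ofReal (wrightDensity α w.2) * heatSemigroup (w.1.1 ^ α * w.2) μ w.1.2) ?_
  refine ((measurable_wrightDensity h0 h1).comp measurable_snd).ennreal_ofReal.mul ?_
  exact (measurable_heatSemigroup μ).comp (by fun_prop : Measurable fun w : (ℝ ×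
    EuclideanSpace ℝ (Fin N)) × ℝ => (w.1.1 ^ α * w.2, w.1.2))

lemma heatSemigroup_withDensity {f : EuclideanSpace ℝ (Fin N) → ℝ≥0∞} (hf : Measurable f)
    (t : ℝ) (x : EuclideanSpace ℝ (Fin N)) :
    heatSemigroup t (volume.withDensity f) x =
      ∫⁻ y, f y * ENNReal.ofReal (heatKernel t (x - y)) := by
  unfold heatSemigroup
  rw [lintegral_withDensity_eq_lintegral_mul _ hf]
  · rfl
  · exact (measurable_heatKernel.comp (by fun_prop : Measurable fun y :
      EuclideanSpace ℝ (Fin N) => (t, x - y))).ennreal_ofReal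

lemma measurable_operatorS {α : ℝ} (h0 : 0 < α) (h1 : α < 1)
    {f : ℝ → EuclideanSpace ℝ (Fin N) → ℝ≥0∞}
    (hf : Measurable fun z : ℝ × EuclideanSpace ℝ (Fin N) => f z.1 z.2) :
    Measurable fun z : (ℝ × EuclideanSpace ℝ (Fin N)) × ℝ =>
      operatorS α (z.1.1 - z.2) (volume.withDensity (f z.2)) z.1.2 := by
  have e : ∀ z : (ℝ × EuclideanSpace ℝ (Fin N)) × ℝ,
      operatorS α (z.1.1 - z.2) (volume.withDensity (f z.2)) z.1.2 =
      ∫⁻ θ in Set.Ioi (0 : ℝ), ENNReal.ofReal (θ * wrightDensity α θ) * ∫⁻ y, f z.2 y *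
        ENNReal.ofReal (heatKernel ((z.1.1 - z.2) ^ α * θ) (z.1.2 - y)) := by
    intro z
    unfold operatorS
    refine lintegral_congr fun θ => ?_
    have hz : Measurable (f z.2) := hf.comp measurable_prodMk_left
    rw [heatSemigroup_withDensity hz]
  simp only [e]
  refine Measurable.lintegral_prod_right' (f := fun w : ((ℝ × EuclideanSpace ℝ (Fin N)) × ℝ) × ℝ =>
    ENNReal.ofReal (w.2 * wrightDensity α w.2) * ∫⁻ y, f w.1.2 y *
        ENNReal.ofReal (heatKernel ((w.1.1.1 - w.1.2) ^ α * w.2) (w.1.1.2 - y))) ?_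
  refine (measurable_snd.mul
    ((measurable_wrightDensity h0 h1).comp measurable_snd)).ennreal_ofReal.mul ?_
  refine Measurable.lintegral_prod_right' (f := fun v : (((ℝ × EuclideanSpace ℝ (Fin N)) × ℝ) × ℝ)
    × EuclideanSpace ℝ (Fin N) => f v.1.1.2 v.2 *
        ENNReal.ofReal (heatKernel ((v.1.1.1.1 - v.1.1.2) ^ α * v.1.2) (v.1.1.1.2 - v.2))) ?_
  refine Measurable.mul ?_ (Measurable.ennreal_ofReal ?_)
  · exact hf.comp (by fun_prop : Measurable fun v : (((ℝ × EuclideanSpace ℝ (Fin N)) × ℝ) × ℝ)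
      × EuclideanSpace ℝ (Fin N) => (v.1.1.2, v.2))
  · exact measurable_heatKernel.comp (by fun_prop : Measurable fun v :
      (((ℝ × EuclideanSpace ℝ (Fin N)) × ℝ) × ℝ) × EuclideanSpace ℝ (Fin N) =>
        ((v.1.1.1.1 - v.1.1.2) ^ α * v.1.2, v.1.1.1.2 - v.2))

lemma measurable_mildRHS {α : ℝ} (h0 : 0 < α) (h1 : α < 1) (p : ℝ)
    (μ : Measure (EuclideanSpace ℝ (Fin N))) [SFinite μ]
    {u : ℝ → EuclideanSpace ℝ (Fin N) → ℝ≥0∞}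
    (hu : Measurable fun z : ℝ × EuclideanSpace ℝ (Fin N) => u z.1 z.2) :
    Measurable fun z : ℝ × EuclideanSpace ℝ (Fin N) => mildRHS p α μ u z.1 z.2 := by
  unfold mildRHS
  refine (measurable_operatorP h0 h1 μ).add (Measurable.const_mul ?_ _)
  have hm : MeasurableSet {w : (ℝ × EuclideanSpace ℝ (Fin N)) × ℝ | w.2 ∈ Set.Ioo 0 w.1.1} :=
    (measurableSet_lt measurable_const measurable_snd).inter
      (measurableSet_lt measurable_snd measurable_fst.fst)
  have e : ∀ z : ℝ × EuclideanSpace ℝ (Fin N), (∫⁻ s in Set.Ioo (0 : ℝ) z.1,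
      ENNReal.ofReal ((z.1 - s) ^ (α - 1)) *
        operatorS α (z.1 - s) (volume.withDensity fun y => u s y ^ p) z.2) =
      ∫⁻ s, {w : (ℝ × EuclideanSpace ℝ (Fin N)) × ℝ | w.2 ∈ Set.Ioo 0 w.1.1}.indicator
        (fun w => ENNReal.ofReal ((w.1.1 - w.2) ^ (α - 1)) *
        operatorS α (w.1.1 - w.2) (volume.withDensity fun y => u w.2 y ^ p) w.1.2) (z, s) := by
    intro z
    rw [← lintegral_indicator measurableSet_Ioo]
    rfl
  simp only [e]
  refine Measurable.lintegral_prod_right' (Measurable.indicator (Measurable.mul ?_ ?_) hm)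
  · fun_prop
  · exact measurable_operatorS h0 h1 (f := fun s y => u s y ^ p) (hu.pow_const p)

end

section

/-! ### The minimal solution as a limit of Picard iterates -/

variable {N : ℕ}

lemma heatSemigroup_mono {μ ν : Measure (EuclideanSpace ℝ (Fin N))} (h : μ ≤ ν) (t : ℝ)
    (x : EuclideanSpace ℝ (Fin N)) : heatSemigroup t μ x ≤ heatSemigroup t ν x :=
  lintegral_mono' h le_rfl

lemma operatorS_mono {μ ν : Measure (EuclideanSpace ℝ (Fin N))} (h : μ ≤ ν) (α t : ℝ)
    (x : EuclideanSpace ℝ (Fin N)) : operatorS α t μ x ≤ operatorS α t ν x :=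
  lintegral_mono fun _ => mul_le_mul_right (heatSemigroup_mono h _ _) _

lemma operatorP_mono {μ ν : Measure (EuclideanSpace ℝ (Fin N))} (h : μ ≤ ν) (α t : ℝ)
    (x : EuclideanSpace ℝ (Fin N)) : operatorP α t μ x ≤ operatorP α t ν x :=
  lintegral_mono fun _ => mul_le_mul_right (heatSemigroup_mono h _ _) _

lemma mildRHS_mono {p α T : ℝ} (hp : 0 ≤ p) {μ ν : Measure (EuclideanSpace ℝ (Fin N))}
    (h : μ ≤ ν) {u v : ℝ → EuclideanSpace ℝ (Fin N) → ℝ≥0∞}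
    (huv : ∀ᵐ t ∂(volume.restrict (Set.Ioc (0 : ℝ) T)), ∀ᵐ x, u t x ≤ v t x) {t : ℝ} (ht : t ≤ T)
    (x : EuclideanSpace ℝ (Fin N)) : mildRHS p α μ u t x ≤ mildRHS p α ν v t x := by
  refine add_le_add (operatorP_mono h _ _ _) (mul_le_mul_right ?_ _)
  refine lintegral_mono_ae ?_
  have hsub : Set.Ioo (0 : ℝ) t ⊆ Set.Ioc 0 T := fun s hs => ⟨hs.1, (hs.2.trans_le ht).le⟩
  filter_upwards [ae_restrict_of_ae_restrict_of_subset hsub huv] with s hs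
  refine mul_le_mul_right (operatorS_mono (withDensity_mono ?_) _ _ _) _
  filter_upwards [hs] with y hy
  exact ENNReal.rpow_le_rpow hy hp

lemma operatorS_iSup {α : ℝ} (h0 : 0 < α) (h1 : α < 1) (t : ℝ) (x : EuclideanSpace ℝ (Fin N))
    {f : ℕ → EuclideanSpace ℝ (Fin N) → ℝ≥0∞} (hf : ∀ n, Measurable (f n)) (hm : Monotone f) :
    operatorS α t (volume.withDensity fun y => ⨆ n, f n y) x =
      ⨆ n, operatorS α t (volume.withDensity (f n)) x := by
  have hk : ∀ s : ℝ, Measurable fun y : EuclideanSpace ℝ (Fin N) =>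
      ENNReal.ofReal (heatKernel s (x - y)) := fun s =>
    (measurable_heatKernel.comp (by fun_prop : Measurable fun y :
      EuclideanSpace ℝ (Fin N) => (s, x - y))).ennreal_ofReal
  have e : ∀ s : ℝ, heatSemigroup s (volume.withDensity fun y => ⨆ n, f n y) x =
      ⨆ n, heatSemigroup s (volume.withDensity (f n)) x := by
    intro s
    rw [heatSemigroup_withDensity (Measurable.iSup hf)]
    simp only [heatSemigroup_withDensity (hf _), ENNReal.iSup_mul]
    exact lintegral_iSup (fun n => (hf n).mul (hk s))
      fun i j hij y => mul_le_mul_left (hm hij y) _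
  unfold operatorS
  simp only [e, ENNReal.mul_iSup]
  refine lintegral_iSup (fun n => ?_) fun i j hij θ => mul_le_mul_right ?_ _
  · refine (measurable_id.mul (measurable_wrightDensity h0 h1)).ennreal_ofReal.mul ?_
    exact (measurable_heatSemigroup (volume.withDensity (f n))).comp
      (by fun_prop : Measurable fun θ : ℝ => (t ^ α * θ, x))
  · exact heatSemigroup_mono (withDensity_mono (Filter.Eventually.of_forall (hm hij))) _ _

lemma rpow_iSup {p : ℝ} (hp : 0 < p) (f : ℕ → ℝ≥0∞) : (⨆ n, f n) ^ p = ⨆ n, f n ^ p := by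
  exact (ENNReal.orderIsoRpow p hp).map_iSup f

/-- Monotone convergence through the integrals in y, θ and s. It makes the limit of the iterates a
fixed point everywhere, with the value ∞ allowed. -/
lemma mildRHS_iSup {p α : ℝ} (hp : 0 < p) (h0 : 0 < α) (h1 : α < 1)
    (μ : Measure (EuclideanSpace ℝ (Fin N))) {u : ℕ → ℝ → EuclideanSpace ℝ (Fin N) → ℝ≥0∞}
    (hu : ∀ n, Measurable fun z : ℝ × EuclideanSpace ℝ (Fin N) => u n z.1 z.2)
    (hm : Monotone u) (t : ℝ) (x : EuclideanSpace ℝ (Fin N)) :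
    mildRHS p α μ (fun s y => ⨆ n, u n s y) t x = ⨆ n, mildRHS p α μ (u n) t x := by
  unfold mildRHS
  rw [← ENNReal.add_iSup, ← ENNReal.mul_iSup]
  congr 2
  have e : ∀ s : ℝ, operatorS α (t - s) (volume.withDensity fun y => (⨆ n, u n s y) ^ p) x =
      ⨆ n, operatorS α (t - s) (volume.withDensity fun y => u n s y ^ p) x := by
    intro s
    simp only [rpow_iSup hp]
    refine operatorS_iSup h0 h1 (t - s) x
      (fun n => ((hu n).comp measurable_prodMk_left).pow_const p) fun i j hij y => ?_
    exact ENNReal.rpow_le_rpow (hm hij s y) hp.le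
  have hS : ∀ n, Measurable fun s : ℝ =>
      operatorS α (t - s) (volume.withDensity fun y => u n s y ^ p) x := fun n =>
    Measurable.comp (g := fun z : (ℝ × EuclideanSpace ℝ (Fin N)) × ℝ =>
      operatorS α (z.1.1 - z.2) (volume.withDensity fun y => u n z.2 y ^ p) z.1.2)
      (f := fun s : ℝ => ((t, x), s))
      (measurable_operatorS h0 h1 (f := fun s y => u n s y ^ p) ((hu n).pow_const p))
      (by fun_prop)
  simp only [e, ENNReal.mul_iSup]
  refine lintegral_iSup (fun n => Measurable.mul (by fun_prop) (hS n)) fun i j hij s =>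
    mul_le_mul_right (operatorS_mono (withDensity_mono ?_) _ _ _) _
  · exact Filter.Eventually.of_forall fun y => ENNReal.rpow_le_rpow (hm hij s y) hp.le

/-- The Picard iterates of the integral equation, starting from `0`. -/
def picard (p α : ℝ) (μ : Measure (EuclideanSpace ℝ (Fin N))) :
    ℕ → ℝ → EuclideanSpace ℝ (Fin N) → ℝ≥0∞
  | 0 => fun _ _ => 0
  | n + 1 => mildRHS p α μ (picard p α μ n)

/-- The limit of the Picard iterates. -/
def picardLimit (p α : ℝ) (μ : Measure (EuclideanSpace ℝ (Fin N))) (t : ℝ)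
    (x : EuclideanSpace ℝ (Fin N)) : ℝ≥0∞ := ⨆ n, picard p α μ n t x

variable {p α T : ℝ} {μ ν : Measure (EuclideanSpace ℝ (Fin N))}
  {v : ℝ → EuclideanSpace ℝ (Fin N) → ℝ≥0∞}

lemma measurable_picard [SFinite μ] (h0 : 0 < α) (h1 : α < 1) (n : ℕ) :
    Measurable fun z : ℝ × EuclideanSpace ℝ (Fin N) => picard p α μ n z.1 z.2 := by
  induction n with
  | zero => exact measurable_const
  | succ n ih => exact measurable_mildRHS h0 h1 p μ ih

lemma measurable_picardLimit [SFinite μ] (h0 : 0 < α) (h1 : α < 1) :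
    Measurable fun z : ℝ × EuclideanSpace ℝ (Fin N) => picardLimit p α μ z.1 z.2 :=
  Measurable.iSup fun n => measurable_picard h0 h1 n

lemma monotone_picard (hp : 0 ≤ p) : Monotone (picard p α μ) := by
  refine monotone_nat_of_le_succ fun n => ?_
  induction n with
  | zero => exact fun t x => zero_le
  | succ n ih =>
    exact fun t x => mildRHS_mono hp le_rfl (T := t) (Filter.Eventually.of_forall fun s =>
      Filter.Eventually.of_forall fun y => ih s y) le_rfl x

lemma picardLimit_eq [SFinite μ] (hp : 0 < p) (h0 : 0 < α) (h1 : α < 1) (t : ℝ)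
    (x : EuclideanSpace ℝ (Fin N)) :
    picardLimit p α μ t x = mildRHS p α μ (picardLimit p α μ) t x := by
  have h := mildRHS_iSup hp h0 h1 μ (fun n => measurable_picard (p := p) (μ := μ) h0 h1 n)
    (monotone_picard hp.le) t x
  refine Eq.trans ?_ h.symm
  unfold picardLimit
  refine le_antisymm (iSup_le fun n => ?_) (iSup_le fun n => le_iSup_of_le (n + 1) le_rfl)
  exact le_iSup_of_le n (monotone_picard hp.le n.le_succ t x)

/-- By induction every iterate stays below v, as the right-hand side is monotone in u and in μ.
Applied to solutions it yields minimality; applied to explicit supersolutions, existence. -/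
lemma picardLimit_le_of_supersolution (hp : 0 ≤ p) (hμν : μ ≤ ν)
    (hv : ∀ᵐ t ∂(volume.restrict (Set.Ioc (0 : ℝ) T)), ∀ᵐ x, mildRHS p α ν v t x ≤ v t x) :
    ∀ᵐ t ∂(volume.restrict (Set.Ioc (0 : ℝ) T)), ∀ᵐ x, picardLimit p α μ t x ≤ v t x := by
  have key : ∀ n, ∀ᵐ t ∂(volume.restrict (Set.Ioc (0 : ℝ) T)), ∀ᵐ x, picard p α μ n t x ≤ v t x := by
    intro n
    induction n with
    | zero => exact Filter.Eventually.of_forall fun t => Filter.Eventually.of_forall fun x => zero_le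
    | succ n ih =>
      filter_upwards [hv, self_mem_ae_restrict measurableSet_Ioc] with t ht hT
      filter_upwards [ht] with x hx
      exact (mildRHS_mono hp hμν ih hT.2 x).trans hx
  filter_upwards [ae_all_iff.2 key] with t ht
  filter_upwards [ae_all_iff.2 ht] with x hx
  exact iSup_le hx

lemma picardLimit_mono (hp : 0 ≤ p) (hμν : μ ≤ ν) (t : ℝ) (x : EuclideanSpace ℝ (Fin N)) :
    picardLimit p α μ t x ≤ picardLimit p α ν t x := by
  have key : ∀ n, picard p α μ n ≤ picard p α ν n := by
    intro n
    induction n with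
    | zero => exact le_rfl
    | succ n ih =>
      exact fun t x => mildRHS_mono hp hμν (T := t) (Filter.Eventually.of_forall fun s =>
        Filter.Eventually.of_forall fun y => ih s y) le_rfl x
  exact iSup_mono fun n => key n t x

/-- The Picard limit is finite almost everywhere on `(0, T] × ℝ^N`. -/
def FiniteUpTo (p α : ℝ) (μ : Measure (EuclideanSpace ℝ (Fin N))) (T : ℝ) : Prop :=
  ∀ᵐ t ∂(volume.restrict (Set.Ioc (0 : ℝ) T)), ∀ᵐ x, picardLimit p α μ t x < ∞

lemma FiniteUpTo.mono_time {T' : ℝ} (h : FiniteUpTo p α μ T) (hT : T' ≤ T) :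
    FiniteUpTo p α μ T' :=
  ae_restrict_of_ae_restrict_of_subset (Set.Ioc_subset_Ioc_right hT) h

lemma FiniteUpTo.anti (hp : 0 ≤ p) (hμν : μ ≤ ν) (h : FiniteUpTo p α ν T) :
    FiniteUpTo p α μ T := by
  filter_upwards [h] with t ht
  filter_upwards [ht] with x hx
  exact (picardLimit_mono hp hμν t x).trans_lt hx

/-- The only obstruction to a minimal solution is that the Picard limit becomes infinite. All later
statements on the life span go through this criterion. -/
lemma exists_isMinimalSolution_iff [SFinite μ] (hp : 0 < p) (h0 : 0 < α) (h1 : α < 1) :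
    (∃ u, IsMinimalSolution p α T μ u) ↔ FiniteUpTo p α μ T := by
  have hle : ∀ w, IsSolution p α T μ w → ∀ᵐ t ∂(volume.restrict (Set.Ioc (0 : ℝ) T)),
      ∀ᵐ x, picardLimit p α μ t x ≤ w t x := by
    intro w hw
    refine picardLimit_le_of_supersolution hp.le le_rfl ?_
    filter_upwards [hw.eq_mildRHS] with t ht
    filter_upwards [ht] with x hx
    exact hx.2.ge
  constructor
  · rintro ⟨u, hu⟩
    filter_upwards [hu.isSolution.eq_mildRHS, hle u hu.isSolution] with t ht ht'
    filter_upwards [ht, ht'] with x hx hx'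
    exact hx'.trans_lt hx.1
  · intro h
    refine ⟨picardLimit p α μ, ⟨measurable_picardLimit h0 h1, ?_⟩, hle⟩
    filter_upwards [h] with t ht
    filter_upwards [ht] with x hx
    exact ⟨hx, picardLimit_eq hp h0 h1 t x⟩

lemma lifeSpan_eq [SFinite μ] (hp : 0 < p) (h0 : 0 < α) (h1 : α < 1) :
    lifeSpan p α μ = sSup {τ : ℝ≥0∞ | ∃ T : ℝ, 0 < T ∧ τ = ENNReal.ofReal T ∧
      FiniteUpTo p α μ T} := by
  unfold lifeSpan
  simp only [exists_isMinimalSolution_iff hp h0 h1]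

lemma FiniteUpTo.le_lifeSpan [SFinite μ] (hp : 0 < p) (h0 : 0 < α) (h1 : α < 1) (hT : 0 < T)
    (h : FiniteUpTo p α μ T) : ENNReal.ofReal T ≤ lifeSpan p α μ := by
  rw [lifeSpan_eq hp h0 h1]
  exact le_sSup ⟨T, hT, rfl, h⟩

lemma finiteUpTo_of_lt_lifeSpan [SFinite μ] (hp : 0 < p) (h0 : 0 < α) (h1 : α < 1)
    (h : ENNReal.ofReal T < lifeSpan p α μ) : FiniteUpTo p α μ T := by
  rw [lifeSpan_eq hp h0 h1] at h
  obtain ⟨_, ⟨T', hT', rfl, hfin⟩, hlt⟩ := lt_sSup_iff.1 h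
  exact hfin.mono_time ((ENNReal.ofReal_lt_ofReal_iff hT').1 hlt).le

lemma lifeSpan_anti [SFinite μ] [SFinite ν] (hp : 0 < p) (h0 : 0 < α) (h1 : α < 1)
    (hμν : μ ≤ ν) : lifeSpan p α ν ≤ lifeSpan p α μ := by
  rw [lifeSpan_eq hp h0 h1, lifeSpan_eq hp h0 h1]
  refine sSup_le_sSup ?_
  rintro _ ⟨T, hT, rfl, h⟩
  exact ⟨T, hT, rfl, h.anti hp.le hμν⟩

end

section

/-! ### Minkowski's integral inequality -/

/-- **Minkowski's integral inequality** for nonnegative functions. -/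
theorem lintegral_lintegral_rpow_le {X Y : Type*} [MeasurableSpace X] [MeasurableSpace Y]
    {μ : Measure X} {ν : Measure Y} [SFinite μ] [SFinite ν] {p : ℝ} (hp : 1 < p)
    {f : X → Y → ℝ≥0∞} (hf : Measurable (Function.uncurry f)) :
    (∫⁻ x, (∫⁻ y, f x y ∂ν) ^ p ∂μ) ^ (1 / p) ≤ ∫⁻ y, (∫⁻ x, f x y ^ p ∂μ) ^ (1 / p) ∂ν := by
  have hp0 : 0 < p := by linarith
  set b : Y → ℝ≥0∞ := fun y => (∫⁻ x, f x y ^ p ∂μ) ^ (1 / p) with hb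
  have hfp : Measurable (Function.uncurry fun x y => f x y ^ p) := hf.pow_const p
  have hbm : Measurable b := (Measurable.lintegral_prod_left' hfp).pow_const _
  have hbp : ∀ y, b y ^ p = ∫⁻ x, f x y ^ p ∂μ := fun y => by
    rw [hb, ← ENNReal.rpow_mul, one_div_mul_cancel hp0.ne', ENNReal.rpow_one]
  have hfx : ∀ x, Measurable (f x) := fun x => hf.comp measurable_prodMk_left
  rcases eq_or_ne (∫⁻ y, b y ∂ν) ∞ with hW | hW
  · rw [hW]; exact le_top
  -- Negative powers of b are used below, so b must be nonzero; where b vanishes, f vanishes almost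
  -- everywhere.
  set S : Set Y := {y | b y ≠ 0} with hS
  have hSm : MeasurableSet S := (hbm (measurableSet_singleton 0)).compl
  have hzero : ∀ᵐ x ∂μ, ∫⁻ y in Sᶜ, f x y ∂ν = 0 := by
    have h1 : ∫⁻ x, ∫⁻ y in Sᶜ, f x y ^ p ∂ν ∂μ = 0 := by
      rw [lintegral_lintegral_swap (f := fun x y => f x y ^ p) hfp.aemeasurable]
      refine (setLIntegral_congr_fun hSm.compl fun y hy => ?_).trans lintegral_zero
      have hy' : b y = 0 := by simpa [hS] using hy
      rw [← hbp, hy', ENNReal.zero_rpow_of_pos hp0]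
    have hm1 : Measurable fun x => ∫⁻ y in Sᶜ, f x y ^ p ∂ν := Measurable.lintegral_prod_right' hfp
    rw [lintegral_eq_zero_iff hm1] at h1
    filter_upwards [h1] with x hx
    have hx' : ∫⁻ y in Sᶜ, f x y ^ p ∂ν = 0 := hx
    rw [lintegral_eq_zero_iff ((hfx x).pow_const p)] at hx'
    rw [lintegral_eq_zero_iff (hfx x)]
    filter_upwards [hx'] with y hy
    exact (ENNReal.rpow_eq_zero_iff_of_pos hp0).1 hy
  have hfin : ∀ᵐ y ∂(ν.restrict S), b y < ∞ :=
    ae_restrict_of_ae (ae_lt_top hbm hW)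
  set W := ∫⁻ y, b y ∂ν
  have hq : p.HolderConjugate (p / (p - 1)) := Real.HolderConjugate.conjExponent hp
  -- Hölder with the weight b^((p-1)/p). After integration in x, the inner integral of f^p is b^p,
  -- and b^p b^(-(p-1)) = b closes the estimate.
  have hpt : ∀ x, (∫⁻ y in S, f x y ∂ν) ^ p ≤
      W ^ (p - 1) * ∫⁻ y in S, f x y ^ p * b y ^ (-(p - 1)) ∂ν := by
    intro x
    have hH := ENNReal.lintegral_mul_le_Lp_mul_Lq (ν.restrict S) hq
      (f := fun y => f x y * b y ^ (-((p - 1) / p))) (g := fun y => b y ^ ((p - 1) / p))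
      ((hfx x).mul (hbm.pow_const _)).aemeasurable (hbm.pow_const _).aemeasurable
    have e1 : ∫⁻ y in S, f x y ∂ν = ∫⁻ y in S, ((fun y => f x y * b y ^ (-((p - 1) / p))) *
        fun y => b y ^ ((p - 1) / p)) y ∂ν := by
      refine lintegral_congr_ae ?_
      filter_upwards [hfin, self_mem_ae_restrict hSm] with y hy hyS
      simp only [Pi.mul_apply]
      rw [mul_assoc, ← ENNReal.rpow_add _ _ hyS hy.ne, neg_add_cancel, ENNReal.rpow_zero, mul_one]
    have e2 : ∫⁻ y in S, (f x y * b y ^ (-((p - 1) / p))) ^ p ∂ν =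
        ∫⁻ y in S, f x y ^ p * b y ^ (-(p - 1)) ∂ν := by
      refine lintegral_congr fun y => ?_
      rw [ENNReal.mul_rpow_of_nonneg _ _ hp0.le, ← ENNReal.rpow_mul]
      congr 2
      field_simp
    have e3 : ∫⁻ y in S, (b y ^ ((p - 1) / p)) ^ (p / (p - 1)) ∂ν ≤ W := by
      refine le_trans (le_of_eq (lintegral_congr fun y => ?_)) (setLIntegral_le_lintegral S b)
      have : (p - 1) / p * (p / (p - 1)) = 1 := by
        have : p - 1 ≠ 0 := by linarith
        field_simp
      rw [← ENNReal.rpow_mul, this, ENNReal.rpow_one]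
    rw [← e1, e2] at hH
    calc (∫⁻ y in S, f x y ∂ν) ^ p
        ≤ ((∫⁻ y in S, f x y ^ p * b y ^ (-(p - 1)) ∂ν) ^ (1 / p) *
          (∫⁻ y in S, (b y ^ ((p - 1) / p)) ^ (p / (p - 1)) ∂ν) ^ (1 / (p / (p - 1)))) ^ p :=
          ENNReal.rpow_le_rpow hH hp0.le
      _ ≤ ((∫⁻ y in S, f x y ^ p * b y ^ (-(p - 1)) ∂ν) ^ (1 / p) *
          W ^ (1 / (p / (p - 1)))) ^ p := by
          have : 0 ≤ 1 / (p / (p - 1)) := by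
            have : 0 < p - 1 := by linarith
            positivity
          gcongr
      _ = _ := by
          have : 1 / (p / (p - 1)) * p = p - 1 := by
            field_simp
          rw [ENNReal.mul_rpow_of_nonneg _ _ hp0.le, ← ENNReal.rpow_mul, ← ENNReal.rpow_mul,
            one_div_mul_cancel hp0.ne', ENNReal.rpow_one, this, mul_comm]
  have hmain : ∫⁻ x, (∫⁻ y, f x y ∂ν) ^ p ∂μ ≤ W ^ p := by
    have hm2 : Measurable (Function.uncurry fun x y => f x y ^ p * b y ^ (-(p - 1))) :=
      hfp.mul ((hbm.comp measurable_snd).pow_const _)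
    calc ∫⁻ x, (∫⁻ y, f x y ∂ν) ^ p ∂μ = ∫⁻ x, (∫⁻ y in S, f x y ∂ν) ^ p ∂μ := by
          refine lintegral_congr_ae ?_
          filter_upwards [hzero] with x hx
          rw [← lintegral_add_compl _ hSm, hx, add_zero]
      _ ≤ ∫⁻ x, W ^ (p - 1) * ∫⁻ y in S, f x y ^ p * b y ^ (-(p - 1)) ∂ν ∂μ :=
          lintegral_mono hpt
      _ = W ^ (p - 1) * ∫⁻ y in S, ∫⁻ x, f x y ^ p * b y ^ (-(p - 1)) ∂μ ∂ν := by
          have hm3 : Measurable fun x => ∫⁻ y in S, f x y ^ p * b y ^ (-(p - 1)) ∂ν :=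
            Measurable.lintegral_prod_right' hm2
          rw [lintegral_const_mul _ hm3, lintegral_lintegral_swap hm2.aemeasurable]
      _ = W ^ (p - 1) * ∫⁻ y in S, b y ∂ν := by
          congr 1
          refine lintegral_congr_ae ?_
          filter_upwards [hfin, self_mem_ae_restrict hSm] with y hy hyS
          have hm4 : Measurable fun x => f x y ^ p := hfp.comp measurable_prodMk_right
          have e : p + -(p - 1) = 1 := by ring
          rw [lintegral_mul_const _ hm4, ← hbp, ← ENNReal.rpow_add _ _ hyS hy.ne, e,
            ENNReal.rpow_one]
      _ ≤ W ^ (p - 1) * W := mul_le_mul_right (setLIntegral_le_lintegral S b) _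
      _ = W ^ p := by
          have h2 := ENNReal.rpow_add_of_nonneg (x := W) (p - 1) 1 (by linarith) zero_le_one
          rw [ENNReal.rpow_one, sub_add_cancel] at h2
          exact h2.symm
  rw [one_div, ENNReal.rpow_inv_le_iff hp0]
  exact hmain

/-! ### Beta integrals -/

lemma setLIntegral_beta_lt_top {a b : ℝ} (ha : 0 < a) (hb : 0 < b) :
    ∫⁻ r in Set.Ioo (0 : ℝ) 1, ENNReal.ofReal ((1 - r) ^ (a - 1) * r ^ (b - 1)) < ∞ := by
  have h := (intervalIntegrable_iff_integrableOn_Ioo_of_le zero_le_one).1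
    (Complex.betaIntegral_convergent (u := b) (v := a) (by simpa) (by simpa))
  refine lt_of_eq_of_lt (setLIntegral_congr_fun measurableSet_Ioo fun r hr => ?_) h.2
  have h1 : 0 < 1 - r := by linarith [hr.2]
  have e : ((r : ℂ) ^ ((b : ℂ) - 1) * (1 - (r : ℂ)) ^ ((a : ℂ) - 1)) =
      (((1 - r) ^ (a - 1) * r ^ (b - 1) : ℝ) : ℂ) := by
    rw [Complex.ofReal_mul, Complex.ofReal_cpow h1.le, Complex.ofReal_cpow hr.1.le, mul_comm]
    push_cast
    rfl
  have hpos : 0 ≤ (1 - r) ^ (a - 1) * r ^ (b - 1) :=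
    mul_nonneg (Real.rpow_nonneg h1.le _) (Real.rpow_nonneg hr.1.le _)
  simp only [e]
  rw [← ofReal_norm, Complex.norm_real, Real.norm_of_nonneg hpos]

lemma setLIntegral_beta_scaled {a b t : ℝ} (ht : 0 < t) :
    ∫⁻ s in Set.Ioo (0 : ℝ) t, ENNReal.ofReal ((t - s) ^ (a - 1) * s ^ (b - 1)) =
      ENNReal.ofReal (t ^ (a + b - 1)) *
        ∫⁻ r in Set.Ioo (0 : ℝ) 1, ENNReal.ofReal ((1 - r) ^ (a - 1) * r ^ (b - 1)) := by
  have himg : (fun r => t * r) '' Set.Ioo (0 : ℝ) 1 = Set.Ioo 0 t := by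
    rw [Set.image_mul_left_Ioo ht]; simp
  rw [← himg, lintegral_image_eq_lintegral_abs_deriv_mul measurableSet_Ioo (f' := fun _ => t)
    (fun x _ => by simpa using ((hasDerivAt_id x).const_mul t).hasDerivWithinAt)
    (fun x _ y _ h => mul_left_cancel₀ ht.ne' h), ← lintegral_const_mul' _ _ ENNReal.ofReal_ne_top]
  refine setLIntegral_congr_fun measurableSet_Ioo fun r hr => ?_
  have h1 : 0 < 1 - r := by linarith [hr.2]
  rw [abs_of_pos ht, ← ENNReal.ofReal_mul ht.le, ← ENNReal.ofReal_mul (by positivity)]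
  congr 1
  have e1 : t - t * r = t * (1 - r) := by ring
  have e2 : t ^ (a + b - 1) = t * t ^ (a - 1) * t ^ (b - 1) := by
    have : a + b - 1 = 1 + (a - 1) + (b - 1) := by ring
    rw [this, Real.rpow_add ht, Real.rpow_add ht, Real.rpow_one]
  rw [e1, Real.mul_rpow ht.le h1.le, Real.mul_rpow ht.le hr.1.le, e2]
  ring

end

section

/-! ### Local existence for bounded data -/

variable {N : ℕ}

lemma heatSemigroup_le_of_le_smul_volume {μ : Measure (EuclideanSpace ℝ (Fin N))} {K : ℝ≥0∞}
    (hμ : μ ≤ K • volume) {τ : ℝ} (hτ : 0 < τ) (x : EuclideanSpace ℝ (Fin N)) :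
    heatSemigroup τ μ x ≤ K := by
  refine (heatSemigroup_mono hμ τ x).trans (le_of_eq ?_)
  rw [heatSemigroup, lintegral_smul_measure, lintegral_heatKernel_left hτ, smul_eq_mul, mul_one]

lemma mul_setLIntegral_rpow {α t : ℝ} (h0 : 0 < α) (ht : 0 < t) :
    ENNReal.ofReal α * ∫⁻ s in Set.Ioo (0 : ℝ) t, ENNReal.ofReal ((t - s) ^ (α - 1)) =
      ENNReal.ofReal (t ^ α) := by
  have himg : (fun r => t - r) '' Set.Ioo (0 : ℝ) t = Set.Ioo 0 t := by
    rw [Set.image_const_sub_Ioo]; simp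
  have hint : IntegrableOn (fun r : ℝ => r ^ (α - 1)) (Set.Ioo 0 t) :=
    (intervalIntegrable_iff_integrableOn_Ioo_of_le ht.le).1
      (intervalIntegral.intervalIntegrable_rpow' (by linarith))
  have h1 : ∫⁻ s in Set.Ioo (0 : ℝ) t, ENNReal.ofReal ((t - s) ^ (α - 1)) =
      ∫⁻ r in Set.Ioo (0 : ℝ) t, ENNReal.ofReal (r ^ (α - 1)) := by
    nth_rewrite 2 [← himg]
    rw [lintegral_image_eq_lintegral_abs_deriv_mul measurableSet_Ioo (f' := fun _ => -1)
      (fun x _ => by simpa using ((hasDerivAt_id x).const_sub t).hasDerivWithinAt)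
      (fun x _ y _ h => by simpa using h)]
    simp
  rw [h1, ← ofReal_integral_eq_lintegral_ofReal hint, ← integral_Ioc_eq_integral_Ioo,
    ← intervalIntegral.integral_of_le ht.le, integral_rpow (Or.inl (by linarith)),
    ← ENNReal.ofReal_mul h0.le]
  · congr 1
    rw [sub_add_cancel, Real.zero_rpow h0.ne', sub_zero]
    field_simp
  · filter_upwards [self_mem_ae_restrict measurableSet_Ioo] with r hr
    exact Real.rpow_nonneg hr.1.le _

/-- Local existence for data with bounded density. -/
theorem exists_finiteUpTo_of_le_smul_volume {p α : ℝ} (hp : 0 < p) (h0 : 0 < α) (h1 : α < 1)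
    {μ : Measure (EuclideanSpace ℝ (Fin N))} {K : ℝ≥0∞} (hK : K ≠ ∞) (hμ : μ ≤ K • volume) :
    ∃ T : ℝ, 0 < T ∧ FiniteUpTo p α μ T := by
  set H₀ := ∫⁻ θ in Set.Ioi (0 : ℝ), ENNReal.ofReal (wrightDensity α θ) with hH₀
  set H₁ := ∫⁻ θ in Set.Ioi (0 : ℝ), ENNReal.ofReal (θ * wrightDensity α θ) with hH₁
  have hH₀t : H₀ ≠ ∞ := by
    have := lintegral_wrightDensity_mul_rpow_lt_top h0 h1 (k := 0) (by norm_num) (by norm_num)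
    simpa using this.ne
  have hH₁t : H₁ ≠ ∞ := by
    have := lintegral_mul_wrightDensity_mul_rpow_lt_top h0 h1 (k := 0) (by norm_num) le_rfl
    simpa using this.ne
  -- A constant supersolution: H₀ K bounds the linear part, and 1 is left for the Duhamel term,
  -- which is at most t^α D.
  set M : ℝ≥0∞ := H₀ * K + 1 with hM
  have hMt : M ≠ ∞ := ENNReal.add_ne_top.2 ⟨ENNReal.mul_ne_top hH₀t hK, ENNReal.one_ne_top⟩
  set D : ℝ≥0∞ := H₁ * M ^ p with hD
  have hDt : D ≠ ∞ := ENNReal.mul_ne_top hH₁t (ENNReal.rpow_ne_top_of_nonneg hp.le hMt)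
  have hT0 : 0 < (D.toReal + 1)⁻¹ ^ (1 / α) := by
    have : 0 ≤ D.toReal := ENNReal.toReal_nonneg
    positivity
  -- Chosen so that T^α (D + 1) = 1.
  refine ⟨(D.toReal + 1)⁻¹ ^ (1 / α), hT0, ?_⟩
  have hS : ∀ τ : ℝ, 0 < τ → ∀ x : EuclideanSpace ℝ (Fin N),
      operatorS α τ (volume.withDensity fun _ => M ^ p) x ≤ D := by
    intro τ hτ x
    rw [hD, hH₁, ← lintegral_mul_const' _ _ (ENNReal.rpow_ne_top_of_nonneg hp.le hMt)]
    refine setLIntegral_mono' measurableSet_Ioi fun θ hθ => mul_le_mul_right ?_ _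
    have hθ' : 0 < θ := hθ
    refine heatSemigroup_le_of_le_smul_volume ?_ (by positivity) x
    rw [withDensity_const]
  have hP : ∀ τ : ℝ, 0 < τ → ∀ x : EuclideanSpace ℝ (Fin N), operatorP α τ μ x ≤ H₀ * K := by
    intro τ hτ x
    rw [hH₀, ← lintegral_mul_const' _ _ hK]
    refine setLIntegral_mono' measurableSet_Ioi fun θ hθ => mul_le_mul_right ?_ _
    have hθ' : 0 < θ := hθ
    exact heatSemigroup_le_of_le_smul_volume hμ (by positivity) x
  have hsuper : ∀ t ∈ Set.Ioc (0 : ℝ) ((D.toReal + 1)⁻¹ ^ (1 / α)),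
      ∀ x : EuclideanSpace ℝ (Fin N), mildRHS p α μ (fun _ _ => M) t x ≤ M := by
    intro t ht x
    refine add_le_add (hP t ht.1 x) ?_
    have htα : t ^ α ≤ (D.toReal + 1)⁻¹ := by
      calc t ^ α ≤ ((D.toReal + 1)⁻¹ ^ (1 / α)) ^ α := Real.rpow_le_rpow ht.1.le ht.2 h0.le
        _ = (D.toReal + 1)⁻¹ := by
          rw [← Real.rpow_mul (by positivity), one_div_mul_cancel h0.ne', Real.rpow_one]
    calc _ ≤ ENNReal.ofReal α * ∫⁻ s in Set.Ioo (0 : ℝ) t,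
          ENNReal.ofReal ((t - s) ^ (α - 1)) * D := by
          refine mul_le_mul_right (setLIntegral_mono' measurableSet_Ioo fun s hs => ?_) _
          exact mul_le_mul_right (hS (t - s) (sub_pos.2 hs.2) x) _
      _ = ENNReal.ofReal (t ^ α) * D := by
          rw [lintegral_mul_const' _ _ hDt, ← mul_assoc, mul_setLIntegral_rpow h0 ht.1]
      _ ≤ ENNReal.ofReal ((D.toReal + 1)⁻¹) * ENNReal.ofReal D.toReal := by
          rw [ENNReal.ofReal_toReal hDt]
          gcongr
      _ ≤ 1 := by
          have hD0 : 0 ≤ D.toReal := ENNReal.toReal_nonneg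
          rw [← ENNReal.ofReal_mul (by positivity)]
          refine ENNReal.ofReal_le_one.2 ?_
          rw [inv_mul_le_iff₀ (by positivity)]
          linarith
  have := picardLimit_le_of_supersolution (T := (D.toReal + 1)⁻¹ ^ (1 / α)) (p := p) (α := α)
    hp.le le_rfl (v := fun _ _ => M) (by
      filter_upwards [self_mem_ae_restrict measurableSet_Ioc] with t ht
      exact Filter.Eventually.of_forall fun x => hsuper t ht x)
  filter_upwards [this] with t ht
  filter_upwards [ht] with x hx
  exact hx.trans_lt hMt.lt_top

/-! ### Global existence for small finite measures -/

variable {p : ℝ}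

/-- Minkowski's inequality moves the L^p norm inside the integral against μ; each kernel has L^p
norm at most τ^(-1/p). -/
lemma heatSemigroup_Lp_le (hN : 1 ≤ N) (hp : p = fujitaExponent N)
    (μ : Measure (EuclideanSpace ℝ (Fin N))) [SFinite μ] {τ : ℝ} (hτ : 0 < τ) :
    (∫⁻ x, heatSemigroup τ μ x ^ p) ^ (1 / p) ≤ ENNReal.ofReal (τ ^ (-(1 / p))) * μ Set.univ := by
  have hp1 : 1 < p := hp ▸ one_lt_fujitaExponent hN
  have hm : Measurable (Function.uncurry fun x y : EuclideanSpace ℝ (Fin N) =>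
      ENNReal.ofReal (heatKernel τ (x - y))) :=
    (measurable_heatKernel.comp (by fun_prop : Measurable fun z : EuclideanSpace ℝ (Fin N) ×
      EuclideanSpace ℝ (Fin N) => (τ, z.1 - z.2))).ennreal_ofReal
  refine (lintegral_lintegral_rpow_le hp1 hm).trans ?_
  rw [← lintegral_const]
  refine lintegral_mono fun y => ?_
  rw [Real.rpow_neg hτ.le, ← Real.inv_rpow hτ.le, ← ENNReal.ofReal_rpow_of_pos (by positivity)]
  refine ENNReal.rpow_le_rpow ?_ (by positivity)
  rw [hp]
  exact lintegral_heatKernel_fujita hN hτ y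

/-- A general weight w serves P_α, with w = h_α, and S_α, with w = θ h_α. Minkowski in θ turns
smoothing at time t^α θ into t^(-α/p) times a moment of order -1/p. -/
lemma operator_Lp_le (hN : 1 ≤ N) (hp : p = fujitaExponent N) {α : ℝ} {w : ℝ → ℝ≥0∞}
    (hw : Measurable w) (μ : Measure (EuclideanSpace ℝ (Fin N))) [SFinite μ] {t : ℝ}
    (ht : 0 < t) :
    (∫⁻ x, (∫⁻ θ in Set.Ioi (0 : ℝ), w θ * heatSemigroup (t ^ α * θ) μ x) ^ p) ^ (1 / p) ≤
      ENNReal.ofReal (t ^ (-(α / p))) *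
        (∫⁻ θ in Set.Ioi (0 : ℝ), w θ * ENNReal.ofReal (θ ^ (-(1 / p)))) * μ Set.univ := by
  have hp1 : 1 < p := hp ▸ one_lt_fujitaExponent hN
  have hp0 : 0 < p := by linarith
  have hm : Measurable (Function.uncurry fun (x : EuclideanSpace ℝ (Fin N)) (θ : ℝ) =>
      w θ * heatSemigroup (t ^ α * θ) μ x) :=
    (hw.comp measurable_snd).mul ((measurable_heatSemigroup μ).comp
      (by fun_prop : Measurable fun z : EuclideanSpace ℝ (Fin N) × ℝ => (t ^ α * z.2, z.1)))
  have hm2 : ∀ τ : ℝ, Measurable fun x : EuclideanSpace ℝ (Fin N) => heatSemigroup τ μ x :=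
    fun τ => (measurable_heatSemigroup μ).comp measurable_prodMk_left
  refine (lintegral_lintegral_rpow_le hp1 hm).trans ?_
  have hwm : Measurable fun θ : ℝ => w θ * ENNReal.ofReal (θ ^ (-(1 / p))) :=
    hw.mul (by fun_prop)
  rw [← lintegral_const_mul _ hwm, ← lintegral_mul_const _ (hwm.const_mul _)]
  refine setLIntegral_mono' measurableSet_Ioi fun θ hθ => ?_
  have hθ' : 0 < θ := hθ
  have e : ∀ x : EuclideanSpace ℝ (Fin N), (w θ * heatSemigroup (t ^ α * θ) μ x) ^ p =
      w θ ^ p * heatSemigroup (t ^ α * θ) μ x ^ p := fun x =>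
    ENNReal.mul_rpow_of_nonneg _ _ hp0.le
  simp only [e]
  rw [lintegral_const_mul _ ((hm2 _).pow_const p), ENNReal.mul_rpow_of_nonneg _ _ (by positivity),
    ← ENNReal.rpow_mul, mul_one_div_cancel hp0.ne', ENNReal.rpow_one]
  refine (mul_le_mul_right (heatSemigroup_Lp_le hN hp μ (by positivity)) _).trans (le_of_eq ?_)
  rw [Real.mul_rpow (by positivity) hθ'.le, ← Real.rpow_mul ht.le,
    ENNReal.ofReal_mul (by positivity)]
  have : α * -(1 / p) = -(α / p) := by ring
  rw [this]
  ring

/-- The nonlinear term of the integral equation, without the factor `α`. -/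
def duhamel (p α : ℝ) (u : ℝ → EuclideanSpace ℝ (Fin N) → ℝ≥0∞) (t : ℝ)
    (x : EuclideanSpace ℝ (Fin N)) : ℝ≥0∞ :=
  ∫⁻ s in Set.Ioo (0 : ℝ) t, ENNReal.ofReal ((t - s) ^ (α - 1)) *
    operatorS α (t - s) (volume.withDensity fun y => u s y ^ p) x

lemma mildRHS_eq (p α : ℝ) (μ : Measure (EuclideanSpace ℝ (Fin N)))
    (u : ℝ → EuclideanSpace ℝ (Fin N) → ℝ≥0∞) (t : ℝ) (x : EuclideanSpace ℝ (Fin N)) :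
    mildRHS p α μ u t x = operatorP α t μ x + ENNReal.ofReal α * duhamel p α u t x := rfl

lemma measurable_duhamel_integrand {α : ℝ} (h0 : 0 < α) (h1 : α < 1)
    {u : ℝ → EuclideanSpace ℝ (Fin N) → ℝ≥0∞}
    (hu : Measurable fun z : ℝ × EuclideanSpace ℝ (Fin N) => u z.1 z.2) (p t : ℝ) :
    Measurable fun z : EuclideanSpace ℝ (Fin N) × ℝ => ENNReal.ofReal ((t - z.2) ^ (α - 1)) *
      operatorS α (t - z.2) (volume.withDensity fun y => u z.2 y ^ p) z.1 :=
  Measurable.mul (by fun_prop) (Measurable.comp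
    (g := fun z : (ℝ × EuclideanSpace ℝ (Fin N)) × ℝ => operatorS α (z.1.1 - z.2)
      (volume.withDensity fun y => u z.2 y ^ p) z.1.2)
    (f := fun z : EuclideanSpace ℝ (Fin N) × ℝ => ((t, z.1), z.2))
    (measurable_operatorS h0 h1 (f := fun s y => u s y ^ p) (hu.pow_const p)) (by fun_prop))

lemma measurable_duhamel {α : ℝ} (h0 : 0 < α) (h1 : α < 1)
    {u : ℝ → EuclideanSpace ℝ (Fin N) → ℝ≥0∞}
    (hu : Measurable fun z : ℝ × EuclideanSpace ℝ (Fin N) => u z.1 z.2) (p t : ℝ) :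
    Measurable fun x : EuclideanSpace ℝ (Fin N) => duhamel p α u t x :=
  Measurable.lintegral_prod_right' (measurable_duhamel_integrand h0 h1 hu p t)

/-- The mass of u(s)^p is the measure to which S_α is applied, and Minkowski in s leaves a Beta
integral with parameters α - α/p and 1 - α. The scaling gives back t^(-α/p), the same weight as for
the linear part. -/
lemma duhamel_Lp_le (hN : 1 ≤ N) (hp : p = fujitaExponent N) {α : ℝ} (h0 : 0 < α) (h1 : α < 1)
    {u : ℝ → EuclideanSpace ℝ (Fin N) → ℝ≥0∞}
    (hu : Measurable fun z : ℝ × EuclideanSpace ℝ (Fin N) => u z.1 z.2) {Q : ℝ} (hQ : 0 ≤ Q)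
    (hmass : ∀ s : ℝ, 0 < s → ∫⁻ y, u s y ^ p ≤ ENNReal.ofReal (Q * s ^ (-α))) {t : ℝ}
    (ht : 0 < t) :
    (∫⁻ x, duhamel p α u t x ^ p) ^ (1 / p) ≤
      (∫⁻ θ in Set.Ioi (0 : ℝ), ENNReal.ofReal (θ * wrightDensity α θ) *
        ENNReal.ofReal (θ ^ (-(1 / p)))) * ENNReal.ofReal Q * (ENNReal.ofReal (t ^ (-(α / p))) *
      ∫⁻ r in Set.Ioo (0 : ℝ) 1,
        ENNReal.ofReal ((1 - r) ^ ((α - α / p) - 1) * r ^ ((1 - α) - 1))) := by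
  have hp1 : 1 < p := hp ▸ one_lt_fujitaExponent hN
  have hp0 : 0 < p := by linarith
  have hpi0 : 0 < 1 / p := by positivity
  have hpi : 1 / p < 1 := by rw [div_lt_one hp0]; exact hp1
  set CS := ∫⁻ θ in Set.Ioi (0 : ℝ), ENNReal.ofReal (θ * wrightDensity α θ) *
    ENNReal.ofReal (θ ^ (-(1 / p))) with hCS
  have hCSt : CS ≠ ∞ :=
    (lintegral_mul_wrightDensity_mul_rpow_lt_top h0 h1 (by linarith) (by linarith)).ne
  have hS : ∀ s ∈ Set.Ioo (0 : ℝ) t, (∫⁻ x, (ENNReal.ofReal ((t - s) ^ (α - 1)) *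
      operatorS α (t - s) (volume.withDensity fun y => u s y ^ p) x) ^ p) ^ (1 / p) ≤
        CS * ENNReal.ofReal Q *
        ENNReal.ofReal ((t - s) ^ ((α - α / p) - 1) * s ^ ((1 - α) - 1)) := by
    intro s hs
    have hts : 0 < t - s := by linarith [hs.2]
    have hs0 : 0 < s := hs.1
    have hOS : Measurable fun x : EuclideanSpace ℝ (Fin N) =>
        operatorS α (t - s) (volume.withDensity fun y => u s y ^ p) x :=
      Measurable.comp
      (g := fun z : (ℝ × EuclideanSpace ℝ (Fin N)) × ℝ => operatorS α (z.1.1 - z.2)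
        (volume.withDensity fun y => u z.2 y ^ p) z.1.2)
      (f := fun x : EuclideanSpace ℝ (Fin N) => ((t, x), s))
      (measurable_operatorS h0 h1 (f := fun s y => u s y ^ p) (hu.pow_const p)) (by fun_prop)
    have e1 : ∀ x : EuclideanSpace ℝ (Fin N), (ENNReal.ofReal ((t - s) ^ (α - 1)) *
        operatorS α (t - s) (volume.withDensity fun y => u s y ^ p) x) ^ p =
        ENNReal.ofReal ((t - s) ^ (α - 1)) ^ p *
        operatorS α (t - s) (volume.withDensity fun y => u s y ^ p) x ^ p :=
      fun x => ENNReal.mul_rpow_of_nonneg _ _ hp0.le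
    simp only [e1]
    rw [lintegral_const_mul _ (hOS.pow_const p), ENNReal.mul_rpow_of_nonneg _ _ hpi0.le,
      ← ENNReal.rpow_mul, mul_one_div_cancel hp0.ne', ENNReal.rpow_one]
    have h2 := operator_Lp_le hN hp (α := α)
      (w := fun θ => ENNReal.ofReal (θ * wrightDensity α θ))
      (measurable_id.mul (measurable_wrightDensity h0 h1)).ennreal_ofReal
      (volume.withDensity fun y => u s y ^ p) hts
    rw [withDensity_apply _ MeasurableSet.univ, setLIntegral_univ] at h2
    calc _ ≤ ENNReal.ofReal ((t - s) ^ (α - 1)) *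
          (ENNReal.ofReal ((t - s) ^ (-(α / p))) * CS * ENNReal.ofReal (Q * s ^ (-α))) :=
          mul_le_mul_right (h2.trans (mul_le_mul_right (hmass s hs0) _)) _
      _ = _ := by
          have e2 : (t - s) ^ ((α - α / p) - 1) = (t - s) ^ (α - 1) * (t - s) ^ (-(α / p)) := by
            rw [← Real.rpow_add hts]; ring_nf
          have e3 : (1 - α) - 1 = -α := by ring
          rw [e2, e3, ENNReal.ofReal_mul hQ, ENNReal.ofReal_mul (by positivity),
            ENNReal.ofReal_mul (by positivity)]
          ring
  have hmink := lintegral_lintegral_rpow_le (μ := (volume : Measure (EuclideanSpace ℝ (Fin N))))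
    (ν := volume.restrict (Set.Ioo (0 : ℝ) t)) hp1 (f := fun x s =>
    ENNReal.ofReal ((t - s) ^ (α - 1)) *
    operatorS α (t - s) (volume.withDensity fun y => u s y ^ p) x)
    (measurable_duhamel_integrand h0 h1 hu p t)
  calc _ ≤ ∫⁻ s in Set.Ioo (0 : ℝ) t, CS * ENNReal.ofReal Q *
        ENNReal.ofReal ((t - s) ^ ((α - α / p) - 1) * s ^ ((1 - α) - 1)) :=
        hmink.trans (setLIntegral_mono' measurableSet_Ioo hS)
    _ = _ := by
        have e4 : (α - α / p) + (1 - α) - 1 = -(α / p) := by ring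
        rw [lintegral_const_mul' _ _ (ENNReal.mul_ne_top hCSt ENNReal.ofReal_ne_top),
          setLIntegral_beta_scaled ht, e4]

/-- Global existence for data of small total mass. -/
theorem exists_finiteUpTo_of_small_mass (hN : 1 ≤ N) (hp : p = fujitaExponent N) {α : ℝ}
    (h0 : 0 < α) (h1 : α < 1) :
    ∃ m : ℝ, 0 < m ∧ ∀ μ : Measure (EuclideanSpace ℝ (Fin N)), SFinite μ →
      μ Set.univ ≤ ENNReal.ofReal m → ∀ T : ℝ, FiniteUpTo p α μ T := by
  have hp1 : 1 < p := hp ▸ one_lt_fujitaExponent hN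
  have hp0 : 0 < p := by linarith
  have hpi : 1 / p < 1 := by rw [div_lt_one hp0]; exact hp1
  have hpi0 : 0 < 1 / p := by positivity
  set CP := ∫⁻ θ in Set.Ioi (0 : ℝ), ENNReal.ofReal (wrightDensity α θ) *
    ENNReal.ofReal (θ ^ (-(1 / p))) with hCP
  set CS := ∫⁻ θ in Set.Ioi (0 : ℝ), ENNReal.ofReal (θ * wrightDensity α θ) *
    ENNReal.ofReal (θ ^ (-(1 / p))) with hCS
  have hCPt : CP ≠ ∞ :=
    (lintegral_wrightDensity_mul_rpow_lt_top h0 h1 (by linarith) (by linarith)).ne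
  have hCSt : CS ≠ ∞ :=
    (lintegral_mul_wrightDensity_mul_rpow_lt_top h0 h1 (by linarith) (by linarith)).ne
  set B := ∫⁻ r in Set.Ioo (0 : ℝ) 1,
    ENNReal.ofReal ((1 - r) ^ ((α - α / p) - 1) * r ^ ((1 - α) - 1)) with hB
  have hαp : α / p < α := div_lt_self h0 hp1
  have hBt : B ≠ ∞ := (setLIntegral_beta_lt_top (by linarith) (by linarith)).ne
  set D := (ENNReal.ofReal α * CS * B).toReal with hD
  have hDt : ENNReal.ofReal α * CS * B ≠ ∞ :=
    ENNReal.mul_ne_top (ENNReal.mul_ne_top ENNReal.ofReal_ne_top hCSt) hBt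
  have hD0 : 0 ≤ D := ENNReal.toReal_nonneg
  have hCP0 : 0 ≤ CP.toReal := ENNReal.toReal_nonneg
  -- M^(p-1) = 1/(2(D+1)), so that the nonlinear term uses at most half of M. The mass m below is
  -- chosen so that the linear term uses the other half.
  set M : ℝ := (2 * (D + 1))⁻¹ ^ (1 / (p - 1)) with hM
  have hM0 : 0 < M := by positivity
  have hMp : D * M ^ p ≤ M / 2 := by
    have e : M ^ p = M * (2 * (D + 1))⁻¹ := by
      have e1 : M ^ (p - 1) = (2 * (D + 1))⁻¹ := by
        rw [hM, ← Real.rpow_mul (by positivity), one_div_mul_cancel (by linarith), Real.rpow_one]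
      rw [← e1, ← Real.rpow_one_add' hM0.le (by linarith)]
      congr 1; ring
    rw [e, ← mul_assoc, mul_comm D M, mul_assoc, div_eq_mul_inv]
    refine mul_le_mul_of_nonneg_left ?_ hM0.le
    rw [mul_inv, mul_comm, mul_assoc]
    refine mul_le_of_le_one_right (by norm_num) ?_
    rw [inv_mul_le_iff₀ (by positivity)]
    linarith
  set m : ℝ := M / (2 * (CP.toReal + 1)) with hm
  have hm0 : 0 < m := by positivity
  have hCPm : CP.toReal * m ≤ M / 2 := by
    rw [hm, mul_div_assoc', div_le_div_iff₀ (by positivity) (by norm_num)]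
    nlinarith
  refine ⟨m, hm0, fun μ hμs hμ T => ?_⟩
  -- The weighted bound t^(α/p) ‖u(t)‖_p ≤ M is inherited by each iterate and passes to the limit by
  -- monotone convergence.
  have key : ∀ n, ∀ t : ℝ, 0 < t →
      (∫⁻ x, picard p α μ n t x ^ p) ^ (1 / p) ≤ ENNReal.ofReal (M * t ^ (-(α / p))) := by
    intro n
    induction n with
    | zero =>
      intro t ht
      simp only [picard]
      rw [ENNReal.zero_rpow_of_pos hp0, lintegral_zero, ENNReal.zero_rpow_of_pos hpi0]
      exact zero_le
    | succ n ih =>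
      intro t ht
      have hun := measurable_picard (p := p) (μ := μ) h0 h1 n
      have hOPm : Measurable fun x : EuclideanSpace ℝ (Fin N) => operatorP α t μ x :=
        Measurable.comp (g := fun z : ℝ × EuclideanSpace ℝ (Fin N) => operatorP α z.1 μ z.2)
          (f := fun x => (t, x)) (measurable_operatorP h0 h1 μ) (by fun_prop)
      have hadd := ENNReal.lintegral_Lp_add_le (μ := volume) hOPm.aemeasurable
        ((measurable_duhamel h0 h1 hun p t).const_mul (ENNReal.ofReal α)).aemeasurable hp1.le
      have hP : (∫⁻ x, operatorP α t μ x ^ p) ^ (1 / p) ≤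
          ENNReal.ofReal (M / 2 * t ^ (-(α / p))) := by
        refine (operator_Lp_le hN hp (measurable_wrightDensity h0 h1).ennreal_ofReal μ ht).trans ?_
        calc _ ≤ ENNReal.ofReal (t ^ (-(α / p))) * CP * ENNReal.ofReal m := by gcongr
          _ = ENNReal.ofReal (t ^ (-(α / p)) * (CP.toReal * m)) := by
            rw [ENNReal.ofReal_mul (by positivity), ENNReal.ofReal_mul hCP0,
              ENNReal.ofReal_toReal hCPt, mul_assoc]
          _ ≤ _ := by
            rw [mul_comm]
            gcongr
      have hDu : (∫⁻ x, (ENNReal.ofReal α * duhamel p α (picard p α μ n) t x) ^ p) ^ (1 / p) ≤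
          ENNReal.ofReal (M / 2 * t ^ (-(α / p))) := by
        have e1 : ∀ x, (ENNReal.ofReal α * duhamel p α (picard p α μ n) t x) ^ p =
            ENNReal.ofReal α ^ p * duhamel p α (picard p α μ n) t x ^ p :=
          fun x => ENNReal.mul_rpow_of_nonneg _ _ hp0.le
        simp only [e1]
        rw [lintegral_const_mul _ ((measurable_duhamel h0 h1 hun p t).pow_const p),
          ENNReal.mul_rpow_of_nonneg _ _ hpi0.le, ← ENNReal.rpow_mul, mul_one_div_cancel hp0.ne',
          ENNReal.rpow_one]
        have hmass : ∀ s : ℝ, 0 < s →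
            ∫⁻ y, picard p α μ n s y ^ p ≤ ENNReal.ofReal (M ^ p * s ^ (-α)) := by
          intro s hs0
          have := ENNReal.rpow_le_rpow (ih s hs0) hp0.le
          rw [← ENNReal.rpow_mul, one_div_mul_cancel hp0.ne', ENNReal.rpow_one,
            ENNReal.ofReal_rpow_of_pos (by positivity),
            Real.mul_rpow hM0.le (by positivity), ← Real.rpow_mul hs0.le] at this
          have e : -(α / p) * p = -α := by field_simp
          rwa [e] at this
        calc _ ≤ ENNReal.ofReal α * (CS * ENNReal.ofReal (M ^ p) *
              (ENNReal.ofReal (t ^ (-(α / p))) * B)) :=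
              mul_le_mul_right (duhamel_Lp_le hN hp h0 h1 hun (by positivity) hmass ht) _
          _ = ENNReal.ofReal (D * M ^ p * t ^ (-(α / p))) := by
              rw [ENNReal.ofReal_mul (by positivity),
                ENNReal.ofReal_mul hD0, hD, ENNReal.ofReal_toReal hDt]
              ring
          _ ≤ _ := by gcongr
      calc _ ≤ _ := hadd
        _ ≤ ENNReal.ofReal (M / 2 * t ^ (-(α / p))) + ENNReal.ofReal (M / 2 * t ^ (-(α / p))) :=
          add_le_add hP hDu
        _ = _ := by
          rw [← ENNReal.ofReal_add (by positivity) (by positivity)]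
          congr 1
          ring
  filter_upwards [self_mem_ae_restrict measurableSet_Ioc] with t ht
  have hlim : ∫⁻ x, picardLimit p α μ t x ^ p ≤ ENNReal.ofReal (M * t ^ (-(α / p))) ^ p := by
    simp only [picardLimit, rpow_iSup hp0]
    have hpm : ∀ n, Measurable fun x => picard p α μ n t x := fun n =>
      Measurable.comp (g := fun z : ℝ × EuclideanSpace ℝ (Fin N) => picard p α μ n z.1 z.2)
        (f := fun x => (t, x)) (measurable_picard h0 h1 n) (by fun_prop)
    rw [lintegral_iSup (fun n => (hpm n).pow_const p)
      (fun i j hij x => ENNReal.rpow_le_rpow (monotone_picard hp0.le hij t x) hp0.le)]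
    refine iSup_le fun n => ?_
    rw [← ENNReal.rpow_inv_le_iff hp0, ← one_div]
    exact key n t ht.1
  have hfin : ∫⁻ x, picardLimit p α μ t x ^ p ≠ ∞ :=
    (hlim.trans_lt (ENNReal.rpow_lt_top_of_nonneg hp0.le ENNReal.ofReal_ne_top)).ne
  have hpl : Measurable fun x => picardLimit p α μ t x :=
    Measurable.comp (g := fun z : ℝ × EuclideanSpace ℝ (Fin N) => picardLimit p α μ z.1 z.2)
      (f := fun x => (t, x)) (measurable_picardLimit h0 h1) (by fun_prop)
  filter_upwards [ae_lt_top (hpl.pow_const p) hfin] with x hx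
  exact (ENNReal.rpow_lt_top_iff_of_pos hp0).1 hx

end

section

/-! ### A necessary condition for the existence of solutions -/

/-- A function with `z(t) - z(s) ≥ k z(s)^p log(t/s)` blows up in finite logarithmic time. -/
lemma log_le_of_superlinear_growth {z : ℝ → ℝ} {p k z₀ T₁ T : ℝ} (hp : 1 < p) (hk : 0 < k)
    (hz₀ : 0 < z₀) (hT₁ : 0 < T₁) (hT : T₁ ≤ T) (hstart : z₀ ≤ z T₁)
    (hz : ∀ s t : ℝ, T₁ ≤ s → s ≤ t → t ≤ T → z s + k * Real.log (t / s) * z s ^ p ≤ z t) :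
    Real.log (T / T₁) ≤ z₀ ^ (1 - p) / k * (1 - 2 ^ (1 - p))⁻¹ := by
  by_contra! hcon
  set q : ℝ := 2 ^ (1 - p) with hq
  have hq0 : 0 < q := by positivity
  have hq1 : q < 1 := Real.rpow_lt_one_of_one_lt_of_neg one_lt_two (by linarith)
  -- Logarithmic times at which z has doubled n times: from the value z₀ 2^n, doubling takes
  -- log-time at most (z₀ 2^n)^(1-p)/k, and these form a convergent geometric series.
  set τ : ℕ → ℝ := fun n => ∑ j ∈ Finset.range n, z₀ ^ (1 - p) / k * q ^ j with hτ
  have hτ0 : ∀ n, 0 ≤ τ n := fun n => Finset.sum_nonneg fun j _ => by positivity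
  have hτle : ∀ n, τ n ≤ Real.log (T / T₁) := by
    intro n
    refine le_trans ?_ hcon.le
    simp only [hτ]
    rw [← Finset.mul_sum]
    refine mul_le_mul_of_nonneg_left ?_ (by positivity)
    rw [← tsum_geometric_of_lt_one hq0.le hq1]
    exact (summable_geometric_of_lt_one hq0.le hq1).sum_le_tsum _ fun j _ => by positivity
  have htT : ∀ n, T₁ * Real.exp (τ n) ≤ T := by
    intro n
    have h1 : Real.exp (τ n) ≤ T / T₁ := by
      have hpos : 0 < T / T₁ := div_pos (hT₁.trans_le hT) hT₁
      rw [← Real.exp_log hpos]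
      exact Real.exp_le_exp.2 (hτle n)
    rwa [le_div_iff₀' hT₁] at h1
  have hge : ∀ n, T₁ ≤ T₁ * Real.exp (τ n) := fun n =>
    le_mul_of_one_le_right hT₁.le (Real.one_le_exp (hτ0 n))
  have key : ∀ n : ℕ, z₀ * 2 ^ n ≤ z (T₁ * Real.exp (τ n)) := by
    intro n
    induction n with
    | zero => simpa [hτ] using hstart
    | succ n ih =>
      have hstep : τ (n + 1) = τ n + z₀ ^ (1 - p) / k * q ^ n := Finset.sum_range_succ _ _
      have hle : T₁ * Real.exp (τ n) ≤ T₁ * Real.exp (τ (n + 1)) := by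
        gcongr
        rw [hstep]
        have : 0 ≤ z₀ ^ (1 - p) / k * q ^ n := by positivity
        linarith
      have h1 := hz _ _ (hge n) hle (htT (n + 1))
      have h2 : Real.log (T₁ * Real.exp (τ (n + 1)) / (T₁ * Real.exp (τ n))) =
          z₀ ^ (1 - p) / k * q ^ n := by
        rw [mul_div_mul_left _ _ hT₁.ne', ← Real.exp_sub, Real.log_exp, hstep]
        ring
      rw [h2] at h1
      have hzn : 0 < z₀ * 2 ^ n := by positivity
      have h3 : (z₀ * 2 ^ n) ^ p ≤ z (T₁ * Real.exp (τ n)) ^ p :=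
        Real.rpow_le_rpow hzn.le ih (by linarith)
      have h4 : k * (z₀ ^ (1 - p) / k * q ^ n) * (z₀ * 2 ^ n) ^ p = z₀ * 2 ^ n := by
        have e1 : z₀ ^ (1 - p) * q ^ n = (z₀ * 2 ^ n) ^ (1 - p) := by
          rw [Real.mul_rpow hz₀.le (by positivity), hq, ← Real.rpow_natCast, ← Real.rpow_natCast,
            ← Real.rpow_mul zero_le_two, ← Real.rpow_mul zero_le_two, mul_comm (n : ℝ)]
        have e2 : k * (z₀ ^ (1 - p) / k * q ^ n) = (z₀ * 2 ^ n) ^ (1 - p) := by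
          rw [← e1]; field_simp
        rw [e2, ← Real.rpow_add hzn, sub_add_cancel, Real.rpow_one]
      have h5 : z₀ * 2 ^ n ≤ k * (z₀ ^ (1 - p) / k * q ^ n) *
          z (T₁ * Real.exp (τ n)) ^ p := by
        calc z₀ * 2 ^ n = k * (z₀ ^ (1 - p) / k * q ^ n) * (z₀ * 2 ^ n) ^ p := h4.symm
          _ ≤ _ := mul_le_mul_of_nonneg_left h3 (by positivity)
      rw [pow_succ]
      linarith
  -- All doubling times lie before T, so z(T) would exceed z₀ 2^n for every n.
  obtain ⟨n, hn⟩ := pow_unbounded_of_one_lt (z T / z₀) (one_lt_two (α := ℝ))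
  have h1 := hz _ _ (hge n) (htT n) le_rfl
  have h2 := key n
  have hpos : 0 < T₁ * Real.exp (τ n) := by positivity
  have h3 : 0 ≤ Real.log (T / (T₁ * Real.exp (τ n))) :=
    Real.log_nonneg ((one_le_div hpos).2 (htT n))
  have hzn : 0 < z (T₁ * Real.exp (τ n)) := lt_of_lt_of_le (by positivity) h2
  have h4 : 0 ≤ k * Real.log (T / (T₁ * Real.exp (τ n))) * z (T₁ * Real.exp (τ n)) ^ p := by
    positivity
  rw [div_lt_iff₀' hz₀] at hn
  linarith

/-! ### Mass in parabolic balls -/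

variable {N : ℕ}

/-- The parabolic ball of radius `t^{α/2}`. -/
def parBall (N : ℕ) (α t : ℝ) : Set (EuclideanSpace ℝ (Fin N)) :=
  Metric.closedBall 0 (t ^ (α / 2))

lemma measurableSet_parBall (α t : ℝ) : MeasurableSet (parBall N α t) :=
  measurableSet_closedBall

lemma parBall_mono {α s t : ℝ} (h0 : 0 ≤ α) (hs : 0 ≤ s) (hst : s ≤ t) :
    parBall N α s ⊆ parBall N α t :=
  Metric.closedBall_subset_closedBall (Real.rpow_le_rpow hs hst (by positivity))

lemma le_setLIntegral_heatSemigroup {c ρ τ : ℝ} (μ : Measure (EuclideanSpace ℝ (Fin N)))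
    [SFinite μ] (hc : ∀ y : EuclideanSpace ℝ (Fin N), ‖y‖ ≤ ρ →
      ENNReal.ofReal c ≤ ∫⁻ x in Metric.closedBall 0 ρ, ENNReal.ofReal (heatKernel τ (x - y))) :
    ENNReal.ofReal c * μ (Metric.closedBall 0 ρ) ≤
      ∫⁻ x in Metric.closedBall 0 ρ, heatSemigroup τ μ x := by
  have hm : Measurable (Function.uncurry fun x y : EuclideanSpace ℝ (Fin N) =>
      ENNReal.ofReal (heatKernel τ (x - y))) :=
    (measurable_heatKernel.comp (by fun_prop : Measurable fun z : EuclideanSpace ℝ (Fin N) ×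
      EuclideanSpace ℝ (Fin N) => (τ, z.1 - z.2))).ennreal_ofReal
  unfold heatSemigroup
  rw [lintegral_lintegral_swap hm.aemeasurable, ← setLIntegral_const]
  refine le_trans ?_ (setLIntegral_le_lintegral (Metric.closedBall 0 ρ) _)
  exact setLIntegral_mono' measurableSet_closedBall fun y hy =>
    hc y (mem_closedBall_zero_iff.1 hy)

/-- For τ ≤ t the heat time τ^α θ is at most θ times the squared radius t^α. The fraction of mass
kept is thus at least a multiple of min(1, 1/θ)^(N/2), independent of τ and t. -/
lemma exists_le_setLIntegral_operator : ∃ c : ℝ, 0 < c ∧ ∀ (α : ℝ), 0 < α → ∀ (w : ℝ → ℝ≥0∞),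
    Measurable w → ∀ (μ : Measure (EuclideanSpace ℝ (Fin N))), SFinite μ → ∀ τ t : ℝ, 0 < τ →
      τ ≤ t → ENNReal.ofReal c * (∫⁻ θ in Set.Ioi (0 : ℝ), w θ *
        ENNReal.ofReal (min 1 (1 / θ) ^ ((N : ℝ) / 2))) * μ (parBall N α t) ≤
      ∫⁻ x in parBall N α t, ∫⁻ θ in Set.Ioi (0 : ℝ), w θ * heatSemigroup (τ ^ α * θ) μ x := by
  obtain ⟨c, hc, H⟩ := exists_le_setLIntegral_heatKernel (N := N)
  refine ⟨c, hc, fun α h0 w hw μ hμ τ t hτ hτt => ?_⟩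
  have ht : 0 < t := hτ.trans_le hτt
  have hm : Measurable (Function.uncurry fun (x : EuclideanSpace ℝ (Fin N)) (θ : ℝ) =>
      w θ * heatSemigroup (τ ^ α * θ) μ x) :=
    (hw.comp measurable_snd).mul ((measurable_heatSemigroup μ).comp
      (by fun_prop : Measurable fun z : EuclideanSpace ℝ (Fin N) × ℝ => (τ ^ α * z.2, z.1)))
  have hm2 : ∀ τ : ℝ, Measurable fun x : EuclideanSpace ℝ (Fin N) => heatSemigroup τ μ x :=
    fun τ => (measurable_heatSemigroup μ).comp measurable_prodMk_left
  have hwm : Measurable fun θ : ℝ => w θ * ENNReal.ofReal (min 1 (1 / θ) ^ ((N : ℝ) / 2)) :=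
    hw.mul (by fun_prop)
  rw [lintegral_lintegral_swap hm.aemeasurable, ← lintegral_const_mul _ hwm,
    ← lintegral_mul_const _ (hwm.const_mul _)]
  refine setLIntegral_mono' measurableSet_Ioi fun θ hθ => ?_
  have hθ' : 0 < θ := hθ
  rw [lintegral_const_mul _ (hm2 _)]
  have hρ : 0 < t ^ (α / 2) := by positivity
  have hτθ : 0 < τ ^ α * θ := by positivity
  have hmin : min 1 (1 / θ) ^ ((N : ℝ) / 2) ≤
      min 1 ((t ^ (α / 2)) ^ 2 / (τ ^ α * θ)) ^ ((N : ℝ) / 2) := by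
    refine Real.rpow_le_rpow (by positivity) (min_le_min_left _ ?_) (by positivity)
    have e : (t ^ (α / 2)) ^ 2 = t ^ α := by
      rw [← Real.rpow_mul_natCast ht.le]; congr 1; push_cast; ring
    rw [e, div_le_div_iff₀ hθ' hτθ, one_mul]
    exact mul_le_mul_of_nonneg_right (Real.rpow_le_rpow hτ.le hτt h0.le) hθ'.le
  have h1 := le_setLIntegral_heatSemigroup μ (ρ := t ^ (α / 2)) (τ := τ ^ α * θ)
    (c := c * min 1 ((t ^ (α / 2)) ^ 2 / (τ ^ α * θ)) ^ ((N : ℝ) / 2))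
    (fun y hy => H _ _ hρ hτθ y hy)
  calc _ = w θ * (ENNReal.ofReal c * ENNReal.ofReal (min 1 (1 / θ) ^ ((N : ℝ) / 2)) *
        μ (parBall N α t)) := by ring
    _ ≤ w θ * (ENNReal.ofReal (c * min 1 ((t ^ (α / 2)) ^ 2 / (τ ^ α * θ)) ^ ((N : ℝ) / 2)) *
        μ (parBall N α t)) := by
        rw [← ENNReal.ofReal_mul hc.le]
        gcongr
    _ ≤ _ := mul_le_mul_right h1 _

/-- The operators `P_α` and `S_α` keep a fixed portion of the mass in parabolic balls, uniformly
for `α` away from `0`. -/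
lemma exists_le_setLIntegral_operatorPS {α₀ : ℝ} (h0 : 0 < α₀) (h1 : α₀ < 1) :
    ∃ c : ℝ, 0 < c ∧ ∀ α : ℝ, α₀ ≤ α → α < 1 →
      ∀ (μ : Measure (EuclideanSpace ℝ (Fin N))), SFinite μ → ∀ τ t : ℝ, 0 < τ → τ ≤ t →
        ENNReal.ofReal c * μ (parBall N α t) ≤ ∫⁻ x in parBall N α t, operatorP α τ μ x ∧
        ENNReal.ofReal c * μ (parBall N α t) ≤ ∫⁻ x in parBall N α t, operatorS α τ μ x := by
  obtain ⟨c, hc, H⟩ := exists_le_setLIntegral_operator (N := N)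
  obtain ⟨d, hd, Hd⟩ := exists_le_lintegral_wrightDensity h0 h1 ((N : ℝ) / 2)
  refine ⟨c * d, mul_pos hc hd, fun α hα hα1 μ hμ τ t hτ hτt => ?_⟩
  have hα0 := h0.trans_le hα
  obtain ⟨hP, hS⟩ := Hd α hα hα1
  have hwm := measurable_wrightDensity hα0 hα1
  rw [ENNReal.ofReal_mul hc.le]
  constructor
  · refine le_trans ?_ (H α hα0 _ hwm.ennreal_ofReal μ hμ τ t hτ hτt)
    gcongr
  · refine le_trans ?_ (H α hα0 (fun θ => ENNReal.ofReal (θ * wrightDensity α θ))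
      (measurable_id.mul hwm).ennreal_ofReal μ hμ τ t hτ hτt)
    gcongr

/-- The integral of `u(t)^p` over the parabolic ball. -/
def powMass (p α : ℝ) (u : ℝ → EuclideanSpace ℝ (Fin N) → ℝ≥0∞) (t : ℝ) : ℝ≥0∞ :=
  ∫⁻ x in parBall N α t, u t x ^ p

lemma measurable_powMass {p α : ℝ} {u : ℝ → EuclideanSpace ℝ (Fin N) → ℝ≥0∞}
    (hu : Measurable fun z : ℝ × EuclideanSpace ℝ (Fin N) => u z.1 z.2) :
    Measurable (powMass p α u) := by
  have hS : MeasurableSet {z : ℝ × EuclideanSpace ℝ (Fin N) | ‖z.2‖ ≤ z.1 ^ (α / 2)} :=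
    measurableSet_le (by fun_prop) (by fun_prop)
  have e : ∀ t, powMass p α u t = ∫⁻ x,
      {z : ℝ × EuclideanSpace ℝ (Fin N) | ‖z.2‖ ≤ z.1 ^ (α / 2)}.indicator
        (fun z => u z.1 z.2 ^ p) (t, x) := by
    intro t
    rw [powMass, ← lintegral_indicator (measurableSet_parBall α t)]
    refine lintegral_congr fun x => ?_
    simp [Set.indicator, parBall]
  rw [funext e]
  exact Measurable.lintegral_prod_right' ((hu.pow_const p).indicator hS)

/-- Hölder on a ball of volume proportional to t^(αN/2). As (p - 1)N/2 = 1, the volume factor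
becomes t^α: this is where criticality enters the nonexistence part. -/
lemma setLIntegral_rpow_le_powMass (hN : 1 ≤ N) {p α t : ℝ} (hp : p = fujitaExponent N)
    (ht : 0 < t) {u : ℝ → EuclideanSpace ℝ (Fin N) → ℝ≥0∞} (hu : Measurable (u t)) :
    (∫⁻ x in parBall N α t, u t x) ^ p ≤ powMass p α u t *
      (ENNReal.ofReal (t ^ α) *
        volume (Metric.ball (0 : EuclideanSpace ℝ (Fin N)) 1) ^ (p - 1)) := by
  have hN' : (0 : ℝ) < N := by exact_mod_cast hN
  have hp1 : 1 < p := hp ▸ one_lt_fujitaExponent hN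
  have hp0 : 0 < p := by linarith
  have hq : p.HolderConjugate (p / (p - 1)) := Real.HolderConjugate.conjExponent hp1
  have hH := ENNReal.lintegral_mul_le_Lp_mul_Lq (volume.restrict (parBall N α t)) hq
    (f := u t) (g := fun _ => (1 : ℝ≥0∞)) hu.aemeasurable aemeasurable_const
  have e1 : ∀ x, (u t * fun _ : EuclideanSpace ℝ (Fin N) => (1 : ℝ≥0∞)) x = u t x :=
    fun x => by simp
  simp only [e1, ENNReal.one_rpow] at hH
  rw [setLIntegral_const, one_mul] at hH
  have h2 := ENNReal.rpow_le_rpow hH hp0.le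
  have e2 : 1 / (p / (p - 1)) * p = p - 1 := by field_simp
  rw [ENNReal.mul_rpow_of_nonneg _ _ hp0.le, ← ENNReal.rpow_mul, ← ENNReal.rpow_mul,
    one_div_mul_cancel hp0.ne', ENNReal.rpow_one, e2] at h2
  have e3 : ((t ^ (α / 2)) ^ N) ^ (p - 1) = t ^ α := by
    rw [← Real.rpow_mul_natCast ht.le, ← Real.rpow_mul ht.le, hp, fujitaExponent]
    congr 1
    field_simp
    ring
  refine h2.trans (le_of_eq ?_)
  rw [powMass, parBall, Measure.addHaar_closedBall _ _ (by positivity), finrank_euclideanSpace_fin,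
    ENNReal.mul_rpow_of_nonneg _ _ (by linarith), ENNReal.ofReal_rpow_of_pos (by positivity), e3]

/-- Parabolic balls grow with time, so mass present in the ball at time s < t is still counted at
time t. The memory kernel (t-s)^(α-1) is replaced by its lower bound T^(α-1), and sources before T₁
are dropped. -/
lemma le_setLIntegral_mildRHS {p α c : ℝ} (hα0 : 0 < α) (hα1 : α < 1)
    (hc : ∀ (μ : Measure (EuclideanSpace ℝ (Fin N))), SFinite μ → ∀ τ t : ℝ, 0 < τ → τ ≤ t →
        ENNReal.ofReal c * μ (parBall N α t) ≤ ∫⁻ x in parBall N α t, operatorP α τ μ x ∧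
        ENNReal.ofReal c * μ (parBall N α t) ≤ ∫⁻ x in parBall N α t, operatorS α τ μ x)
    (μ : Measure (EuclideanSpace ℝ (Fin N))) [SFinite μ]
    {u : ℝ → EuclideanSpace ℝ (Fin N) → ℝ≥0∞}
    (hu : Measurable fun z : ℝ × EuclideanSpace ℝ (Fin N) => u z.1 z.2) {T₁ t T : ℝ}
    (hT₁ : 0 < T₁) (ht : T₁ ≤ t) (htT : t ≤ T) :
    ENNReal.ofReal c * μ (parBall N α T₁) + ENNReal.ofReal (α * T ^ (α - 1)) *
      (ENNReal.ofReal c * ∫⁻ s in Set.Ioo T₁ t, powMass p α u s) ≤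
      ∫⁻ x in parBall N α t, mildRHS p α μ u t x := by
  have ht0 : 0 < t := hT₁.trans_le ht
  have hT0 : 0 < T := ht0.trans_le htT
  have hOPm : Measurable fun x : EuclideanSpace ℝ (Fin N) => operatorP α t μ x :=
    Measurable.comp (g := fun z : ℝ × EuclideanSpace ℝ (Fin N) => operatorP α z.1 μ z.2)
      (f := fun x => (t, x)) (measurable_operatorP hα0 hα1 μ) (by fun_prop)
  simp only [mildRHS_eq]
  rw [lintegral_add_left hOPm, lintegral_const_mul _ (measurable_duhamel hα0 hα1 hu p t)]
  refine add_le_add ?_ ?_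
  · refine le_trans ?_ (hc μ inferInstance t t ht0 le_rfl).1
    gcongr
    exact parBall_mono hα0.le hT₁.le ht
  · rw [ENNReal.ofReal_mul hα0.le, mul_assoc]
    refine mul_le_mul_right ?_ _
    unfold duhamel
    rw [lintegral_lintegral_swap (f := fun x s => ENNReal.ofReal ((t - s) ^ (α - 1)) *
      operatorS α (t - s) (volume.withDensity fun y => u s y ^ p) x)
      (measurable_duhamel_integrand hα0 hα1 hu p t).aemeasurable,
      ← lintegral_const_mul _ (measurable_powMass hu),
      ← lintegral_const_mul _ ((measurable_powMass hu).const_mul _)]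
    refine le_trans ?_ (lintegral_mono_set (Set.Ioo_subset_Ioo_left hT₁.le))
    refine setLIntegral_mono' measurableSet_Ioo fun s hs => ?_
    have hs0 : 0 < s := hT₁.trans hs.1
    have hts : 0 < t - s := sub_pos.2 hs.2
    rw [lintegral_const_mul' _ _ ENNReal.ofReal_ne_top]
    have h1 : T ^ (α - 1) ≤ (t - s) ^ (α - 1) :=
      Real.rpow_le_rpow_of_nonpos hts (by linarith) (by linarith)
    have h2 : powMass p α u s ≤
        (volume.withDensity fun y => u s y ^ p) (parBall N α t) := by
      rw [withDensity_apply _ (measurableSet_parBall α t)]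
      exact lintegral_mono_set (parBall_mono hα0.le hs0.le hs.2.le)
    calc _ ≤ ENNReal.ofReal ((t - s) ^ (α - 1)) * (ENNReal.ofReal c *
          (volume.withDensity fun y => u s y ^ p) (parBall N α t)) := by gcongr
      _ ≤ _ := mul_le_mul_right (hc _ inferInstance (t - s) t hts (by linarith)).2 _

/-- Finiteness at a single point (t, x) with t > T suffices: seen from there, all sources in the
ball up to time T contribute with weights bounded below, because t - s stays between t - T and t. It
allows the growth argument to be carried out with real numbers. -/
lemma setLIntegral_powMass_lt_top {p α T₁ T T' : ℝ} (hp : 0 < p) (h0 : 0 < α) (h1 : α < 1)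
    (hT₁ : 0 < T₁) (hT : T₁ ≤ T) (hT' : T < T') (μ : Measure (EuclideanSpace ℝ (Fin N)))
    [SFinite μ] (hfin : FiniteUpTo p α μ T') :
    ∫⁻ s in Set.Ioo T₁ T, powMass p α (picardLimit p α μ) s < ∞ := by
  have hT0 : 0 < T := hT₁.trans_le hT
  obtain ⟨t, ⟨htT, -⟩, hx⟩ : ∃ t ∈ Set.Ioc T T', ∀ᵐ x, picardLimit p α μ t x < ∞ := by
    have hne : (ae (volume.restrict (Set.Ioc T T'))).NeBot := by
      rw [ae_neBot, Ne, Measure.restrict_eq_zero, Real.volume_Ioc, ENNReal.ofReal_eq_zero]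
      linarith
    have h2 := ae_restrict_of_ae_restrict_of_subset
      (Set.Ioc_subset_Ioc_left hT0.le : Set.Ioc T T' ⊆ Set.Ioc 0 T') hfin
    have h3 : ∀ᵐ s ∂(volume.restrict (Set.Ioc T T')), s ∈ Set.Ioc T T' :=
      self_mem_ae_restrict measurableSet_Ioc
    exact (h3.and h2).exists
  obtain ⟨x, hx⟩ := hx.exists
  have ht0 : 0 < t := hT0.trans htT
  set D := ‖x‖ + T ^ (α / 2) with hD
  -- A lower bound for the heat kernel common to all s < T and all y in the ball: the longest time
  -- in the prefactor, the shortest time and largest distance in the exponential.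
  set g : ℝ → ℝ := fun θ => (4 * Real.pi * (t ^ α * θ)) ^ (-((N : ℝ) / 2)) *
    Real.exp (-D ^ 2 / (4 * ((t - T) ^ α * θ))) with hg
  have hgm : Measurable g := by fun_prop
  have htT' : 0 < t - T := sub_pos.2 htT
  have hgpos : ∀ θ : ℝ, 0 < θ → 0 < g θ := fun θ hθ => by
    have := Real.pi_pos
    simp only [hg]
    positivity
  set J := ∫⁻ θ in Set.Ioi (0 : ℝ), ENNReal.ofReal (θ * wrightDensity α θ) *
    ENNReal.ofReal (g θ) with hJ
  have hwm : Measurable fun θ => ENNReal.ofReal (θ * wrightDensity α θ) :=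
    (measurable_id.mul (measurable_wrightDensity h0 h1)).ennreal_ofReal
  have hwg : Measurable fun θ => ENNReal.ofReal (θ * wrightDensity α θ) *
      ENNReal.ofReal (g θ) := hwm.mul hgm.ennreal_ofReal
  -- The average with exponent 0 shows that the positive part of θ h_α does not vanish almost
  -- everywhere, and g is strictly positive.
  have hJ0 : J ≠ 0 := by
    intro hJz
    obtain ⟨d, hd, Hd⟩ := exists_le_lintegral_wrightDensity h0 h1 0
    have h3 := (Hd α le_rfl h1).2
    rw [hJ, lintegral_eq_zero_iff hwg] at hJz
    have h4 : ∫⁻ θ in Set.Ioi (0 : ℝ), ENNReal.ofReal (θ * wrightDensity α θ) *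
        ENNReal.ofReal (min 1 (1 / θ) ^ (0 : ℝ)) = 0 := by
      refine (lintegral_congr_ae ?_).trans lintegral_zero
      filter_upwards [hJz, self_mem_ae_restrict measurableSet_Ioi] with θ hθ hθ'
      have h5 := (mul_eq_zero.1 hθ).resolve_right (by
        rw [ENNReal.ofReal_eq_zero, not_le]; exact hgpos θ hθ')
      rw [h5, zero_mul]
    rw [h4, nonpos_iff_eq_zero, ENNReal.ofReal_eq_zero] at h3
    linarith
  have hker : ∀ s ∈ Set.Ioo T₁ T, J * powMass p α (picardLimit p α μ) s ≤
      operatorS α (t - s) (volume.withDensity fun y => picardLimit p α μ s y ^ p) x := by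
    intro s hs
    have hs0 : 0 < s := hT₁.trans hs.1
    have hts : 0 < t - s := by linarith [hs.2]
    rw [hJ, ← lintegral_mul_const _ hwg]
    refine setLIntegral_mono' measurableSet_Ioi fun θ hθ => ?_
    have hθ' : 0 < θ := hθ
    rw [mul_assoc]
    refine mul_le_mul_right ?_ _
    have hmass : powMass p α (picardLimit p α μ) s ≤
        (volume.withDensity fun y => picardLimit p α μ s y ^ p) (parBall N α T) := by
      rw [withDensity_apply _ (measurableSet_parBall α T)]
      exact lintegral_mono_set (parBall_mono h0.le hs0.le hs.2.le)
    refine (mul_le_mul_right hmass _).trans ?_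
    rw [← setLIntegral_const]
    refine le_trans ?_ (setLIntegral_le_lintegral (parBall N α T) _)
    refine setLIntegral_mono' (measurableSet_parBall α T) fun y hy =>
      ENNReal.ofReal_le_ofReal ?_
    have hπ := Real.pi_pos
    have hnorm : ‖x - y‖ ≤ D :=
      (norm_sub_le x y).trans (add_le_add le_rfl (mem_closedBall_zero_iff.1 hy))
    have hpow1 : (t - T) ^ α ≤ (t - s) ^ α :=
      Real.rpow_le_rpow htT'.le (by linarith [hs.2]) h0.le
    have hpow2 : (t - s) ^ α ≤ t ^ α := Real.rpow_le_rpow hts.le (by linarith) h0.le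
    simp only [hg, heatKernel]
    refine mul_le_mul ?_ (Real.exp_le_exp.2 ?_) (Real.exp_pos _).le (by positivity)
    · refine Real.rpow_le_rpow_of_nonpos (by positivity) (by gcongr) ?_
      have : (0 : ℝ) ≤ N := Nat.cast_nonneg N
      linarith
    · rw [neg_div, neg_div, neg_le_neg_iff]
      gcongr
  have hRHS : mildRHS p α μ (picardLimit p α μ) t x < ∞ := by
    rwa [← picardLimit_eq hp h0 h1]
  have hduh : ENNReal.ofReal α * duhamel p α (picardLimit p α μ) t x < ∞ :=
    lt_of_le_of_lt le_add_self hRHS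
  have hlow : ENNReal.ofReal α * (ENNReal.ofReal (t ^ (α - 1)) * J) *
      ∫⁻ s in Set.Ioo T₁ T, powMass p α (picardLimit p α μ) s < ∞ := by
    refine lt_of_le_of_lt ?_ hduh
    rw [mul_assoc]
    refine mul_le_mul_right ?_ _
    rw [← lintegral_const_mul _ (measurable_powMass (measurable_picardLimit h0 h1))]
    unfold duhamel
    refine le_trans ?_ (lintegral_mono_set (Set.Ioo_subset_Ioo hT₁.le htT.le))
    refine setLIntegral_mono' measurableSet_Ioo fun s hs => ?_
    rw [mul_assoc]
    have hts : 0 < t - s := by linarith [hs.2]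
    have hs0 : 0 < s := hT₁.trans hs.1
    refine mul_le_mul' (ENNReal.ofReal_le_ofReal ?_) (hker s hs)
    exact Real.rpow_le_rpow_of_nonpos hts (by linarith) (by linarith)
  refine ENNReal.lt_top_of_mul_ne_top_right hlow.ne ?_
  have : 0 < t ^ (α - 1) := by positivity
  simp [hJ0, h0, this]

end

/-! ### From mass to a logarithmic bound on the existence time -/

section

variable {N : ℕ}

lemma setLIntegral_Ioo_inv {s t : ℝ} (hs : 0 < s) (hst : s ≤ t) :
    ∫⁻ r in Set.Ioo s t, ENNReal.ofReal r⁻¹ = ENNReal.ofReal (Real.log (t / s)) := by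
  have hint : IntervalIntegrable (fun r : ℝ => r⁻¹) volume s t :=
    intervalIntegral.intervalIntegrable_inv (fun r hr => by
      rw [Set.uIcc_of_le hst] at hr
      exact (hs.trans_le hr.1).ne') continuousOn_id
  rw [← integral_inv_of_pos hs (hs.trans_le hst), intervalIntegral.integral_of_le hst,
    ← restrict_Ioo_eq_restrict_Ioc,
    ofReal_integral_eq_lintegral_ofReal]
  · exact (intervalIntegrable_iff_integrableOn_Ioo_of_le hst).1 hint
  · filter_upwards [self_mem_ae_restrict measurableSet_Ioo] with r hr
    exact inv_nonneg.2 (hs.trans hr.1).le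

/-- A lower bound for the mass of the initial datum in a parabolic ball limits the time up to which
the minimal solution is finite, uniformly for `α` away from `0`. -/
theorem exists_log_mul_rpow_le (hN : 1 ≤ N) {p α₀ : ℝ} (hp : p = fujitaExponent N) (h0 : 0 < α₀)
    (h1 : α₀ < 1) :
    ∃ C : ℝ, 0 < C ∧ ∀ α : ℝ, α₀ ≤ α → α < 1 →
      ∀ (μ : Measure (EuclideanSpace ℝ (Fin N))), SFinite μ → ∀ T₁ T T' m : ℝ, 0 < T₁ → T₁ ≤ T →
        T < T' → (1 - α) * Real.log (T / T₁) ≤ 1 → FiniteUpTo p α μ T' → 0 < m →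
          ENNReal.ofReal m ≤ μ (parBall N α T₁) → Real.log (T / T₁) * m ^ (p - 1) ≤ C := by
  obtain ⟨c, hc, H⟩ := exists_le_setLIntegral_operatorPS (N := N) h0 h1
  have hp1 : 1 < p := hp ▸ one_lt_fujitaExponent hN
  have hp0 : 0 < p := by linarith
  set ω := volume (Metric.ball (0 : EuclideanSpace ℝ (Fin N)) 1) with hω
  have hωtop : ω ≠ ∞ := measure_ball_lt_top.ne
  have hω0 : 0 < ω.toReal :=
    ENNReal.toReal_pos (Metric.measure_ball_pos _ _ one_pos).ne' hωtop
  set k : ℝ := α₀ * c / ω.toReal ^ (p - 1) * Real.exp (-1) with hk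
  have hk0 : 0 < k := by positivity
  have hq1 : (2 : ℝ) ^ (1 - p) < 1 :=
    Real.rpow_lt_one_of_one_lt_of_neg one_lt_two (by linarith)
  refine ⟨c ^ (1 - p) / k * (1 - 2 ^ (1 - p))⁻¹, mul_pos (by positivity)
    (inv_pos.2 (by linarith)), fun α hα hα1 μ hμ T₁ T T' m hT₁ hT hT' hlog hfin hm hmass => ?_⟩
  have hα0 : 0 < α := h0.trans_le hα
  have hT0 : 0 < T := hT₁.trans_le hT
  set u := picardLimit p α μ with hu
  have hum : Measurable fun z : ℝ × EuclideanSpace ℝ (Fin N) => u z.1 z.2 :=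
    measurable_picardLimit hα0 hα1
  set I : ℝ → ℝ≥0∞ := fun t => ∫⁻ s in Set.Ioo T₁ t, powMass p α u s with hI
  have hImono : Monotone I := fun s t hst =>
    lintegral_mono_set (Set.Ioo_subset_Ioo_right hst)
  have hItop : ∀ t, t ≤ T → I t ≠ ∞ := fun t ht =>
    ((hImono ht).trans_lt (setLIntegral_powMass_lt_top hp0 hα0 hα1 hT₁ hT hT' μ hfin)).ne
  -- A real, monotone minorant of the integral of u(t) over the parabolic ball. The factor α is
  -- replaced by α₀ to keep the constants uniform.
  set z : ℝ → ℝ := fun t => c * m + α₀ * T ^ (α - 1) * (c * (I t).toReal) with hz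
  have hz0 : ∀ t, 0 < z t := fun t => by positivity
  have hzmono : ∀ s t, s ≤ t → t ≤ T → z s ≤ z t := by
    intro s t hst ht
    have := ENNReal.toReal_mono (hItop t ht) (hImono hst)
    simp only [hz]
    gcongr
  have hzU : ∀ t, T₁ ≤ t → t ≤ T → ENNReal.ofReal (z t) ≤ ∫⁻ x in parBall N α t, u t x := by
    intro t ht htT
    have h2 := le_setLIntegral_mildRHS (p := p) hα0 hα1 (H α hα hα1) μ hum hT₁ ht htT
    simp only [hu, ← picardLimit_eq hp0 hα0 hα1] at h2
    refine le_trans ?_ h2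
    rw [hz, ENNReal.ofReal_add (by positivity) (by positivity), ENNReal.ofReal_mul hc.le,
      ENNReal.ofReal_mul (by positivity), ENNReal.ofReal_mul hc.le, ENNReal.ofReal_toReal (hItop t htT)]
    gcongr
  have hpow : ∀ t, T₁ ≤ t → t ≤ T →
      ENNReal.ofReal (z t ^ p / (t ^ α * ω.toReal ^ (p - 1))) ≤ powMass p α u t := by
    intro t ht htT
    have ht0 : 0 < t := hT₁.trans_le ht
    have humt : Measurable (u t) :=
      Measurable.comp (g := fun z : ℝ × EuclideanSpace ℝ (Fin N) => u z.1 z.2)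
        (f := fun x => (t, x)) hum (by fun_prop)
    have h2 := setLIntegral_rpow_le_powMass hN hp (α := α) ht0 humt
    have h3 := (ENNReal.rpow_le_rpow (hzU t ht htT) hp0.le).trans h2
    rw [ENNReal.ofReal_rpow_of_pos (hz0 t), ← hω, ← ENNReal.ofReal_toReal hωtop,
      ENNReal.ofReal_rpow_of_pos hω0, ← ENNReal.ofReal_mul (by positivity)] at h3
    rw [ENNReal.ofReal_div_of_pos (by positivity)]
    exact ENNReal.div_le_of_le_mul h3
  have hgrow : ∀ s t : ℝ, T₁ ≤ s → s ≤ t → t ≤ T →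
      z s + k * Real.log (t / s) * z s ^ p ≤ z t := by
    intro s t hs hst ht
    have hs0 : 0 < s := hT₁.trans_le hs
    have hlog0 : 0 ≤ Real.log (t / s) := Real.log_nonneg ((one_le_div hs0).2 hst)
    -- For r ≥ T₁ one has r^(-α) ≥ T₁^(1-α)/r; this produces the logarithm for every α.
    set d : ℝ := z s ^ p * T₁ ^ (1 - α) / ω.toReal ^ (p - 1) with hd
    have hzs := hz0 s
    have hd0 : 0 ≤ d := by positivity
    have h2 : I s + ENNReal.ofReal (d * Real.log (t / s)) ≤ I t := by
      have h3 : ENNReal.ofReal (d * Real.log (t / s)) ≤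
          ∫⁻ r in Set.Ioo s t, powMass p α u r := by
        rw [ENNReal.ofReal_mul hd0, ← setLIntegral_Ioo_inv hs0 hst,
          ← lintegral_const_mul' _ _ ENNReal.ofReal_ne_top]
        refine setLIntegral_mono' measurableSet_Ioo fun r hr => ?_
        have hr0 : 0 < r := hs0.trans hr.1
        refine le_trans ?_ (hpow r (hs.trans hr.1.le) (hr.2.le.trans ht))
        rw [← ENNReal.ofReal_mul hd0]
        refine ENNReal.ofReal_le_ofReal ?_
        have h4 : z s ^ p ≤ z r ^ p :=
          Real.rpow_le_rpow hzs.le (hzmono s r hr.1.le (hr.2.le.trans ht)) hp0.le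
        have h5 : T₁ ^ (1 - α) * r⁻¹ ≤ (r ^ α)⁻¹ := by
          have : T₁ ^ (1 - α) ≤ r ^ (1 - α) :=
            Real.rpow_le_rpow hT₁.le (hs.trans hr.1.le) (by linarith)
          calc T₁ ^ (1 - α) * r⁻¹ ≤ r ^ (1 - α) * r⁻¹ := by gcongr
            _ = (r ^ α)⁻¹ := by
              rw [Real.rpow_sub hr0, Real.rpow_one]
              field_simp
        calc d * r⁻¹ = z s ^ p * (T₁ ^ (1 - α) * r⁻¹) / ω.toReal ^ (p - 1) := by
              rw [hd]; ring
          _ ≤ z r ^ p * (r ^ α)⁻¹ / ω.toReal ^ (p - 1) := by gcongr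
          _ = _ := by field_simp
      refine (add_le_add le_rfl h3).trans ?_
      simp only [hI]
      rw [← lintegral_union measurableSet_Ioo
        (Set.disjoint_left.2 fun r hr hr' => lt_asymm hr.2 hr'.1)]
      refine lintegral_mono_set (Set.union_subset (Set.Ioo_subset_Ioo_right hst)
        (Set.Ioo_subset_Ioo_left hs))
    have h3 : (I s).toReal + d * Real.log (t / s) ≤ (I t).toReal := by
      have h4 := ENNReal.toReal_mono (hItop t ht) h2
      rwa [ENNReal.toReal_add (hItop s (hst.trans ht)) ENNReal.ofReal_ne_top,
        ENNReal.toReal_ofReal (by positivity)] at h4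
    -- The loss (T₁/T)^(1-α) from the memory kernel is at least 1/e by the hypothesis on log(T/T₁).
    have h4 : Real.exp (-1) ≤ T ^ (α - 1) * T₁ ^ (1 - α) := by
      have e : T ^ (α - 1) * T₁ ^ (1 - α) = Real.exp (-((1 - α) * Real.log (T / T₁))) := by
        rw [Real.rpow_def_of_pos hT0, Real.rpow_def_of_pos hT₁, ← Real.exp_add,
          Real.log_div hT0.ne' hT₁.ne']
        congr 1
        ring
      rw [e]
      exact Real.exp_le_exp.2 (by linarith)
    have h5 : k * Real.log (t / s) * z s ^ p ≤
        α₀ * T ^ (α - 1) * (c * (d * Real.log (t / s))) := by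
      calc k * Real.log (t / s) * z s ^ p = α₀ * c / ω.toReal ^ (p - 1) * Real.log (t / s) *
            z s ^ p * Real.exp (-1) := by rw [hk]; ring
        _ ≤ α₀ * c / ω.toReal ^ (p - 1) * Real.log (t / s) *
            z s ^ p * (T ^ (α - 1) * T₁ ^ (1 - α)) := by gcongr
        _ = _ := by rw [hd]; ring
    calc z s + k * Real.log (t / s) * z s ^ p ≤
          z s + α₀ * T ^ (α - 1) * (c * (d * Real.log (t / s))) := by gcongr
      _ = c * m + α₀ * T ^ (α - 1) * (c * ((I s).toReal + d * Real.log (t / s))) := by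
          simp only [hz]; ring
      _ ≤ z t := by simp only [hz]; gcongr
  have hend := log_le_of_superlinear_growth hp1 hk0 (z₀ := c * m) (by positivity) hT₁ hT
    (by simp only [hz]; exact le_add_of_nonneg_right (by positivity)) hgrow
  calc Real.log (T / T₁) * m ^ (p - 1)
      ≤ (c * m) ^ (1 - p) / k * (1 - 2 ^ (1 - p))⁻¹ * m ^ (p - 1) := by gcongr
    _ = c ^ (1 - p) / k * (1 - 2 ^ (1 - p))⁻¹ * (m ^ (1 - p) * m ^ (p - 1)) := by
        rw [Real.mul_rpow hc.le hm.le]; ring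
    _ = _ := by rw [← Real.rpow_add hm]; simp

end

section

/-! ### The initial data `κ (1 + |x|)^{-A}` -/

variable {N : ℕ}

instance (A κ : ℝ) : SFinite (decayingDatum N A κ) := by
  unfold decayingDatum
  infer_instance

lemma decayingDatum_le_smul_volume {A κ : ℝ} (hA : 0 ≤ A) (hκ : 0 ≤ κ) :
    decayingDatum N A κ ≤ ENNReal.ofReal κ • volume := by
  rw [decayingDatum, ← withDensity_const]
  refine withDensity_mono (Filter.Eventually.of_forall fun x => ENNReal.ofReal_le_ofReal ?_)
  exact mul_le_of_le_one_right hκ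
    (Real.rpow_le_one_of_one_le_of_nonpos (by linarith [norm_nonneg x]) (by linarith))

lemma decayingDatum_mono (A : ℝ) {κ κ' : ℝ} (h : κ ≤ κ') :
    decayingDatum N A κ ≤ decayingDatum N A κ' :=
  withDensity_mono (Filter.Eventually.of_forall fun x => ENNReal.ofReal_le_ofReal
    (mul_le_mul_of_nonneg_right h (by positivity)))

lemma exists_decayingDatum_univ_le {A m : ℝ} (hA : (N : ℝ) < A) (hm : 0 < m) :
    ∃ κ : ℝ, 0 < κ ∧ decayingDatum N A κ Set.univ ≤ ENNReal.ofReal m := by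
  have hint : Integrable (fun x : EuclideanSpace ℝ (Fin N) => (1 + ‖x‖) ^ (-A)) volume :=
    integrable_one_add_norm (by simpa using hA)
  set M := ∫ x : EuclideanSpace ℝ (Fin N), (1 + ‖x‖) ^ (-A) with hM
  have hM0 : 0 ≤ M := integral_nonneg fun x => by positivity
  refine ⟨m / (M + 1), by positivity, ?_⟩
  rw [decayingDatum, withDensity_apply _ MeasurableSet.univ, Measure.restrict_univ,
    ← ofReal_integral_eq_lintegral_ofReal (hint.const_mul _)
      (Filter.Eventually.of_forall fun x => by positivity), integral_const_mul, ← hM]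
  refine ENNReal.ofReal_le_ofReal ?_
  rw [div_mul_eq_mul_div, div_le_iff₀ (by positivity)]
  nlinarith

lemma exists_le_decayingDatum_closedBall (A : ℝ) (hA : 0 ≤ A) :
    ∃ c : ℝ, 0 < c ∧ ∀ κ R : ℝ, 0 ≤ κ → 1 ≤ R →
      ENNReal.ofReal (c * κ) ≤ decayingDatum N A κ (Metric.closedBall 0 R) := by
  set ω := volume (Metric.closedBall (0 : EuclideanSpace ℝ (Fin N)) 1) with hω
  have hωtop : ω ≠ ∞ := measure_closedBall_lt_top.ne
  have hω0 : 0 < ω.toReal :=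
    ENNReal.toReal_pos (Metric.measure_closedBall_pos _ _ one_pos).ne' hωtop
  refine ⟨2 ^ (-A) * ω.toReal, by positivity, fun κ R hκ hR => ?_⟩
  refine le_trans ?_ (measure_mono (Metric.closedBall_subset_closedBall hR))
  rw [decayingDatum, withDensity_apply _ measurableSet_closedBall]
  calc _ = ENNReal.ofReal (κ * 2 ^ (-A)) * ω := by
        rw [← ENNReal.ofReal_toReal hωtop, ← ENNReal.ofReal_mul (by positivity),
          ENNReal.toReal_ofReal hω0.le]
        congr 1
        ring
    _ = ∫⁻ x in Metric.closedBall (0 : EuclideanSpace ℝ (Fin N)) 1,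
        ENNReal.ofReal (κ * 2 ^ (-A)) := by rw [setLIntegral_const]
    _ ≤ _ := by
        refine setLIntegral_mono' measurableSet_closedBall fun x hx =>
          ENNReal.ofReal_le_ofReal (mul_le_mul_of_nonneg_left ?_ hκ)
        have := mem_closedBall_zero_iff.1 hx
        exact Real.rpow_le_rpow_of_nonpos (by positivity) (by linarith) (by linarith)

/-- For y ≥ 1 one has 1 + y ≤ 2y, so the integrand is at least 2^(-N)/y. -/
lemma log_le_integral_pow_mul_rpow (hN : 1 ≤ N) {R : ℝ} (hR : 1 ≤ R) :
    2 ^ (-(N : ℝ)) * Real.log R ≤ ∫ y in (1 : ℝ)..R, y ^ (N - 1) * (1 + y) ^ (-(N : ℝ)) := by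
  have h0 : ∀ y ∈ Set.uIcc 1 R, 0 < y := fun y hy => by
    rw [Set.uIcc_of_le hR] at hy
    linarith [hy.1]
  rw [← div_one R, ← integral_inv_of_pos one_pos (by linarith), div_one,
    ← intervalIntegral.integral_const_mul]
  refine intervalIntegral.integral_mono_on hR ?_ ?_ fun y hy => ?_
  · refine (intervalIntegral.intervalIntegrable_inv (fun r hr => (h0 r hr).ne')
      continuousOn_id).const_mul _
  · refine ContinuousOn.intervalIntegrable fun y hy => ContinuousAt.continuousWithinAt ?_
    have := h0 y hy
    exact (by fun_prop : ContinuousAt (fun y : ℝ => y ^ (N - 1)) y).mul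
      (ContinuousAt.rpow_const (by fun_prop) (Or.inl (by linarith)))
  · have hy0 : 0 < y := by linarith [hy.1]
    have h1 : (2 * y) ^ (-(N : ℝ)) ≤ (1 + y) ^ (-(N : ℝ)) :=
      Real.rpow_le_rpow_of_nonpos (by positivity) (by linarith [hy.1]) (by simp)
    have h2 : y ^ (N - 1) * y ^ (-(N : ℝ)) = y⁻¹ := by
      rw [← Real.rpow_natCast, ← Real.rpow_add hy0, Nat.cast_sub hN, ← Real.rpow_neg_one]
      congr 1
      push_cast
      ring
    calc 2 ^ (-(N : ℝ)) * y⁻¹ = y ^ (N - 1) * (2 * y) ^ (-(N : ℝ)) := by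
          rw [← h2, Real.mul_rpow zero_le_two hy0.le]; ring
      _ ≤ _ := by gcongr

/-- Polar coordinates: with the decay |x|^(-N) the mass diverges logarithmically, which is the extra
factor separating A = N from A > N. -/
lemma exists_log_le_decayingDatum_closedBall (hN : 1 ≤ N) :
    ∃ c : ℝ, 0 < c ∧ ∀ κ R : ℝ, 0 ≤ κ → 1 ≤ R →
      ENNReal.ofReal (c * κ * Real.log R) ≤
        decayingDatum N (N : ℝ) κ (Metric.closedBall 0 R) := by
  set b : ℝ := volume.real (Metric.ball (0 : EuclideanSpace ℝ (Fin N)) 1) with hb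
  have hb0 : 0 < b := ENNReal.toReal_pos (Metric.measure_ball_pos _ _ one_pos).ne'
    measure_ball_lt_top.ne
  have hN' : (0 : ℝ) < N := by exact_mod_cast hN
  have : Nonempty (Fin N) := ⟨⟨0, hN⟩⟩
  refine ⟨N * b * 2 ^ (-(N : ℝ)), by positivity, fun κ R hκ hR => ?_⟩
  set f : ℝ → ℝ := (Set.Iic R).indicator fun y => (1 + y) ^ (-(N : ℝ)) with hf
  have hfx : ∀ x : EuclideanSpace ℝ (Fin N), f ‖x‖ =
      (Metric.closedBall 0 R).indicator (fun x => (1 + ‖x‖) ^ (-(N : ℝ))) x := fun x => by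
    simp [hf, Set.indicator]
  have hon : IntegrableOn (fun x : EuclideanSpace ℝ (Fin N) => (1 + ‖x‖) ^ (-(N : ℝ)))
      (Metric.closedBall 0 R) := by
    refine ContinuousOn.integrableOn_compact (isCompact_closedBall _ _)
      (Continuous.continuousOn ?_)
    exact Continuous.rpow_const (by fun_prop) fun x => Or.inl (by positivity)
  have hint : Integrable fun x : EuclideanSpace ℝ (Fin N) => f ‖x‖ := by
    simp only [hfx]
    exact (integrable_indicator_iff measurableSet_closedBall).2 hon
  have hint' := (integrable_fun_norm_addHaar (volume : Measure (EuclideanSpace ℝ (Fin N)))).1 hint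
  have hpolar := integral_fun_norm_addHaar (volume : Measure (EuclideanSpace ℝ (Fin N))) f
  simp only [finrank_euclideanSpace_fin, smul_eq_mul, nsmul_eq_mul] at hint' hpolar
  have hlow : 2 ^ (-(N : ℝ)) * Real.log R ≤ ∫ y in Set.Ioi (0 : ℝ), y ^ (N - 1) * f y := by
    refine (log_le_integral_pow_mul_rpow hN hR).trans ?_
    rw [intervalIntegral.integral_of_le hR]
    refine le_trans (le_of_eq ?_) (setIntegral_mono_set hint' ?_
      (Filter.Eventually.of_forall fun y (hy : y ∈ Set.Ioc 1 R) => zero_lt_one.trans hy.1))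
    · refine setIntegral_congr_fun measurableSet_Ioc fun y hy => ?_
      simp [hf, hy.2]
    · filter_upwards [self_mem_ae_restrict measurableSet_Ioi] with y hy
      have hy0 : (0 : ℝ) < y := hy
      simp only [hf, Set.indicator_apply]
      split_ifs <;> first | rfl | positivity
  rw [decayingDatum, withDensity_apply _ measurableSet_closedBall,
    ← ofReal_integral_eq_lintegral_ofReal (hon.const_mul κ)
      (Filter.Eventually.of_forall fun x => by positivity), integral_const_mul,
    ← integral_indicator measurableSet_closedBall]
  simp only [← hfx]
  rw [hpolar]
  refine ENNReal.ofReal_le_ofReal ?_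
  calc N * b * 2 ^ (-(N : ℝ)) * κ * Real.log R
      = κ * (N * (b * (2 ^ (-(N : ℝ)) * Real.log R))) := by ring
    _ ≤ _ := by gcongr

end

section

/-! ### Estimates of the life span -/

variable {N : ℕ}

/-- The mass bound is applied on [T₁, T] with T₁ = T e^(-L), the longest logarithmic interval that
meets two constraints explained by the two terms of the minimum. -/
lemma exists_min_log_mul_rpow_le (hN : 1 ≤ N) {p α₀ : ℝ} (hp : p = fujitaExponent N) (h0 : 0 < α₀)
    (h1 : α₀ < 1) :
    ∃ C : ℝ, 0 < C ∧ ∀ α : ℝ, α₀ ≤ α → α < 1 →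
      ∀ (μ : Measure (EuclideanSpace ℝ (Fin N))), SFinite μ → ∀ T m : ℝ, 1 < T →
        ENNReal.ofReal T < lifeSpan p α μ → 0 < m →
        ENNReal.ofReal m ≤ μ (Metric.closedBall 0 (T ^ (α / 4))) →
          min (Real.log T / 2) (1 / (1 - α)) * m ^ (p - 1) ≤ C := by
  obtain ⟨C, hC, H⟩ := exists_log_mul_rpow_le hN hp h0 h1
  have hp0 : 0 < p := by linarith [hp ▸ one_lt_fujitaExponent hN]
  refine ⟨C, hC, fun α hα hα1 μ hμ T m hT hlife hm hmass => ?_⟩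
  have hα0 : 0 < α := h0.trans_le hα
  have hα1' : 0 < 1 - α := by linarith
  have hT0 : 0 < T := by linarith
  have hlogT : 0 < Real.log T := Real.log_pos hT
  -- L ≤ (log T)/2 keeps T₁ ≥ √T, so the initial parabolic ball contains the ball of radius T^(α/4);
  -- L ≤ 1/(1-α) limits the kernel loss to a factor e.
  set L := min (Real.log T / 2) (1 / (1 - α)) with hL
  have hL0 : 0 < L := lt_min (by positivity) (by positivity)
  obtain ⟨T', hT', hT'2⟩ := ENNReal.lt_iff_exists_nnreal_btwn.1 hlife
  rw [← ENNReal.ofReal_coe_nnreal] at hT' hT'2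
  have hTT' : T < T' := ((ENNReal.ofReal_lt_ofReal_iff_of_nonneg hT0.le).1 hT')
  have hlog : Real.log (T / (T * Real.exp (-L))) = L := by
    rw [Real.log_div hT0.ne' (by positivity), Real.log_mul hT0.ne' (Real.exp_pos _).ne',
      Real.log_exp]
    ring
  have h2 := H α hα hα1 μ hμ (T * Real.exp (-L)) T T' m (by positivity)
    (mul_le_of_le_one_right hT0.le (Real.exp_le_one_iff.2 (by linarith))) hTT'
    (by
      rw [hlog]
      calc (1 - α) * L ≤ (1 - α) * (1 / (1 - α)) := by gcongr; exact min_le_right _ _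
        _ = 1 := by field_simp)
    (finiteUpTo_of_lt_lifeSpan hp0 hα0 hα1 hT'2) hm
    (hmass.trans (measure_mono (Metric.closedBall_subset_closedBall ?_)))
  · rwa [hlog] at h2
  · have h3 : T ^ ((1 : ℝ) / 2) ≤ T * Real.exp (-L) := by
      rw [Real.rpow_def_of_pos hT0]
      nth_rewrite 2 [← Real.exp_log hT0]
      rw [← Real.exp_add]
      exact Real.exp_le_exp.2 (by linarith [min_le_left (Real.log T / 2) (1 / (1 - α))])
    calc T ^ (α / 4) = (T ^ ((1 : ℝ) / 2)) ^ (α / 2) := by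
          rw [← Real.rpow_mul hT0.le]; congr 1; ring
      _ ≤ _ := Real.rpow_le_rpow (by positivity) h3 (by positivity)

/-- The bound by log T is trivial as T > 1. The other is y e^(-y) ≤ 1 with y = (1-α)(log T)/2, which
accounts for the power T^((α-1)/2) in the result. -/
lemma rpow_mul_log_le_min {α T : ℝ} (hα : α < 1) (hT : 1 < T) :
    T ^ ((α - 1) / 2) * Real.log T ≤ 2 * min (Real.log T / 2) (1 / (1 - α)) := by
  have hT0 : 0 < T := by linarith
  have hlogT : 0 < Real.log T := Real.log_pos hT
  have hα' : 0 < 1 - α := by linarith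
  rw [mul_min_of_nonneg _ _ zero_le_two]
  refine le_min ?_ ?_
  · have : T ^ ((α - 1) / 2) ≤ 1 :=
      Real.rpow_le_one_of_one_le_of_nonpos hT.le (by linarith)
    nlinarith
  · set y := (1 - α) / 2 * Real.log T with hy
    have hy0 : 0 < y := by positivity
    have e : T ^ ((α - 1) / 2) = (Real.exp y)⁻¹ := by
      rw [Real.rpow_def_of_pos hT0, ← Real.exp_neg, hy]
      congr 1
      ring
    have h2 : y ≤ Real.exp y := by linarith [Real.add_one_le_exp y]
    have e2 : Real.log T = y * (2 * (1 / (1 - α))) := by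
      rw [hy]; field_simp
    rw [e, e2, ← mul_assoc]
    refine mul_le_of_le_one_left (by positivity) ?_
    rw [inv_mul_le_one₀ (Real.exp_pos y)]
    exact h2

/-- The estimates concern times strictly before the life span; continuity carries them to the life
span itself. If it is at most 1, the logarithm is nonpositive. -/
lemma rpow_mul_log_le_of_forall_lt {a B T₀ : ℝ} (hT₀ : 0 < T₀) (hB : 0 ≤ B)
    (h : ∀ T, 1 < T → T < T₀ → T ^ a * Real.log T ≤ B) : T₀ ^ a * Real.log T₀ ≤ B := by
  rcases le_or_gt T₀ 1 with h1 | h1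
  · exact (mul_nonpos_of_nonneg_of_nonpos (by positivity)
      (Real.log_nonpos hT₀.le h1)).trans hB
  · have hc : ContinuousAt (fun T : ℝ => T ^ a * Real.log T) T₀ :=
      (Real.continuousAt_rpow_const _ _ (Or.inl hT₀.ne')).mul (Real.continuousAt_log hT₀.ne')
    refine le_of_tendsto (hc.tendsto.mono_left (nhdsWithin_le_nhds (s := Set.Iio T₀))) ?_
    filter_upwards [Ioo_mem_nhdsLT h1] with T hT
    exact h T hT.1 hT.2

lemma lifeSpan_decayingDatum_pos {p α A κ : ℝ} (hp : 0 < p) (h0 : 0 < α) (h1 : α < 1)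
    (hA : 0 ≤ A) (hκ : 0 ≤ κ) : 0 < lifeSpan p α (decayingDatum N A κ) := by
  obtain ⟨T, hT, hfin⟩ := exists_finiteUpTo_of_le_smul_volume hp h0 h1 ENNReal.ofReal_ne_top
    (decayingDatum_le_smul_volume (N := N) hA hκ)
  exact (ENNReal.ofReal_pos.2 hT).trans_le (hfin.le_lifeSpan hp h0 h1 hT)

/-- Global existence for small data with `A > N`. -/
lemma exists_lifeSpan_eq_top (hN : 1 ≤ N) {p α A : ℝ} (hp : p = fujitaExponent N) (h0 : 0 < α)
    (h1 : α < 1) (hA : (N : ℝ) < A) :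
    ∃ κ : ℝ, 0 < κ ∧ lifeSpan p α (decayingDatum N A κ) = ⊤ := by
  have hp0 : 0 < p := by linarith [hp ▸ one_lt_fujitaExponent hN]
  obtain ⟨m, hm, H⟩ := exists_finiteUpTo_of_small_mass hN hp h0 h1
  obtain ⟨κ, hκ, hmass⟩ := exists_decayingDatum_univ_le hA hm
  refine ⟨κ, hκ, ENNReal.eq_top_of_forall_nnreal_le fun r => ?_⟩
  have h2 := (H _ inferInstance hmass (r + 1)).le_lifeSpan hp0 h0 h1 (by positivity)
  refine le_trans ?_ h2
  rw [← ENNReal.ofReal_coe_nnreal]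
  exact ENNReal.ofReal_le_ofReal (by linarith)

/-- The critical size of the initial data: the supremum of all `κ` with global existence. -/
def criticalSize (N : ℕ) (p A α : ℝ) : ℝ :=
  sSup {κ : ℝ | 0 < κ ∧ lifeSpan p α (decayingDatum N A κ) = ⊤}

/-- Only the mass in the unit ball is used; for A > N the total mass is finite, so larger balls
could improve just the constant. -/
lemma exists_min_log_mul_rpow_size_le (hN : 1 ≤ N) {p A α₀ : ℝ} (hp : p = fujitaExponent N)
    (hA : 0 ≤ A) (h0 : 0 < α₀) (h1 : α₀ < 1) :
    ∃ C : ℝ, 0 < C ∧ ∀ α : ℝ, α₀ ≤ α → α < 1 → ∀ κ T : ℝ, 0 < κ → 1 < T →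
      ENNReal.ofReal T < lifeSpan p α (decayingDatum N A κ) →
        min (Real.log T / 2) (1 / (1 - α)) * κ ^ (p - 1) ≤ C := by
  obtain ⟨C, hC, H⟩ := exists_min_log_mul_rpow_le hN hp h0 h1
  obtain ⟨c, hc, Hc⟩ := exists_le_decayingDatum_closedBall (N := N) A hA
  refine ⟨C / c ^ (p - 1), by positivity, fun α hα hα1 κ T hκ hT hlife => ?_⟩
  have h2 := H α hα hα1 _ inferInstance T (c * κ) hT hlife (by positivity)
    (Hc κ _ hκ.le (Real.one_le_rpow hT.le (by linarith)))
  rw [Real.mul_rpow hc.le hκ.le] at h2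
  rw [le_div_iff₀ (by positivity)]
  linarith

lemma exists_min_log_mul_log_rpow_le (hN : 1 ≤ N) {p α₀ : ℝ} (hp : p = fujitaExponent N)
    (h0 : 0 < α₀) (h1 : α₀ < 1) :
    ∃ C : ℝ, 0 < C ∧ ∀ α : ℝ, α₀ ≤ α → α < 1 → ∀ κ T : ℝ, 0 < κ → 1 < T →
      ENNReal.ofReal T < lifeSpan p α (decayingDatum N (N : ℝ) κ) →
        min (Real.log T / 2) (1 / (1 - α)) * (κ * Real.log T) ^ (p - 1) ≤ C := by
  obtain ⟨C, hC, H⟩ := exists_min_log_mul_rpow_le hN hp h0 h1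
  obtain ⟨c, hc, Hc⟩ := exists_log_le_decayingDatum_closedBall hN
  refine ⟨C / (c * α₀ / 4) ^ (p - 1), by positivity, fun α hα hα1 κ T hκ hT hlife => ?_⟩
  have hlogT : 0 < Real.log T := Real.log_pos hT
  have h2 := H α hα hα1 _ inferInstance T (c * α₀ / 4 * (κ * Real.log T)) hT hlife
    (by positivity) (le_trans (ENNReal.ofReal_le_ofReal ?_)
      (Hc κ _ hκ.le (Real.one_le_rpow hT.le (by linarith : 0 ≤ α / 4))))
  · rw [Real.mul_rpow (by positivity) (by positivity)] at h2
    rw [le_div_iff₀ (by positivity)]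
    linarith
  · rw [Real.log_rpow (by linarith)]
    calc c * α₀ / 4 * (κ * Real.log T) = c * κ * (α₀ / 4 * Real.log T) := by ring
      _ ≤ _ := by gcongr

lemma one_le_min_log {α T : ℝ} (h0 : 0 < α) (h1 : α < 1) (hT : Real.exp 2 ≤ T) :
    1 ≤ min (Real.log T / 2) (1 / (1 - α)) := by
  have h2 := Real.log_le_log (Real.exp_pos 2) hT
  rw [Real.log_exp] at h2
  refine le_min (by linarith) ?_
  rw [le_div_iff₀ (by linarith)]
  linarith

/-- For infinite life span the estimate may be used at T = e², where the minimum is at least 1; it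
then reads κ^(p-1) ≤ C. -/
lemma bddAbove_lifeSpan_eq_top (hN : 1 ≤ N) {p α A : ℝ} (hp : p = fujitaExponent N)
    (hA : 0 ≤ A) (h0 : 0 < α) (h1 : α < 1) :
    BddAbove {κ : ℝ | 0 < κ ∧ lifeSpan p α (decayingDatum N A κ) = ⊤} := by
  have hp1 : 1 < p := hp ▸ one_lt_fujitaExponent hN
  obtain ⟨C, hC, H⟩ := exists_min_log_mul_rpow_size_le hN hp hA h0 h1
  refine ⟨C ^ (p - 1)⁻¹, fun κ ⟨hκ, hlife⟩ => ?_⟩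
  have h2 := H α le_rfl h1 κ (Real.exp 2) hκ (Real.one_lt_exp_iff.2 two_pos)
    (hlife ▸ ENNReal.ofReal_lt_top)
  have h3 : κ ^ (p - 1) ≤ C :=
    (le_mul_of_one_le_left (by positivity) (one_le_min_log h0 h1 le_rfl)).trans h2
  rwa [Real.le_rpow_inv_iff_of_pos hκ.le hC.le (by linarith)]

lemma criticalSize_pos (hN : 1 ≤ N) {p α A : ℝ} (hp : p = fujitaExponent N)
    (hA : (N : ℝ) < A) (h0 : 0 < α) (h1 : α < 1) : 0 < criticalSize N p A α := by
  obtain ⟨κ, hκ, hlife⟩ := exists_lifeSpan_eq_top hN hp h0 h1 hA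
  exact hκ.trans_le (le_csSup (bddAbove_lifeSpan_eq_top hN hp
    ((Nat.cast_nonneg N).trans hA.le) h0 h1) ⟨hκ, hlife⟩)

lemma lifeSpan_eq_top_of_lt_criticalSize (hN : 1 ≤ N) {p α A κ : ℝ} (hp : p = fujitaExponent N)
    (hA : (N : ℝ) < A) (h0 : 0 < α) (h1 : α < 1) (hκ : κ < criticalSize N p A α) :
    lifeSpan p α (decayingDatum N A κ) = ⊤ := by
  have hp0 : 0 < p := by linarith [hp ▸ one_lt_fujitaExponent hN]
  obtain ⟨κ₁, hκ₁⟩ := exists_lifeSpan_eq_top hN hp h0 h1 hA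
  obtain ⟨κ', ⟨-, hlife⟩, hlt⟩ := exists_lt_of_lt_csSup ⟨κ₁, hκ₁⟩ hκ
  exact top_le_iff.1 (hlife ▸ lifeSpan_anti hp0 h0 h1 (decayingDatum_mono A hlt.le))

lemma lifeSpan_lt_top_of_criticalSize_lt (hN : 1 ≤ N) {p α A κ : ℝ} (hp : p = fujitaExponent N)
    (hA : (N : ℝ) < A) (h0 : 0 < α) (h1 : α < 1) (hκ : criticalSize N p A α < κ) :
    lifeSpan p α (decayingDatum N A κ) < ⊤ := by
  refine lt_top_iff_ne_top.2 fun h => hκ.not_ge ?_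
  exact le_csSup (bddAbove_lifeSpan_eq_top hN hp ((Nat.cast_nonneg N).trans hA.le) h0 h1)
    ⟨(criticalSize_pos hN hp hA h0 h1).trans hκ, h⟩

/-- The life span for `A > N` and supercritical data. -/
theorem exists_lifeSpan_estimate (hN : 1 ≤ N) {p A α₀ : ℝ} (hp : p = fujitaExponent N)
    (hA : (N : ℝ) < A) (h0 : 0 < α₀) (h1 : α₀ < 1) :
    ∃ C : ℝ, 0 < C ∧ ∀ α : ℝ, α₀ ≤ α → α < 1 → ∀ κ : ℝ, criticalSize N p A α < κ →
      ∃ T : ℝ, 0 < T ∧ lifeSpan p α (decayingDatum N A κ) = ENNReal.ofReal T ∧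
        T ^ ((α - 1) / 2) * Real.log T ≤ C * κ ^ (-(p - 1)) := by
  have hp0 : 0 < p := by linarith [hp ▸ one_lt_fujitaExponent hN]
  have hA0 : 0 ≤ A := (Nat.cast_nonneg N).trans hA.le
  obtain ⟨C, hC, H⟩ := exists_min_log_mul_rpow_size_le hN hp hA0 h0 h1
  refine ⟨2 * C, by positivity, fun α hα hα1 κ hκ => ?_⟩
  have hα0 : 0 < α := h0.trans_le hα
  have hκ0 : 0 < κ := (criticalSize_pos hN hp hA hα0 hα1).trans hκ
  have htop := lifeSpan_lt_top_of_criticalSize_lt hN hp hA hα0 hα1 hκ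
  have hpos := lifeSpan_decayingDatum_pos (N := N) hp0 hα0 hα1 hA0 hκ0.le
  have hT : 0 < (lifeSpan p α (decayingDatum N A κ)).toReal :=
    ENNReal.toReal_pos hpos.ne' htop.ne
  refine ⟨_, hT, (ENNReal.ofReal_toReal htop.ne).symm,
    rpow_mul_log_le_of_forall_lt hT (by positivity) fun T hT1 hTlt => ?_⟩
  have h2 := H α hα hα1 κ T hκ0 hT1 ((ENNReal.ofReal_lt_iff_lt_toReal (by linarith) htop.ne).2 hTlt)
  have h3 := rpow_mul_log_le_min hα1 hT1
  rw [Real.rpow_neg hκ0.le, ← div_eq_mul_inv, le_div_iff₀ (by positivity)]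
  calc _ ≤ 2 * min (Real.log T / 2) (1 / (1 - α)) * κ ^ (p - 1) := by gcongr
    _ ≤ 2 * C := by linarith

/-- The life span for `A = N`. -/
theorem exists_lifeSpan_estimate_critical_decay (hN : 1 ≤ N) {p α₀ : ℝ}
    (hp : p = fujitaExponent N) (h0 : 0 < α₀) (h1 : α₀ < 1) :
    ∃ C : ℝ, 0 < C ∧ ∀ α : ℝ, α₀ ≤ α → α < 1 → ∀ κ : ℝ, 0 < κ →
      ∃ T : ℝ, 0 < T ∧ lifeSpan p α (decayingDatum N (N : ℝ) κ) = ENNReal.ofReal T ∧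
        T ^ ((α - 1) / (2 * p)) * Real.log T ≤ C * κ ^ (-((p - 1) / p)) := by
  have hp1 : 1 < p := hp ▸ one_lt_fujitaExponent hN
  have hp0 : 0 < p := by linarith
  obtain ⟨C, hC, H⟩ := exists_min_log_mul_log_rpow_le hN hp h0 h1
  refine ⟨(2 * C) ^ p⁻¹, by positivity, fun α hα hα1 κ hκ => ?_⟩
  have hα0 : 0 < α := h0.trans_le hα
  have htop : lifeSpan p α (decayingDatum N (N : ℝ) κ) < ⊤ := by
    refine lt_top_iff_ne_top.2 fun hlife => ?_
    -- At log T = b + 2 the estimate would give κ(b + 2) ≤ C^(1/(p-1)) = κb. The summand 2 provides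
    -- both the contradiction and T ≥ e².
    set b := C ^ (p - 1)⁻¹ / κ with hb
    have hb0 : 0 < b := by positivity
    have h2 := H α hα hα1 κ (Real.exp (b + 2)) hκ (Real.one_lt_exp_iff.2 (by positivity))
      (hlife ▸ ENNReal.ofReal_lt_top)
    have h3 : (κ * Real.log (Real.exp (b + 2))) ^ (p - 1) ≤ C := by
      refine le_trans (le_mul_of_one_le_left ?_ (one_le_min_log hα0 hα1
        (Real.exp_le_exp.2 (by linarith)))) h2
      rw [Real.log_exp]
      positivity
    rw [Real.log_exp, ← Real.le_rpow_inv_iff_of_pos (by positivity) hC.le (by linarith)] at h3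
    have h4 : κ * b = C ^ (p - 1)⁻¹ := by rw [hb]; field_simp
    nlinarith
  have hpos := lifeSpan_decayingDatum_pos (N := N) hp0 hα0 hα1 (Nat.cast_nonneg N) hκ.le
  have hT : 0 < (lifeSpan p α (decayingDatum N (N : ℝ) κ)).toReal :=
    ENNReal.toReal_pos hpos.ne' htop.ne
  refine ⟨_, hT, (ENNReal.ofReal_toReal htop.ne).symm,
    rpow_mul_log_le_of_forall_lt hT (by positivity) fun T hT1 hTlt => ?_⟩
  have h2 := H α hα hα1 κ T hκ hT1 ((ENNReal.ofReal_lt_iff_lt_toReal (by linarith) htop.ne).2 hTlt)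
  have h3 := rpow_mul_log_le_min hα1 hT1
  have hT0 : 0 < T := by linarith
  have hl : 0 < Real.log T := Real.log_pos hT1
  -- The mass contributes (κ log T)^(p-1) and the time interval one more log T. Together they form
  -- (log T)^p, hence the p-th roots in the result.
  have h4 : (T ^ ((α - 1) / (2 * p)) * Real.log T) ^ p ≤ 2 * C * κ ^ (-(p - 1)) := by
    rw [Real.mul_rpow (by positivity) hl.le, ← Real.rpow_mul hT0.le,
      Real.rpow_neg hκ.le, ← div_eq_mul_inv, le_div_iff₀ (by positivity)]
    have e1 : (α - 1) / (2 * p) * p = (α - 1) / 2 := by field_simp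
    have e2 : Real.log T ^ p = Real.log T * Real.log T ^ (p - 1) := by
      rw [← Real.rpow_one_add' hl.le (by linarith)]; congr 1; ring
    calc _ = T ^ ((α - 1) / 2) * Real.log T * (κ * Real.log T) ^ (p - 1) := by
          rw [e1, e2, Real.mul_rpow hκ.le hl.le]; ring
      _ ≤ 2 * min (Real.log T / 2) (1 / (1 - α)) * (κ * Real.log T) ^ (p - 1) := by gcongr
      _ ≤ 2 * C := by linarith
  have e3 : (2 * C) ^ p⁻¹ * κ ^ (-((p - 1) / p)) = (2 * C * κ ^ (-(p - 1))) ^ p⁻¹ := by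
    rw [Real.mul_rpow (x := 2 * C) (by positivity) (by positivity), ← Real.rpow_mul hκ.le]
    congr 2
    ring
  rw [e3]
  exact (Real.le_rpow_inv_iff_of_pos (by positivity) (by positivity) hp0).2 h4

end

end TimeFractionalFujita

end

theorem mainTheorem10 (N : ℕ) (hN : 1 ≤ N) (p A : ℝ)
    (hp : p = TimeFractionalFujita.fujitaExponent N) (hA : 2 / (p - 1) ≤ A) :
    ((N : ℝ) < A →
      ∃ K : ℝ → ℝ,
        (∀ α : ℝ, 0 < α → α < 1 →
          0 < K α ∧
          ∀ κ : ℝ, 0 < κ → κ < K α →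
            TimeFractionalFujita.lifeSpan p α
              (TimeFractionalFujita.decayingDatum N A κ) = ⊤) ∧
        (∀ α₀ : ℝ, 0 < α₀ → α₀ < 1 →
          ∃ C : ℝ, 0 < C ∧
            ∀ α : ℝ, α₀ ≤ α → α < 1 → ∀ κ : ℝ, K α < κ →
              ∃ T : ℝ, 0 < T ∧
                TimeFractionalFujita.lifeSpan p α
                  (TimeFractionalFujita.decayingDatum N A κ) = ENNReal.ofReal T ∧
                T ^ ((α - 1) / 2) * Real.log T ≤ C * κ ^ (-(p - 1)))) ∧
    (A = (N : ℝ) →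
      ∀ α₀ : ℝ, 0 < α₀ → α₀ < 1 →
        ∃ C κ₀ : ℝ, 0 < C ∧ 0 < κ₀ ∧
          ∀ α : ℝ, α₀ ≤ α → α < 1 → ∀ κ : ℝ, 0 < κ → κ < κ₀ →
            ∃ T : ℝ, 0 < T ∧
              TimeFractionalFujita.lifeSpan p α
                (TimeFractionalFujita.decayingDatum N A κ) = ENNReal.ofReal T ∧
              T ^ ((α - 1) / (2 * p)) * Real.log T ≤ C * κ ^ (-((p - 1) / p))) := by
  refine ⟨fun hAN => ⟨TimeFractionalFujita.criticalSize N p A, fun α h0 h1 =>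
    ⟨TimeFractionalFujita.criticalSize_pos hN hp hAN h0 h1, fun κ _ hκ =>
      TimeFractionalFujita.lifeSpan_eq_top_of_lt_criticalSize hN hp hAN h0 h1 hκ⟩,
    fun α₀ h0 h1 => TimeFractionalFujita.exists_lifeSpan_estimate hN hp hAN h0 h1⟩, ?_⟩
  rintro rfl α₀ h0 h1
  obtain ⟨C, hC, H⟩ :=
    TimeFractionalFujita.exists_lifeSpan_estimate_critical_decay hN hp h0 h1
  -- Any κ₀ works: for A = N the estimate holds for every κ > 0.
  exact ⟨C, 1, hC, one_pos, fun α hα hα1 κ hκ _ => H α hα hα1 κ hκ⟩
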